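/- Let $N\subset(0,\infty)$ be a finite (possibly empty) set. Call $v$ a density of class $\mathcal H^*_N$ on $(0,\infty)$ if it satisfies a Hölder condition on every compact interval of $(0,\infty)\setminus N$; on each side (within $(0,\infty)$) of each node $c\in N\cup\{0\}$ it has near $c$ the form $|t-c|^{-\alpha}\varphi(t)$ with $\alpha<1$ and $\varphi$ satisfying a Hölder condition up to $c$; and near infinity it has the form $t^{-\beta}\psi(1/t)$ with $\beta>0$ and $\psi$ satisfying a Hölder condition up to $0$. Call $H$ sectionally analytic with branch cut along the positive semi-axis if it is analytic in $\mathbb C\setminus[0,\infty)$, has boundary values $H^+(t)$, $H^-(t)$ from the upper and the lower half-plane at every $t\in(0,\infty)\setminus N$, both of class $\mathcal H^*_N$, satisfies $H(z)=O(|z-c|^{-\alpha})$ with some $\alpha<1$ near each $c\in N\cup\{0\}$, and is regular at infinity in the sense that $H(z)=O(|z|^{-\beta})$ with some $\beta>0$ as $z\to\infty$ off the cut. Consider the equation $$\frac1{\pi i}\int_0^\infty\frac{v(\mu)}{\mu-t}\,d\mu=H(t)$$ for an unknown density $v$ of class $\mathcal H^*_N$. Equality of densities is understood on $(0,\infty)\setminus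 N$. (1) Complex $t$. For a given function $H$ the equation has a solution $v$ (for all $t\in\mathbb C\setminus[0,\infty)$) if and only if $H$ is sectionally analytic. The solution is unique if it exists, and $v(t)=\tfrac12\left(H^+(t)-H^-(t)\right)$ for $t\in(0,\infty)\setminus N$. (2) $t$ on the positive semi-axis. Here the right side is a function $h$ on $(0,\infty)\setminus N$, and the integral is taken along a path passing the pole $\mu=t$ from below, that is, the equation reads $$v(t)+\frac1{\pi i}\,\mathrm{P}\!\!\int_0^\infty\frac{v(\mu)}{\mu-t}\,d\mu=h(t),\qquad t\in(0,\infty)\setminus N.$$ It has a solution $v$ if and only if $h=H^+$ on $(0,\infty)\setminus N$ for some sectionally analytic function $H$. The solution is unique if it exists, and for every such $H$ one has $\frac1{\pi i}\int_0^\infty\frac{v(\mu)}{\mu-z}\,d\mu=H(z)$ off the cut and $v(t)=\tfrac12\left(H^+(t)-H^-(t)\right)$ for $t\in(0,\infty)\setminus N$. -/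

import Mathlib

open Filter Topology MeasureTheory Set Asymptotics
open scoped NNReal

/-- The complex plane cut along the closed positive semi-axis `[0, ∞)`. -/
def cutPlane : Set ℂ := {z | ¬ (0 ≤ z.re ∧ z.im = 0)}

/-- `f` satisfies a Hölder condition on `s` (some positive exponent, some constant). -/
def IsHolderOn (f : ℝ → ℂ) (s : Set ℝ) : Prop :=
  ∃ C r : ℝ≥0, 0 < r ∧ HolderOnWith C r f s

/-- The classical class of densities on `(0, ∞)` with nodes `0`, `∞` and the points of the finite
set `N ⊆ (0, ∞)`: locally Hölder continuous away from the nodes; on each side of a finite node `c`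
it is `|t - c| ^ (-α)` (`α < 1`) times a function that is Hölder continuous up to `c`; near `∞` it
is `t ^ (-β)` (`β > 0`) times a function of `1 / t` that is Hölder continuous up to `0`.
Only the values on `(0, ∞) \ N` matter. -/
structure IsNodalHolder (N : Finset ℝ) (f : ℝ → ℂ) : Prop where
  locally_holder : ∀ a b : ℝ, (∀ t ∈ Icc a b, 0 < t ∧ t ∉ N) → IsHolderOn f (Icc a b)
  right_of_node : ∀ c : ℝ, (c = 0 ∨ c ∈ N) → ∃ α < (1 : ℝ), ∃ δ > 0,
    IsHolderOn (fun t => ((|t - c| ^ α : ℝ) : ℂ) * f t) (Ioo c (c + δ))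
  left_of_node : ∀ c ∈ N, ∃ α < (1 : ℝ), ∃ δ > 0,
    IsHolderOn (fun t => ((|t - c| ^ α : ℝ) : ℂ) * f t) (Ioo (c - δ) c)
  at_infinity : ∃ β > (0 : ℝ), ∃ δ > 0,
    IsHolderOn (fun s => ((s ^ (-β) : ℝ) : ℂ) * f (1 / s)) (Ioo 0 δ)

/-- `w` is the value of `H` at the point `t` of the cut, taken from its upper side. -/
def IsUpperValue (H : ℂ → ℂ) (t : ℝ) (w : ℂ) : Prop :=
  Tendsto H (𝓝[{z : ℂ | 0 < z.im}] (t : ℂ)) (𝓝 w)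

/-- `w` is the value of `H` at the point `t` of the cut, taken from its lower side. -/
def IsLowerValue (H : ℂ → ℂ) (t : ℝ) (w : ℂ) : Prop :=
  Tendsto H (𝓝[{z : ℂ | z.im < 0}] (t : ℂ)) (𝓝 w)

/-- Sectionally analytic functions with branch cut `[0, ∞)` and nodes `0`, `∞`, `N`: analytic off
the cut, with Hölder continuous boundary values on both sides of the cut away from the nodes, with
singularities of order less than one at the finite nodes, and regular at infinity, that is,
vanishing there like a negative power (the cut reaches infinity, so that `z = ∞` is
an end point of it). -/
structure IsSectionallyAnalytic (N : Finset ℝ) (H : ℂ → ℂ) : Prop where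
  analytic_off_cut : AnalyticOnNhd ℂ H cutPlane
  boundary_values : ∃ Hp Hm : ℝ → ℂ, IsNodalHolder N Hp ∧ IsNodalHolder N Hm ∧
    ∀ t : ℝ, 0 < t → t ∉ N → IsUpperValue H t (Hp t) ∧ IsLowerValue H t (Hm t)
  at_node : ∀ c : ℝ, (c = 0 ∨ c ∈ N) → ∃ α < (1 : ℝ),
    H =O[𝓝[cutPlane] (c : ℂ)] fun z => ‖z - (c : ℂ)‖ ^ (-α)
  at_infinity : ∃ β > (0 : ℝ), H =O[Bornology.cobounded ℂ ⊓ 𝓟 cutPlane] fun z => ‖z‖ ^ (-β)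

/-- The Cauchy type integral `(1 / (π i)) ∫₀^∞ v(μ) / (μ - z) dμ`. -/
noncomputable def cauchyIntegral (v : ℝ → ℂ) (z : ℂ) : ℂ :=
  1 / ((Real.pi : ℂ) * Complex.I) * ∫ μ in Ioi (0 : ℝ), v μ / ((μ : ℂ) - z)

/-- The truncated integral `(1 / (π i)) ∫ v(μ) / (μ - t) dμ` over `μ > 0`, `|μ - t| > ε`. -/
noncomputable def truncatedCauchyIntegral (v : ℝ → ℂ) (t ε : ℝ) : ℂ :=
  1 / ((Real.pi : ℂ) * Complex.I) *
    ∫ μ in {μ : ℝ | 0 < μ ∧ ε < |μ - t|}, v μ / ((μ : ℂ) - (t : ℂ))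

/-- `v` solves `(1 / (π i)) ∫₀^∞ v(μ) / (μ - z) dμ = H(z)`, `z` a complex variable off the cut. -/
structure IsSolutionOffCut (N : Finset ℝ) (v : ℝ → ℂ) (H : ℂ → ℂ) : Prop where
  density : IsNodalHolder N v
  equation : ∀ z ∈ cutPlane,
    IntegrableOn (fun μ : ℝ => v μ / ((μ : ℂ) - z)) (Ioi 0) ∧ cauchyIntegral v z = H z

/-- `v` solves `(1 / (π i)) ∫₀^∞ v(μ) / (μ - t) dμ = h(t)` for `t` on the positive semi-axis, the
path of integration passing the pole `μ = t` from below, that is,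
`v(t) + (1 / (π i)) P∫₀^∞ v(μ) / (μ - t) dμ = h(t)` with the principal value of the integral. -/
structure IsSolutionOnAxis (N : Finset ℝ) (v h : ℝ → ℂ) : Prop where
  density : IsNodalHolder N v
  integrable : ∀ t : ℝ, 0 < t → t ∉ N → ∀ ε > 0,
    IntegrableOn (fun μ : ℝ => v μ / ((μ : ℂ) - (t : ℂ))) {μ : ℝ | 0 < μ ∧ ε < |μ - t|}
  equation : ∀ t : ℝ, 0 < t → t ∉ N →
    Tendsto (fun ε : ℝ => v t + truncatedCauchyIntegral v t ε) (𝓝[>] 0) (𝓝 (h t))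

/-! Everything rests on the Plemelj formulas. For a density `v` of the nodal Hölder class let `Φ =
cauchyIntegral v`. At a point `t` of the cut that is not a node, the one-sided limits of `Φ` are `v
t + P` and `-v t + P`, where `P` is the principal value divided by `π i`
(`IsNodalHolder.exists_boundary_values`). So `v` is half the jump of `Φ`, which gives the formula
and uniqueness off the cut, and the equation on the axis says exactly that `Φ` has upper value `h`.

Existence: take half the jump of `H` as density. Then `Φ - H` has no jump, singularities of order
less than one and limit zero at infinity. By Painlevé's theorem it continues across the cut, by
Riemann's theorem across the nodes, and by Liouville's theorem it is zero (`eqOn_zero_of_no_jump`).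
On the axis only upper values are known, but they determine an analytic function: one whose upper
values vanish continues by zero into the lower half-plane (`eqOn_zero_of_isUpperValue_zero`), and no
growth condition is needed.

The hard part is that `Φ` is sectionally analytic, with boundary values in the same class as `v`
(`IsNodalHolder.isSectionallyAnalytic_cauchyIntegral`). It comes from a single estimate on the unit
interval, `LocalBound.exists_norm_lineCauchy_sub_le`, whose constant depends only on the Hölder
exponent. The kernel `dμ / (μ - z)` is invariant under affine maps, so the estimate holds at every
point and scale. At distance `s` from a node it is used at scale `s / 2`, where the density has size
`s ^ (-α)` and a Hölder condition in the relative variable `s' / s - 1` (`ScaledHolderOn`,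
`EndData`); large `s` plays the same role at infinity. Passing between this scaled form and the
original class costs a small change of exponent, harmless because `α < 1` and `β > 0` are open
conditions. Extension by zero makes the origin a node like the others, and complex conjugation
derives the lower side from the upper one. -/

/-! ### Continuation across the cut and uniqueness of analytic functions -/

/-- **Painlevé's theorem** for the real line: a continuous function which is holomorphic off the
real line is holomorphic. -/
theorem DifferentiableOn.of_continuousOn_of_im_ne_zero {U : Set ℂ} {f : ℂ → ℂ} (hU : IsOpen U)
    (hc : ContinuousOn f U) (hd : DifferentiableOn ℂ f (U ∩ {z | z.im ≠ 0})) :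
    DifferentiableOn ℂ f U := by
  refine (Complex.isConservativeOn_and_continuousOn_iff_isDifferentiableOn hU).1 ⟨?_, hc⟩
  -- Morera's theorem needs rectangles only. One whose interior misses the real line is covered by
  -- Cauchy's theorem with mere continuity on the boundary.
  have key : ∀ z w : ℂ, Complex.Rectangle z w ⊆ U →
      (0 : ℝ) ∉ Ioo (min z.im w.im) (max z.im w.im) →
      (∫ x : ℝ in z.re..w.re, f (x + z.im * Complex.I)) -
        (∫ x : ℝ in z.re..w.re, f (x + w.im * Complex.I)) +
        Complex.I • (∫ y : ℝ in z.im..w.im, f (w.re + y * Complex.I)) -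
        Complex.I • (∫ y : ℝ in z.im..w.im, f (z.re + y * Complex.I)) = 0 := by
    intro z w hzw h0
    refine Complex.integral_boundary_rect_eq_zero_of_continuousOn_of_differentiableOn f z w
      (hc.mono hzw) (hd.mono ?_)
    rintro x ⟨hx1, hx2⟩
    refine ⟨hzw ⟨Ioo_subset_Icc_self hx1, Ioo_subset_Icc_self hx2⟩, fun h => ?_⟩
    rw [mem_preimage, h] at hx2
    exact h0 hx2
  intro z w hzw
  rw [← add_eq_zero_iff_eq_neg, Complex.wedgeIntegral_add_wedgeIntegral_eq]
  -- A rectangle crossed by the real line is cut along it; the two integrals over the common side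
  -- cancel.
  by_cases h0 : (0 : ℝ) ∈ Ioo (min z.im w.im) (max z.im w.im)
  swap
  · exact key z w hzw h0
  have h0' : (0 : ℝ) ∈ uIcc z.im w.im := Ioo_subset_Icc_self h0
  have hs1 : Complex.Rectangle z (w.re : ℂ) ⊆ Complex.Rectangle z w := by
    rintro x ⟨hx1, hx2⟩
    simp only [Complex.ofReal_re, Complex.ofReal_im] at hx1 hx2
    exact ⟨hx1, uIcc_subset_uIcc_left h0' hx2⟩
  have hs2 : Complex.Rectangle (z.re : ℂ) w ⊆ Complex.Rectangle z w := by
    rintro x ⟨hx1, hx2⟩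
    simp only [Complex.ofReal_re, Complex.ofReal_im] at hx1 hx2
    exact ⟨hx1, uIcc_subset_uIcc_right h0' hx2⟩
  have e1 := key z (w.re : ℂ) (hs1.trans hzw) (by
    simp only [Complex.ofReal_im, mem_Ioo, min_lt_iff, lt_max_iff, lt_irrefl, or_false, not_and,
      not_lt]
    intro h; exact h.le)
  have e2 := key (z.re : ℂ) w (hs2.trans hzw) (by
    simp only [Complex.ofReal_im, mem_Ioo, min_lt_iff, lt_max_iff, lt_irrefl, false_or, not_and,
      not_lt]
    intro h; exact h.le)
  simp only [Complex.ofReal_re, Complex.ofReal_im] at e1 e2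
  have hint : ∀ a ∈ uIcc z.re w.re, ∀ y₁ ∈ uIcc z.im w.im, ∀ y₂ ∈ uIcc z.im w.im,
      IntervalIntegrable (fun y : ℝ => f (a + y * Complex.I)) volume y₁ y₂ := by
    intro a ha y₁ h₁ y₂ h₂
    refine ContinuousOn.intervalIntegrable (hc.comp (by fun_prop) ?_)
    intro y hy
    refine hzw ⟨?_, ?_⟩
    · simpa using ha
    · simpa using uIcc_subset_uIcc h₁ h₂ hy
  rw [← intervalIntegral.integral_add_adjacent_intervals (b := (0 : ℝ))
      (hint w.re right_mem_uIcc _ left_mem_uIcc _ h0')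
      (hint w.re right_mem_uIcc _ h0' _ right_mem_uIcc),
    ← intervalIntegral.integral_add_adjacent_intervals (b := (0 : ℝ))
      (hint z.re left_mem_uIcc _ left_mem_uIcc _ h0')
      (hint z.re left_mem_uIcc _ h0' _ right_mem_uIcc)]
  simp only [smul_add]
  linear_combination e1 + e2

theorem isOpen_cutPlane : IsOpen cutPlane := by
  have : cutPlane = {z : ℂ | z.re < 0} ∪ {z : ℂ | z.im ≠ 0} := by
    ext z; simp only [cutPlane, mem_ofPred_eq, mem_union, not_and_or, not_le]
  rw [this]
  exact (isOpen_lt Complex.continuous_re continuous_const).union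
    (isOpen_ne_fun Complex.continuous_im continuous_const)

theorem mem_cutPlane_of_im_ne_zero {z : ℂ} (hz : z.im ≠ 0) : z ∈ cutPlane := fun h => hz h.2

theorem isPreconnected_cutPlane : IsPreconnected cutPlane := by
  have : StarConvex ℝ (-1 : ℂ) cutPlane := by
    rw [starConvex_iff_forall_pos (by simp [cutPlane])]
    rintro z hz a b ha hb hab ⟨h1, h2⟩
    simp at h1 h2
    rcases h2 with h2 | h2
    · exact hb.ne' h2
    · refine hz ⟨?_, h2⟩
      by_contra! h
      nlinarith
  exact this.isPathConnected (by simp [cutPlane]) |>.isConnected.isPreconnected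

theorem dense_im_ne_zero : Dense {z : ℂ | z.im ≠ 0} := by
  have : {z : ℂ | z.im ≠ 0} = {z : ℂ | z.im = 0}ᶜ := by ext; simp
  rw [this, ← interior_eq_empty_iff_dense_compl]
  have h : {z : ℂ | z.im = 0} = Complex.im ⁻¹' {0} := rfl
  rw [h, Complex.interior_preimage_im]
  simp

instance nhdsWithin_im_pos_neBot (t : ℝ) : (𝓝[{z : ℂ | 0 < z.im}] (t : ℂ)).NeBot := by
  rw [← mem_closure_iff_nhdsWithin_neBot, Complex.closure_setOfPred_lt_im]
  simp

instance nhdsWithin_im_neg_neBot (t : ℝ) : (𝓝[{z : ℂ | z.im < 0}] (t : ℂ)).NeBot := by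
  rw [← mem_closure_iff_nhdsWithin_neBot, Complex.closure_setOfPred_im_lt]
  simp

theorem IsUpperValue.unique {H : ℂ → ℂ} {t : ℝ} {a b : ℂ} (ha : IsUpperValue H t a)
    (hb : IsUpperValue H t b) : a = b := tendsto_nhds_unique ha hb

theorem IsLowerValue.unique {H : ℂ → ℂ} {t : ℝ} {a b : ℂ} (ha : IsLowerValue H t a)
    (hb : IsLowerValue H t b) : a = b := tendsto_nhds_unique ha hb

theorem exists_forall_lt_of_finset (N : Finset ℝ) : ∃ M : ℝ, 0 ≤ M ∧ ∀ c ∈ N, c ≤ M := by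
  obtain ⟨M, hM⟩ := N.bddAbove
  exact ⟨max M 0, le_max_right _ _, fun c hc => (hM hc).trans (le_max_left _ _)⟩

/-- A function analytic off the cut whose upper boundary values vanish away from finitely many
points is zero. -/
theorem eqOn_zero_of_isUpperValue_zero {N : Finset ℝ} {G : ℂ → ℂ}
    (hG : AnalyticOnNhd ℂ G cutPlane)
    (h0 : ∀ t : ℝ, 0 < t → t ∉ N → IsUpperValue G t 0) : EqOn G 0 cutPlane := by
  classical
  obtain ⟨M, hM0, hM⟩ := exists_forall_lt_of_finset N
  -- This half-plane lies to the right of all nodes, so the hypothesis applies at every real point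
  -- of it.
  set V : Set ℂ := {z | M < z.re} with hV
  have hVo : IsOpen V := isOpen_lt continuous_const Complex.continuous_re
  have hVc : IsPreconnected V := (convex_halfSpace_re_gt M).isPreconnected
  -- Gluing with zero below the axis is continuous on `V` because the upper values vanish.
  -- Painlevé's theorem makes it analytic there, and it vanishes on an open set.
  set f : ℂ → ℂ := fun z => if 0 < z.im then G z else 0 with hf
  have hupper : ∀ z : ℂ, 0 < z.im → f =ᶠ[𝓝 z] G := by
    intro z hz
    filter_upwards [(isOpen_lt continuous_const Complex.continuous_im).mem_nhds hz] with w hw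
    exact if_pos hw
  have hlower : ∀ z : ℂ, z.im < 0 → f =ᶠ[𝓝 z] 0 := by
    intro z hz
    filter_upwards [(isOpen_lt Complex.continuous_im continuous_const).mem_nhds hz] with w hw
    exact if_neg (not_lt.2 (le_of_lt hw))
  have hdiff : ∀ z : ℂ, z.im ≠ 0 → DifferentiableAt ℂ f z := by
    intro z hz
    rcases hz.lt_or_gt with h | h
    · exact (hlower z h).differentiableAt_iff.2 (differentiableAt_const 0)
    · exact (hupper z h).differentiableAt_iff.2
        (hG z (mem_cutPlane_of_im_ne_zero hz)).differentiableAt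
  have hcont : ContinuousOn f V := by
    intro z hz
    refine ContinuousAt.continuousWithinAt ?_
    by_cases him : z.im = 0
    · have hz' : z = ((z.re : ℝ) : ℂ) := Complex.ext (by simp) (by simp [him])
      have hfz : f z = 0 := if_neg (by simp [him])
      have hup := h0 z.re (hM0.trans_lt hz) (fun h => (hM _ h).not_gt hz)
      rw [IsUpperValue, ← hz'] at hup
      rw [ContinuousAt, hfz]
      refine Tendsto.if (p := fun w : ℂ => 0 < w.im) hup tendsto_const_nhds
    · exact (hdiff z him).continuousAt
  have hfd : DifferentiableOn ℂ f V := DifferentiableOn.of_continuousOn_of_im_ne_zero hVo hcont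
    fun z hz => (hdiff z hz.2).differentiableWithinAt
  have hfa : AnalyticOnNhd ℂ f V := hfd.analyticOnNhd hVo
  have hzero : EqOn f 0 V := hfa.eqOn_zero_of_preconnected_of_eventuallyEq_zero hVc
    (z₀ := (⟨M + 1, -1⟩ : ℂ)) (by simp [hV]) (hlower _ (by simp))
  refine hG.eqOn_zero_of_preconnected_of_eventuallyEq_zero isPreconnected_cutPlane
    (z₀ := (⟨M + 1, 1⟩ : ℂ)) (mem_cutPlane_of_im_ne_zero (by simp)) ?_
  refine (hupper ⟨M + 1, 1⟩ (by simp)).symm.trans ?_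
  filter_upwards [hVo.mem_nhds (show (⟨M + 1, 1⟩ : ℂ) ∈ V by simp [hV])] with w hw
  exact hzero hw

/-- A function analytic off the cut, without jump across it, with singularities of order less than
one at finitely many points and vanishing at infinity is zero. -/
theorem eqOn_zero_of_no_jump {N : Finset ℝ} (hN : ∀ c ∈ N, 0 < c) {G : ℂ → ℂ}
    (hG : AnalyticOnNhd ℂ G cutPlane)
    (hj : ∀ t : ℝ, 0 < t → t ∉ N → ∃ a, IsUpperValue G t a ∧ IsLowerValue G t a)
    (hn : ∀ c : ℝ, (c = 0 ∨ c ∈ N) → ∃ α < (1 : ℝ),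
      G =O[𝓝[cutPlane] (c : ℂ)] fun z => ‖z - (c : ℂ)‖ ^ (-α))
    (hi : ∃ β > (0 : ℝ), G =O[Bornology.cobounded ℂ ⊓ 𝓟 cutPlane] fun z => ‖z‖ ^ (-β)) :
    EqOn G 0 cutPlane := by
  classical
  set S : Finset ℂ := (insert 0 N).image (fun c : ℝ => (c : ℂ)) with hS
  set U : Set ℂ := (S : Set ℂ)ᶜ with hU
  have hUo : IsOpen U := S.finite_toSet.isClosed.isOpen_compl
  have hmemS : ∀ c ∈ S, ∃ x : ℝ, (x = 0 ∨ x ∈ N) ∧ (x : ℂ) = c := by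
    intro c hc
    obtain ⟨x, hx, rfl⟩ := Finset.mem_image.1 hc
    exact ⟨x, by simpa using hx, rfl⟩
  have hSmem : ∀ x : ℝ, (x = 0 ∨ x ∈ N) → (x : ℂ) ∈ S := by
    intro x hx
    exact Finset.mem_image_of_mem _ (by simpa using hx)
  set A : Set ℂ := {z | z.im ≠ 0} with hA
  have hAo : IsOpen A := isOpen_ne_fun Complex.continuous_im continuous_const
  have hAc : A ⊆ cutPlane := fun z hz => mem_cutPlane_of_im_ne_zero hz
  have hAU : A ⊆ U := by
    intro z hz hzS
    obtain ⟨x, -, rfl⟩ := hmemS z hzS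
    exact hz (by simp)
  -- The limit from the two open half-planes exists everywhere off the nodes: the absence of a jump
  -- makes the two sides agree on the cut.
  set E : ℂ → ℂ := extendFrom A G with hE
  have hEG : ∀ z ∈ cutPlane, E z = G z := by
    intro z hz
    exact extendFrom_eq (dense_im_ne_zero z)
      ((hG z hz).continuousAt.tendsto.mono_left nhdsWithin_le_nhds)
  have hEc : ContinuousOn E U := by
    refine continuousOn_extendFrom (fun x _ => dense_im_ne_zero x) ?_
    intro z hz
    by_cases hzc : z ∈ cutPlane
    · exact ⟨G z, (hG z hzc).continuousAt.tendsto.mono_left nhdsWithin_le_nhds⟩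
    · obtain ⟨h1, h2⟩ := not_not.1 hzc
      have hz' : ((z.re : ℝ) : ℂ) = z := Complex.ext (by simp) (by simp [h2])
      have hne : ¬ (z.re = 0 ∨ z.re ∈ N) := fun h => hz (by rw [← hz']; exact hSmem _ h)
      push Not at hne
      obtain ⟨a, ha, hb⟩ := hj z.re (lt_of_le_of_ne h1 (Ne.symm hne.1)) hne.2
      rw [IsUpperValue, hz'] at ha
      rw [IsLowerValue, hz'] at hb
      refine ⟨a, ?_⟩
      have : A = {z : ℂ | 0 < z.im} ∪ {z : ℂ | z.im < 0} := by
        ext w; simp only [hA, mem_ofPred_eq, mem_union]; rw [or_comm]; exact ne_iff_lt_or_gt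
      rw [this, nhdsWithin_union]
      exact ha.sup hb
  have hEd : DifferentiableOn ℂ E U := by
    refine DifferentiableOn.of_continuousOn_of_im_ne_zero hUo hEc ?_
    intro z hz
    have : E =ᶠ[𝓝 z] G := by
      filter_upwards [hAo.mem_nhds hz.2] with w hw using hEG w (hAc hw)
    exact (this.differentiableAt_iff.2
      (hG z (hAc hz.2)).differentiableAt).differentiableWithinAt
  -- bounds off the real line extend to the real line
  have hext : ∀ (W : Set ℂ) (b : ℂ → ℝ), IsOpen W → W ⊆ U → ContinuousOn b W →
      (∀ z ∈ W ∩ cutPlane, ‖G z‖ ≤ b z) → ∀ z ∈ W, ‖E z‖ ≤ b z := by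
    intro W b hW hWU hb hGb z hz
    have hne : (𝓝[W ∩ A] z).NeBot := by
      rw [← mem_closure_iff_nhdsWithin_neBot]
      exact dense_im_ne_zero.open_subset_closure_inter hW hz
    have t1 : Tendsto (fun w => ‖E w‖) (𝓝[W ∩ A] z) (𝓝 ‖E z‖) :=
      ((hEc.continuousAt (hUo.mem_nhds (hWU hz))).norm.tendsto).mono_left nhdsWithin_le_nhds
    have t2 : Tendsto b (𝓝[W ∩ A] z) (𝓝 (b z)) :=
      (hb.continuousAt (hW.mem_nhds hz)).tendsto.mono_left nhdsWithin_le_nhds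
    refine le_of_tendsto_of_tendsto t1 t2 ?_
    filter_upwards [self_mem_nhdsWithin] with w hw
    rw [hEG w (hAc hw.2)]
    exact hGb w ⟨hw.1, hAc hw.2⟩
  -- `F` fills in the finitely many isolated singularities by limits, to obtain an entire function.
  set F : ℂ → ℂ := fun z => if z ∈ S then limUnder (𝓝[≠] z) E else E z with hF
  have hFE : ∀ z ∈ U, F z = E z := fun z hz => if_neg hz
  have hFd : Differentiable ℂ F := by
    intro z
    by_cases hzS : z ∈ S
    · obtain ⟨x, hx, rfl⟩ := hmemS z hzS
      obtain ⟨α, hα, hO⟩ := hn x hx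
      obtain ⟨C, hC⟩ := hO.bound
      rw [eventually_nhdsWithin_iff, Metric.eventually_nhds_iff_ball] at hC
      obtain ⟨δ, hδ, hC⟩ := hC
      have hpunct : ∀ᶠ w in 𝓝[≠] (x : ℂ), w ∈ U := by
        have : ((S.erase (x : ℂ) : Finset ℂ) : Set ℂ)ᶜ ∈ 𝓝 (x : ℂ) :=
          (S.erase (x : ℂ)).finite_toSet.isClosed.isOpen_compl.mem_nhds (by simp)
        filter_upwards [nhdsWithin_le_nhds this, self_mem_nhdsWithin] with w hw hw2 hw3
        exact hw (Finset.mem_coe.2 (Finset.mem_erase.2 ⟨hw2, hw3⟩))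
      have hbound : ∀ᶠ w in 𝓝[≠] (x : ℂ), ‖E w‖ ≤ C * ‖w - (x : ℂ)‖ ^ (-α) := by
        have hb : ∀ w ∈ Metric.ball (x : ℂ) δ ∩ U, ‖E w‖ ≤ C * ‖w - (x : ℂ)‖ ^ (-α) := by
          refine hext _ _ (Metric.isOpen_ball.inter hUo) inter_subset_right ?_ ?_
          · intro w hw
            have hwx : w ≠ x := by rintro rfl; exact hw.2 hzS
            refine ContinuousAt.continuousWithinAt ?_
            refine continuousAt_const.mul (ContinuousAt.rpow_const (by fun_prop) (Or.inl ?_))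
            exact norm_ne_zero_iff.2 (sub_ne_zero.2 hwx)
          · rintro w ⟨hw1, hw2⟩
            have := hC w hw1.1 hw2
            rwa [Real.norm_of_nonneg (Real.rpow_nonneg (norm_nonneg _) _)] at this
        filter_upwards [hpunct, nhdsWithin_le_nhds (Metric.ball_mem_nhds _ hδ)] with w h1 h2
        exact hb w ⟨h2, h1⟩
      -- Order less than one is exactly what Riemann's criterion needs. The value `E x` has no
      -- meaning here, but as a constant it is covered by the exponent `γ = 0`.
      have ho : (fun w => E w - E (x : ℂ)) =o[𝓝[≠] (x : ℂ)] fun w => (w - (x : ℂ))⁻¹ := by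
        have hpow : ∀ γ < (1 : ℝ), (fun w : ℂ => ‖w - (x : ℂ)‖ ^ (-γ)) =o[𝓝[≠] (x : ℂ)]
            fun w => (w - (x : ℂ))⁻¹ := by
          intro γ hγ
          rw [← isLittleO_norm_right]
          refine isLittleO_of_tendsto' (by
            filter_upwards [self_mem_nhdsWithin] with w hw h
            exact absurd (sub_eq_zero.1 (inv_eq_zero.1 (norm_eq_zero.1 h))) hw) ?_
          have t0 : Tendsto (fun w : ℂ => ‖w - (x : ℂ)‖ ^ (1 - γ)) (𝓝[≠] (x : ℂ)) (𝓝 0) := by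
            have : Tendsto (fun w : ℂ => ‖w - (x : ℂ)‖ ^ (1 - γ)) (𝓝 (x : ℂ))
                (𝓝 (‖(x : ℂ) - (x : ℂ)‖ ^ (1 - γ))) :=
              ContinuousAt.tendsto (f := fun w : ℂ => ‖w - (x : ℂ)‖ ^ (1 - γ))
                (ContinuousAt.rpow_const (by fun_prop) (Or.inr (by linarith)))
            rw [sub_self, norm_zero, Real.zero_rpow (by linarith)] at this
            exact this.mono_left nhdsWithin_le_nhds
          refine t0.congr' ?_
          filter_upwards [self_mem_nhdsWithin] with w hw
          have hp : 0 < ‖w - (x : ℂ)‖ := norm_pos_iff.2 (sub_ne_zero.2 hw)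
          rw [norm_inv, div_inv_eq_mul, ← Real.rpow_add_one hp.ne']
          congr 1; ring
        have h1 : E =o[𝓝[≠] (x : ℂ)] fun w => (w - (x : ℂ))⁻¹ := by
          refine IsBigO.trans_isLittleO (IsBigO.of_bound C ?_) (hpow α hα)
          filter_upwards [hbound] with w hw
          rwa [Real.norm_of_nonneg (Real.rpow_nonneg (norm_nonneg _) _)]
        refine h1.sub (IsBigO.trans_isLittleO ?_ (hpow 0 one_pos))
        simp only [neg_zero, Real.rpow_zero]
        exact isBigO_const_const _ one_ne_zero _
      have hd := Complex.differentiableOn_update_limUnder_insert_of_isLittleO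
        (f := E) (c := (x : ℂ)) hpunct hEd ho
      have hmem : insert (x : ℂ) U ∈ 𝓝 (x : ℂ) := insert_mem_nhds_iff.2 hpunct
      refine ((hd.differentiableAt hmem).congr_of_eventuallyEq ?_)
      filter_upwards [hmem] with w hw
      by_cases hwx : w = x
      · subst hwx; simp [hF, hzS]
      · have hwU : w ∈ U := hw.resolve_left hwx
        rw [hFE w hwU, Function.update_of_ne hwx]
    · have : F =ᶠ[𝓝 z] E := by
        filter_upwards [hUo.mem_nhds hzS] with w hw using hFE w hw
      exact this.differentiableAt_iff.2 (hEd.differentiableAt (hUo.mem_nhds hzS))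
  -- An entire function with limit zero at infinity vanishes, by Liouville's theorem.
  have hF0 : Tendsto F (cocompact ℂ) (𝓝 0) := by
    obtain ⟨β, hβ, hO⟩ := hi
    obtain ⟨C, hC⟩ := hO.bound
    rw [eventually_inf_principal] at hC
    rw [← Metric.cobounded_eq_cocompact]
    have hUcob : ∀ᶠ z in Bornology.cobounded ℂ, z ∈ U := by
      have := S.finite_toSet.isCompact.isBounded
      exact this
    obtain ⟨R, hR, hCR⟩ := (hasBasis_cobounded_norm.eventually_iff).1 hC
    have hb : ∀ z ∈ {z : ℂ | max R 0 < ‖z‖} ∩ U, ‖E z‖ ≤ C * ‖z‖ ^ (-β) := by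
      refine hext _ _ ((isOpen_lt continuous_const continuous_norm).inter hUo)
        inter_subset_right ?_ ?_
      · rintro w ⟨hw, -⟩
        refine ContinuousAt.continuousWithinAt ?_
        exact continuousAt_const.mul (ContinuousAt.rpow_const (by fun_prop)
          (Or.inl ((le_max_right R 0).trans_lt hw).ne'))
      · rintro w ⟨⟨hw1, -⟩, hw2⟩
        have := hCR ((le_max_left R 0).trans (le_of_lt hw1)) hw2
        rwa [Real.norm_of_nonneg (Real.rpow_nonneg (norm_nonneg _) _)] at this
    have hlim : Tendsto (fun z : ℂ => C * ‖z‖ ^ (-β)) (Bornology.cobounded ℂ) (𝓝 0) := by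
      have := ((tendsto_rpow_neg_atTop hβ).comp
        (tendsto_norm_cobounded_atTop (E := ℂ))).const_mul C
      simpa using this
    refine squeeze_zero_norm' ?_ hlim
    filter_upwards [hUcob, (tendsto_norm_cobounded_atTop (E := ℂ)).eventually_gt_atTop (max R 0)]
      with z h1 h2
    rw [hFE z h1]
    exact hb z ⟨h2, h1⟩
  intro z hz
  have hzU : z ∈ U := by
    intro hzS
    obtain ⟨x, hx, rfl⟩ := hmemS z hzS
    have hx0 : 0 ≤ x := hx.elim (fun h => h.ge) (fun h => (hN x h).le)
    exact hz ⟨by simpa using hx0, by simp⟩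
  rw [← hEG z hz, ← hFE z hzU, hFd.apply_eq_of_tendsto_cocompact z hF0]
  rfl

/-! ### Hölder conditions relative to the distance from a node -/

/-- `F s = O(s ^ p)` on `S`, together with the Hölder estimate at the scale `s`:
the increments of `F` over `[s, κ s]` are `O(s ^ p (s' / s - 1) ^ r)`. -/
def ScaledHolderOn (κ : ℝ) (F : ℝ → ℂ) (p : ℝ) (S : Set ℝ) : Prop :=
  ∃ C r : ℝ, 0 ≤ C ∧ 0 < r ∧ r ≤ 1 ∧ (∀ s ∈ S, ‖F s‖ ≤ C * s ^ p) ∧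
    ∀ s ∈ S, ∀ s' ∈ S, s ≤ s' → s' ≤ κ * s → ‖F s' - F s‖ ≤ C * s ^ p * (s' / s - 1) ^ r

theorem isHolderOn_of_le {f : ℝ → ℂ} {s : Set ℝ} {C r : ℝ} (hC : 0 ≤ C) (hr : 0 < r)
    (h : ∀ x ∈ s, ∀ y ∈ s, x ≤ y → ‖f y - f x‖ ≤ C * (y - x) ^ r) : IsHolderOn f s := by
  lift C to ℝ≥0 using hC
  lift r to ℝ≥0 using hr.le
  refine ⟨C, r, by exact_mod_cast hr, ?_⟩
  have key : ∀ x ∈ s, ∀ y ∈ s, dist (f x) (f y) ≤ C * dist x y ^ (r : ℝ) := by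
    intro x hx y hy
    rcases le_total x y with hxy | hxy
    · rw [dist_comm, dist_eq_norm, dist_comm, Real.dist_eq, abs_of_nonneg (by linarith)]
      exact h x hx y hy hxy
    · rw [dist_eq_norm, Real.dist_eq, abs_of_nonneg (by linarith)]
      exact h y hy x hx hxy
  intro x hx y hy
  have := key x hx y hy
  rw [edist_nndist, edist_nndist, ← ENNReal.coe_rpow_of_nonneg _ r.coe_nonneg, ← ENNReal.coe_mul,
    ENNReal.coe_le_coe, ← NNReal.coe_le_coe]
  push_cast
  exact this

/-- On a bounded set a Hölder exponent may be lowered at the price of the constant, so it can be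
taken at most one; later estimates use this normalisation. -/
theorem IsHolderOn.exists_le {f : ℝ → ℂ} {s : Set ℝ} (h : IsHolderOn f s)
    (hs : Bornology.IsBounded s) : ∃ C r : ℝ, 0 ≤ C ∧ 0 < r ∧ r ≤ 1 ∧
      ∀ x ∈ s, ∀ y ∈ s, ‖f x - f y‖ ≤ C * |x - y| ^ r := by
  obtain ⟨C, r, hr, hf⟩ := h
  obtain ⟨D, hD⟩ := Metric.isBounded_iff_nndist.1 hs
  have h1 := hf.of_le (D := D) (s := min r 1)
    (fun x hx y hy => by rw [edist_nndist]; exact_mod_cast hD hx hy) (min_le_left _ _)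
  refine ⟨(C * D ^ ((r : ℝ) - ((min r 1 : ℝ≥0) : ℝ)) : ℝ≥0), (min r 1 : ℝ≥0),
    NNReal.coe_nonneg _, by simpa using hr, by simp, ?_⟩
  intro x hx y hy
  have := h1.dist_le hx hy
  rwa [dist_eq_norm, Real.dist_eq] at this

theorem rpow_le_rpow_abs {κ u p : ℝ} (h1 : 1 ≤ u) (h2 : u ≤ κ) : u ^ p ≤ κ ^ |p| :=
  (Real.rpow_le_rpow_of_exponent_le h1 (le_abs_self p)).trans
    (Real.rpow_le_rpow (by linarith) h2 (abs_nonneg p))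

theorem abs_rpow_sub_one_le {κ u q : ℝ} (h1 : 1 ≤ u) (h2 : u ≤ κ) :
    |u ^ q - 1| ≤ |q| * κ ^ |q - 1| * (u - 1) := by
  have := (convex_Icc (1 : ℝ) κ).norm_image_sub_le_of_norm_hasDerivWithin_le
    (f := fun x : ℝ => x ^ q) (f' := fun x => q * x ^ (q - 1)) (C := |q| * κ ^ |q - 1|)
    (fun x hx => (Real.hasDerivAt_rpow_const (Or.inl (by linarith [hx.1]))).hasDerivWithinAt)
    (fun x hx => by
      rw [norm_mul, Real.norm_eq_abs, Real.norm_of_nonneg (Real.rpow_nonneg (by linarith [hx.1]) _)]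
      exact mul_le_mul_of_nonneg_left (rpow_le_rpow_abs hx.1 hx.2) (abs_nonneg q))
    (x := 1) (y := u) ⟨le_rfl, h1.trans h2⟩ ⟨h1, h2⟩
  simpa [Real.norm_eq_abs, abs_of_nonneg (sub_nonneg.2 h1)] using this

theorem rpow_eq_mul_div_rpow {s s' : ℝ} (hs : 0 < s) (hs' : 0 < s') (q : ℝ) :
    s' ^ q = s ^ q * (s' / s) ^ q := by
  rw [← Real.mul_rpow hs.le (by positivity)]
  congr 1; field_simp

theorem abs_rpow_sub_rpow_le {κ s s' : ℝ} (q : ℝ) (hs : 0 < s) (h1 : s ≤ s') (h2 : s' ≤ κ * s) :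
    |s' ^ q - s ^ q| ≤ s ^ q * (|q| * κ ^ |q - 1| * (s' / s - 1)) := by
  have hu1 : 1 ≤ s' / s := (one_le_div hs).2 h1
  have hu2 : s' / s ≤ κ := (div_le_iff₀ hs).2 h2
  have : s' ^ q - s ^ q = s ^ q * ((s' / s) ^ q - 1) := by
    rw [rpow_eq_mul_div_rpow hs (hs.trans_le h1) q]; ring
  rw [this, abs_mul, abs_of_nonneg (Real.rpow_nonneg hs.le _)]
  exact mul_le_mul_of_nonneg_left (abs_rpow_sub_one_le hu1 hu2) (Real.rpow_nonneg hs.le _)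

theorem rpow_le_mul_rpow {κ s s' : ℝ} (q : ℝ) (hs : 0 < s) (h1 : s ≤ s') (h2 : s' ≤ κ * s) :
    s' ^ q ≤ κ ^ |q| * s ^ q := by
  rw [rpow_eq_mul_div_rpow hs (hs.trans_le h1) q, mul_comm]
  exact mul_le_mul_of_nonneg_right
    (rpow_le_rpow_abs ((one_le_div hs).2 h1) ((div_le_iff₀ hs).2 h2)) (Real.rpow_nonneg hs.le _)

namespace ScaledHolderOn

variable {κ p q : ℝ} {F G : ℝ → ℂ} {S T : Set ℝ}

theorem mono (h : ScaledHolderOn κ F p S) (hT : T ⊆ S) : ScaledHolderOn κ F p T := by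
  obtain ⟨C, r, hC, hr, hr1, h1, h2⟩ := h
  exact ⟨C, r, hC, hr, hr1, fun s hs => h1 s (hT hs), fun s hs s' hs' => h2 s (hT hs) s' (hT hs')⟩

theorem congr (h : ScaledHolderOn κ F p S) (hFG : EqOn F G S) : ScaledHolderOn κ G p S := by
  obtain ⟨C, r, hC, hr, hr1, h1, h2⟩ := h
  refine ⟨C, r, hC, hr, hr1, fun s hs => hFG hs ▸ h1 s hs, fun s hs s' hs' => ?_⟩
  rw [← hFG hs, ← hFG hs']
  exact h2 s hs s' hs'

theorem of_rpow_le (h : ScaledHolderOn κ F p S) (hS : ∀ s ∈ S, 0 < s)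
    (hpq : ∀ s ∈ S, s ^ p ≤ s ^ q) : ScaledHolderOn κ F q S := by
  obtain ⟨C, r, hC, hr, hr1, h1, h2⟩ := h
  refine ⟨C, r, hC, hr, hr1, fun s hs => (h1 s hs).trans
    (mul_le_mul_of_nonneg_left (hpq s hs) hC), fun s hs s' hs' h3 h4 => (h2 s hs s' hs' h3 h4).trans ?_⟩
  have : 1 ≤ s' / s := (one_le_div (hS s hs)).2 h3
  exact mul_le_mul_of_nonneg_right (mul_le_mul_of_nonneg_left (hpq s hs) hC)
    (Real.rpow_nonneg (by linarith) _)

theorem const_mul (h : ScaledHolderOn κ F p S) (a : ℂ) :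
    ScaledHolderOn κ (fun s => a * F s) p S := by
  obtain ⟨C, r, hC, hr, hr1, h1, h2⟩ := h
  refine ⟨‖a‖ * C, r, by positivity, hr, hr1, fun s hs => ?_, fun s hs s' hs' h3 h4 => ?_⟩
  · rw [norm_mul, mul_assoc]
    exact mul_le_mul_of_nonneg_left (h1 s hs) (norm_nonneg a)
  · rw [← mul_sub, norm_mul, mul_assoc, mul_assoc, ← mul_assoc C]
    exact mul_le_mul_of_nonneg_left (h2 s hs s' hs' h3 h4) (norm_nonneg a)

/-- The base `s' / s - 1` is bounded by `κ`, so one enlarged constant serves all smaller exponents.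
This lets functions with different Hölder exponents be added. -/
theorem exists_exponent_le (h : ScaledHolderOn κ F p S) (hκ : 1 ≤ κ) (hS : ∀ s ∈ S, 0 < s) :
    ∃ C r : ℝ, 0 ≤ C ∧ 0 < r ∧ r ≤ 1 ∧ ∀ ρ, 0 < ρ → ρ ≤ r → (∀ s ∈ S, ‖F s‖ ≤ C * s ^ p) ∧
    ∀ s ∈ S, ∀ s' ∈ S, s ≤ s' → s' ≤ κ * s → ‖F s' - F s‖ ≤ C * s ^ p * (s' / s - 1) ^ ρ := by
  obtain ⟨C, r, hC, hr, hr1, h1, h2⟩ := h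
  refine ⟨C * κ, r, by positivity, hr, hr1, fun ρ hρ hρr => ⟨fun s hs => ?_,
    fun s hs s' hs' h3 h4 => ?_⟩⟩
  · have := h1 s hs
    have h0 : 0 ≤ C * s ^ p := mul_nonneg hC (Real.rpow_nonneg (hS s hs).le _)
    nlinarith
  · have hs0 := hS s hs
    refine (h2 s hs s' hs' h3 h4).trans ?_
    have hu1 : 1 ≤ s' / s := (one_le_div hs0).2 h3
    have hu2 : s' / s ≤ κ := (div_le_iff₀ hs0).2 h4
    have h0 : 0 ≤ C * s ^ p := mul_nonneg hC (Real.rpow_nonneg hs0.le _)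
    have : (s' / s - 1) ^ r ≤ κ * (s' / s - 1) ^ ρ := by
      have e : (s' / s - 1) ^ r = (s' / s - 1) ^ (r - ρ) * (s' / s - 1) ^ ρ := by
        rw [← Real.rpow_add_of_nonneg (by linarith) (by linarith) hρ.le]; congr 1; ring
      rw [e]
      refine mul_le_mul_of_nonneg_right ?_ (Real.rpow_nonneg (by linarith) _)
      calc (s' / s - 1) ^ (r - ρ) ≤ κ ^ (r - ρ) :=
            Real.rpow_le_rpow (by linarith) (by linarith) (by linarith)
        _ ≤ κ ^ (1 : ℝ) := Real.rpow_le_rpow_of_exponent_le hκ (by linarith)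
        _ = κ := Real.rpow_one κ
    calc C * s ^ p * (s' / s - 1) ^ r ≤ C * s ^ p * (κ * (s' / s - 1) ^ ρ) :=
          mul_le_mul_of_nonneg_left this h0
      _ = _ := by ring

theorem add (hF : ScaledHolderOn κ F p S) (hG : ScaledHolderOn κ G p S) (hκ : 1 ≤ κ)
    (hS : ∀ s ∈ S, 0 < s) : ScaledHolderOn κ (fun s => F s + G s) p S := by
  obtain ⟨C, r, hC, hr, hr1, h⟩ := hF.exists_exponent_le hκ hS
  obtain ⟨C', r', hC', hr', hr1', h'⟩ := hG.exists_exponent_le hκ hS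
  obtain ⟨h1, h2⟩ := h (min r r') (lt_min hr hr') (min_le_left _ _)
  obtain ⟨h1', h2'⟩ := h' (min r r') (lt_min hr hr') (min_le_right _ _)
  refine ⟨C + C', min r r', by positivity, lt_min hr hr', (min_le_left _ _).trans hr1,
    fun s hs => ?_, fun s hs s' hs' h3 h4 => ?_⟩
  · rw [add_mul]
    exact norm_add_le_of_le (h1 s hs) (h1' s hs)
  · rw [add_mul, add_mul, add_sub_add_comm]
    exact norm_add_le_of_le (h2 s hs s' hs' h3 h4) (h2' s hs s' hs' h3 h4)

/-- Inversion preserves ratios and reverses their order, which reduces the node at infinity to one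
at zero. -/
theorem inv (h : ScaledHolderOn κ F p S) (hκ : 1 ≤ κ) (hS : ∀ s ∈ S, 0 < s) :
    ScaledHolderOn κ (fun t => F (1 / t)) (-p) ((fun t => 1 / t) ⁻¹' S) := by
  obtain ⟨C, r, hC, hr, hr1, h1, h2⟩ := h
  have hpos : ∀ t : ℝ, 1 / t ∈ S → 0 < t := fun t ht => one_div_pos.1 (hS _ ht)
  have hpow : ∀ t : ℝ, 0 < t → (1 / t) ^ p = t ^ (-p) := fun t ht => by
    rw [one_div, Real.inv_rpow ht.le, Real.rpow_neg ht.le]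
  have hκ' : 1 ≤ κ ^ |(-p)| := Real.one_le_rpow hκ (abs_nonneg _)
  refine ⟨C * κ ^ |(-p)|, r, by positivity, hr, hr1, fun t ht => ?_, fun t ht t' ht' h3 h4 => ?_⟩
  · have ht0 := hpos t ht
    rw [← hpow t ht0]
    refine (h1 _ ht).trans ?_
    have : 0 ≤ (1 / t) ^ p := by positivity
    nlinarith [mul_nonneg hC this]
  · have ht0 := hpos t ht
    have ht0' := hpos t' ht'
    have e : 1 / t / (1 / t') = t' / t := by field_simp
    have := h2 (1 / t') ht' (1 / t) ht (one_div_le_one_div_of_le ht0 h3) (by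
      rw [mul_one_div, div_le_div_iff₀ ht0 ht0']; linarith)
    rw [e, hpow t' ht0'] at this
    rw [norm_sub_rev]
    refine this.trans ?_
    have hu : 1 ≤ t' / t := (one_le_div ht0).2 h3
    refine mul_le_mul_of_nonneg_right ?_ (Real.rpow_nonneg (by linarith) _)
    rw [mul_assoc]
    exact mul_le_mul_of_nonneg_left (rpow_le_mul_rpow _ ht0 h3 h4) hC

/-- With `g = s ^ α F` Hölder continuous up to the node, `g` is bounded, and its increments pass to
the relative variable through `s' - s = s u ≤ δ u`, where `u = s' / s - 1`. The factor `s ^ (-α)`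
varies by a relative amount `O(u)`. -/
theorem of_isHolderOn {α δ : ℝ} (hκ : 1 ≤ κ) (hδ : 0 < δ)
    (h : IsHolderOn (fun s => ((s ^ α : ℝ) : ℂ) * F s) (Ioo 0 δ)) :
    ScaledHolderOn κ F (-α) (Ioo 0 δ) := by
  obtain ⟨C, r, hC, hr, hr1, hH⟩ := h.exists_le (Metric.isBounded_Ioo 0 δ)
  set g : ℝ → ℂ := fun s => ((s ^ α : ℝ) : ℂ) * F s with hg
  have hmid : δ / 2 ∈ Ioo (0 : ℝ) δ := ⟨by linarith, by linarith⟩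
  set M : ℝ := ‖g (δ / 2)‖ + C * δ ^ r with hM
  have hM0 : 0 ≤ M := by positivity
  have hgM : ∀ s ∈ Ioo (0 : ℝ) δ, ‖g s‖ ≤ M := by
    intro s hs
    have h1 : ‖g s‖ ≤ ‖g (δ / 2)‖ + ‖g s - g (δ / 2)‖ := by
      have := norm_add_le (g (δ / 2)) (g s - g (δ / 2)); rwa [add_sub_cancel] at this
    have h2 := hH s hs _ hmid
    have h3 : |s - δ / 2| ^ r ≤ δ ^ r := Real.rpow_le_rpow (abs_nonneg _)
      (abs_le.2 ⟨by linarith [hs.1], by linarith [hs.2]⟩) hr.le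
    nlinarith
  have hF : ∀ s ∈ Ioo (0 : ℝ) δ, F s = ((s ^ (-α) : ℝ) : ℂ) * g s := by
    intro s hs
    rw [hg, ← mul_assoc, ← Complex.ofReal_mul, ← Real.rpow_add hs.1]
    simp
  set Q : ℝ := |(-α)| * κ ^ |(-α) - 1| with hQ
  have hQ0 : 0 ≤ Q := by positivity
  refine ⟨M + (κ ^ |(-α)| * C * δ ^ r + Q * κ * M), r, by positivity, hr, hr1, fun s hs => ?_,
    fun s hs s' hs' h3 h4 => ?_⟩
  · rw [hF s hs, norm_mul, Complex.norm_real, Real.norm_of_nonneg (Real.rpow_nonneg hs.1.le _),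
      mul_comm]
    refine mul_le_mul_of_nonneg_right ((hgM s hs).trans ?_) (Real.rpow_nonneg hs.1.le _)
    have : 0 ≤ κ ^ |(-α)| * C * δ ^ r + Q * κ * M := by positivity
    linarith
  · have hs0 := hs.1
    set u : ℝ := s' / s - 1 with hu
    have hu0 : 0 ≤ u := by
      have : 1 ≤ s' / s := (one_le_div hs0).2 h3
      linarith
    have huκ : u ≤ κ := by
      have : s' / s ≤ κ := (div_le_iff₀ hs0).2 h4
      linarith
    have hP : 0 ≤ s ^ (-α) := Real.rpow_nonneg hs0.le _
    have hP' : 0 ≤ s' ^ (-α) := Real.rpow_nonneg hs'.1.le _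
    have huk : u ≤ κ * u ^ r := by
      rcases hu0.eq_or_lt with h | h
      · rw [← h, Real.zero_rpow hr.ne']; simp
      · have e : u = u ^ (1 - r) * u ^ r := by
          rw [← Real.rpow_add h]; simp
        have : u ^ (1 - r) ≤ κ := by
          calc u ^ (1 - r) ≤ κ ^ (1 - r) := Real.rpow_le_rpow hu0 huκ (by linarith)
            _ ≤ κ ^ (1 : ℝ) := Real.rpow_le_rpow_of_exponent_le hκ (by linarith)
            _ = κ := Real.rpow_one κ
        calc u = u ^ (1 - r) * u ^ r := e
          _ ≤ κ * u ^ r := mul_le_mul_of_nonneg_right this (Real.rpow_nonneg hu0 _)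
    have e : F s' - F s = ((s' ^ (-α) : ℝ) : ℂ) * (g s' - g s) +
        ((s' ^ (-α) - s ^ (-α) : ℝ) : ℂ) * g s := by
      rw [hF s hs, hF s' hs']; push_cast; ring
    have hdiff : ‖g s' - g s‖ ≤ C * δ ^ r * u ^ r := by
      refine (hH s' hs' s hs).trans ?_
      rw [mul_assoc, ← Real.mul_rpow hδ.le hu0]
      refine mul_le_mul_of_nonneg_left (Real.rpow_le_rpow (abs_nonneg _) ?_ hr.le) hC
      rw [abs_of_nonneg (by linarith)]
      have : s' - s = s * u := by rw [hu]; field_simp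
      rw [this]
      exact mul_le_mul_of_nonneg_right hs.2.le hu0
    rw [e]
    refine (norm_add_le _ _).trans ?_
    rw [norm_mul, norm_mul, Complex.norm_real, Complex.norm_real, Real.norm_eq_abs,
      Real.norm_eq_abs, abs_of_nonneg hP']
    have t1 : s' ^ (-α) * ‖g s' - g s‖ ≤ κ ^ |(-α)| * s ^ (-α) * (C * δ ^ r * u ^ r) :=
      mul_le_mul (rpow_le_mul_rpow _ hs0 h3 h4) hdiff (norm_nonneg _) (by positivity)
    have t2 : |s' ^ (-α) - s ^ (-α)| * ‖g s‖ ≤ s ^ (-α) * (Q * (κ * u ^ r)) * M := by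
      refine mul_le_mul ((abs_rpow_sub_rpow_le _ hs0 h3 h4).trans ?_) (hgM s hs) (norm_nonneg _)
        (by positivity)
      exact mul_le_mul_of_nonneg_left (mul_le_mul_of_nonneg_left huk hQ0) hP
    have t3 : 0 ≤ M * s ^ (-α) * u ^ r := by positivity
    linear_combination t1 + t2 + t3

/-- The converse loses a little in the exponent: for `α' > α` the product `g = s ^ α' F` is `O(s ^
γ)` with `γ = α' - α > 0`. Points of ratio at most `κ` are handled by the scaled condition, the
others by the smallness of both values. -/
theorem isHolderOn {α α' δ : ℝ} (hκ : 1 < κ) (hκ2 : κ ≤ 2) (hδ : 0 < δ) (hα : α < α')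
    (h : ScaledHolderOn κ F (-α) (Ioo 0 δ)) :
    IsHolderOn (fun s => ((s ^ α' : ℝ) : ℂ) * F s) (Ioo 0 δ) := by
  obtain ⟨C, r, hC, hr, hr1, h1, h2⟩ := h
  set γ : ℝ := α' - α with hγ
  have hγ0 : 0 < γ := by linarith
  -- Close pairs yield the exponent `r`, distant pairs the exponent `γ`.
  set ρ : ℝ := min r γ with hρ
  have hρ0 : 0 < ρ := lt_min hr hγ0
  have hρr : ρ ≤ r := min_le_left _ _
  have hργ : ρ ≤ γ := min_le_right _ _
  set Q : ℝ := |α'| * κ ^ |α' - 1| with hQ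
  have hQ0 : 0 ≤ Q := by positivity
  -- If `s' > κ s`, then `s' ≤ K (s' - s)`, so powers of `s'` are controlled by powers of the
  -- distance.
  set K : ℝ := κ / (κ - 1) with hK
  have hK0 : 0 < K := div_pos (by linarith) (by linarith)
  set g : ℝ → ℂ := fun s => ((s ^ α' : ℝ) : ℂ) * F s with hg
  have hgb : ∀ s ∈ Ioo (0 : ℝ) δ, ‖g s‖ ≤ C * s ^ γ := by
    intro s hs
    rw [hg, norm_mul, Complex.norm_real, Real.norm_of_nonneg (Real.rpow_nonneg hs.1.le _)]
    calc s ^ α' * ‖F s‖ ≤ s ^ α' * (C * s ^ (-α)) :=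
          mul_le_mul_of_nonneg_left (h1 s hs) (Real.rpow_nonneg hs.1.le _)
      _ = C * (s ^ α' * s ^ (-α)) := by ring
      _ = C * s ^ γ := by rw [← Real.rpow_add hs.1]; rfl
  refine isHolderOn_of_le
    (C := (C + Q * (κ ^ |(-α)| * C)) * δ ^ (γ - ρ) + 2 * C * K ^ γ * δ ^ (γ - ρ)) (r := ρ)
    (by positivity) hρ0 ?_
  intro s hs s' hs' hss
  have hs0 := hs.1
  have hd0 : 0 ≤ s' - s := by linarith
  have hA : 0 ≤ (C + Q * (κ ^ |(-α)| * C)) * δ ^ (γ - ρ) * (s' - s) ^ ρ := by positivity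
  have hB : 0 ≤ 2 * C * K ^ γ * δ ^ (γ - ρ) * (s' - s) ^ ρ := by positivity
  by_cases hcase : s' ≤ κ * s
  · set u : ℝ := s' / s - 1 with hu
    have hu0 : 0 ≤ u := by
      have : 1 ≤ s' / s := (one_le_div hs0).2 hss
      linarith
    have hu1 : u ≤ 1 := by
      have : s' / s ≤ κ := (div_le_iff₀ hs0).2 hcase
      linarith
    have hu_r : u ^ r ≤ u ^ ρ := Real.rpow_le_rpow_of_exponent_ge_of_imp hu0 hu1 hρr
      (fun _ h => absurd h hr.ne')
    have hu_1 : u ≤ u ^ ρ := by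
      conv_lhs => rw [← Real.rpow_one u]
      exact Real.rpow_le_rpow_of_exponent_ge_of_imp hu0 hu1 (hρr.trans hr1)
        (fun _ h => absurd h one_ne_zero)
    have hscale : s ^ γ * u ^ ρ ≤ δ ^ (γ - ρ) * (s' - s) ^ ρ := by
      have e : s ^ γ = s ^ (γ - ρ) * s ^ ρ := by rw [← Real.rpow_add hs0]; congr 1; ring
      have e2 : s' - s = s * u := by rw [hu]; field_simp
      rw [e, e2, Real.mul_rpow hs0.le hu0, mul_assoc]
      exact mul_le_mul_of_nonneg_right (Real.rpow_le_rpow hs0.le hs.2.le (by linarith))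
        (by positivity)
    have e : g s' - g s = ((s ^ α' : ℝ) : ℂ) * (F s' - F s) +
        ((s' ^ α' - s ^ α' : ℝ) : ℂ) * F s' := by
      rw [hg]; push_cast; ring
    have hP : 0 ≤ s ^ α' := Real.rpow_nonneg hs0.le _
    have hP2 : 0 ≤ s ^ (-α) := Real.rpow_nonneg hs0.le _
    have hPP : s ^ α' * s ^ (-α) = s ^ γ := by rw [← Real.rpow_add hs0]; rfl
    have t1 : ‖((s ^ α' : ℝ) : ℂ) * (F s' - F s)‖ ≤ C * (s ^ γ * u ^ ρ) := by
      rw [norm_mul, Complex.norm_real, Real.norm_of_nonneg hP]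
      calc s ^ α' * ‖F s' - F s‖ ≤ s ^ α' * (C * s ^ (-α) * u ^ ρ) :=
            mul_le_mul_of_nonneg_left ((h2 s hs s' hs' hss hcase).trans
              (mul_le_mul_of_nonneg_left hu_r (by positivity))) hP
        _ = C * (s ^ α' * s ^ (-α) * u ^ ρ) := by ring
        _ = _ := by rw [hPP]
    have t2 : ‖((s' ^ α' - s ^ α' : ℝ) : ℂ) * F s'‖ ≤
        Q * (κ ^ |(-α)| * C) * (s ^ γ * u ^ ρ) := by
      rw [norm_mul, Complex.norm_real, Real.norm_eq_abs]
      have f1 : |s' ^ α' - s ^ α'| ≤ s ^ α' * (Q * u ^ ρ) :=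
        (abs_rpow_sub_rpow_le _ hs0 hss hcase).trans
          (mul_le_mul_of_nonneg_left (mul_le_mul_of_nonneg_left hu_1 hQ0) hP)
      have f2 : ‖F s'‖ ≤ C * (κ ^ |(-α)| * s ^ (-α)) :=
        (h1 s' hs').trans (mul_le_mul_of_nonneg_left (rpow_le_mul_rpow _ hs0 hss hcase) hC)
      calc |s' ^ α' - s ^ α'| * ‖F s'‖
          ≤ s ^ α' * (Q * u ^ ρ) * (C * (κ ^ |(-α)| * s ^ (-α))) :=
            mul_le_mul f1 f2 (norm_nonneg _) (by positivity)
        _ = Q * (κ ^ |(-α)| * C) * (s ^ α' * s ^ (-α) * u ^ ρ) := by ring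
        _ = _ := by rw [hPP]
    rw [e]
    refine (norm_add_le_of_le t1 t2).trans ?_
    have : (C + Q * (κ ^ |(-α)| * C)) * (s ^ γ * u ^ ρ) ≤
        (C + Q * (κ ^ |(-α)| * C)) * (δ ^ (γ - ρ) * (s' - s) ^ ρ) :=
      mul_le_mul_of_nonneg_left hscale (by positivity)
    linear_combination this + hB
  · push Not at hcase
    have hs'0 := hs'.1
    have hle : s' ≤ K * (s' - s) := by
      rw [hK, div_mul_eq_mul_div, le_div_iff₀ (by linarith)]
      nlinarith
    have hpow : s' ^ γ ≤ K ^ γ * (δ ^ (γ - ρ) * (s' - s) ^ ρ) := by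
      have hd1 : 0 < s' - s := by nlinarith
      calc s' ^ γ ≤ (K * (s' - s)) ^ γ := Real.rpow_le_rpow hs'0.le hle hγ0.le
        _ = K ^ γ * (s' - s) ^ γ := Real.mul_rpow hK0.le hd0
        _ ≤ _ := by
          refine mul_le_mul_of_nonneg_left ?_ (by positivity)
          have e : (s' - s) ^ γ = (s' - s) ^ (γ - ρ) * (s' - s) ^ ρ := by
            rw [← Real.rpow_add hd1]; congr 1; ring
          rw [e]
          exact mul_le_mul_of_nonneg_right
            (Real.rpow_le_rpow hd0 (by linarith [hs'.2]) (by linarith)) (by positivity)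
    have h3 : s ^ γ ≤ s' ^ γ := Real.rpow_le_rpow hs0.le hss hγ0.le
    have := norm_sub_le_of_le (hgb s' hs') (hgb s hs)
    refine this.trans ?_
    have h4 : C * s ^ γ ≤ C * s' ^ γ := mul_le_mul_of_nonneg_left h3 hC
    have h5 : C * s' ^ γ ≤ C * (K ^ γ * (δ ^ (γ - ρ) * (s' - s) ^ ρ)) :=
      mul_le_mul_of_nonneg_left hpow hC
    linear_combination 2 * h5 + h4 + hA

end ScaledHolderOn

/-! ### The basic estimate of the Cauchy integral at unit scale -/

/-- The Cauchy integral `∫ v(μ) / (μ - z) dμ` over the real line. -/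
noncomputable def lineCauchy (v : ℝ → ℂ) (z : ℂ) : ℂ := ∫ μ : ℝ, v μ / ((μ : ℂ) - z)

/-- Bounds for a density near `t` at the scale `d`: size and Hölder condition on `(t - d, t + d)`,
and the size of the absolute Cauchy integral over the complement. -/
structure LocalBound (v : ℝ → ℂ) (t d r A : ℝ) : Prop where
  aesm : AEStronglyMeasurable v
  d_pos : 0 < d
  r_pos : 0 < r
  r_le : r ≤ 1
  bound : ∀ x ∈ Ioo (t - d) (t + d), ‖v x‖ ≤ A
  holder : ∀ x ∈ Ioo (t - d) (t + d), ∀ y ∈ Ioo (t - d) (t + d), ‖v x - v y‖ ≤ A * (|x - y| / d) ^ r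
  integrable : IntegrableOn (fun μ : ℝ => v μ / ((μ : ℂ) - t)) (Ioo (t - d) (t + d))ᶜ
  far : ∫ μ in (Ioo (t - d) (t + d))ᶜ, ‖v μ / ((μ : ℂ) - t)‖ ≤ A

theorem integrableOn_ball_abs_sub_rpow {p : ℝ} (hp : -1 < p) (c R : ℝ) :
    IntegrableOn (fun x : ℝ => |x - c| ^ p) (Ioo (c - R) (c + R)) := by
  have h : LocallyIntegrable (fun x : ℝ => |x| ^ p) volume := by
    refine locallyIntegrable_of_norm_le_rpow (C := 1) (α := -p) (by simp)
      (by simp; linarith) (Eventually.of_forall fun x => ?_)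
      (measurable_id.abs.pow_const p).aestronglyMeasurable
    rw [neg_neg, one_mul, Real.norm_of_nonneg (Real.rpow_nonneg (abs_nonneg _) _),
      Real.norm_eq_abs]
  have h2 : IntegrableOn (fun x : ℝ => |x| ^ p) (Ioo (-R) R) :=
    (h.integrableOn_isCompact isCompact_Icc).mono_set Ioo_subset_Icc_self
  have h3 := ((integrable_indicator_iff measurableSet_Ioo).2 h2).comp_sub_right c
  rw [← integrable_indicator_iff measurableSet_Ioo]
  refine h3.congr (Eventually.of_forall fun x => ?_)
  by_cases hx : x ∈ Ioo (c - R) (c + R)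
  · have hx' : x - c ∈ Ioo (-R) R := ⟨by linarith [hx.1], by linarith [hx.2]⟩
    simp only [indicator_of_mem hx, indicator_of_mem hx']
  · have hx' : x - c ∉ Ioo (-R) R := fun h => hx ⟨by linarith [h.1], by linarith [h.2]⟩
    simp only [indicator_of_notMem hx, indicator_of_notMem hx']

/-- Replacing the larger of the two bases by the smaller separates a product of singularities at two
points into a sum of integrable ones. The resulting integral is then bounded uniformly in the
position of the points. -/
theorem rpow_mul_rpow_le_add {a b r : ℝ} (ha : 0 < a) (hb : 0 < b) (hr : 0 < r) (hr1 : r ≤ 1) :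
    a ^ (r - 1) * b ^ (-(r / 2)) ≤ a ^ (r / 2 - 1) + b ^ (r / 2 - 1) := by
  have ha' : 0 ≤ a ^ (r / 2 - 1) := by positivity
  have hb' : 0 ≤ b ^ (r / 2 - 1) := by positivity
  rcases le_total a b with h | h
  · have h1 : b ^ (-(r / 2)) ≤ a ^ (-(r / 2)) :=
      Real.rpow_le_rpow_of_nonpos ha h (by linarith)
    have h2 : a ^ (r - 1) * a ^ (-(r / 2)) = a ^ (r / 2 - 1) := by
      rw [← Real.rpow_add ha]; congr 1; ring
    have := mul_le_mul_of_nonneg_left h1 (Real.rpow_nonneg ha.le (r - 1))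
    linarith
  · have h1 : a ^ (r - 1) ≤ b ^ (r - 1) :=
      Real.rpow_le_rpow_of_nonpos hb h (by linarith)
    have h2 : b ^ (r - 1) * b ^ (-(r / 2)) = b ^ (r / 2 - 1) := by
      rw [← Real.rpow_add hb]; congr 1; ring
    have := mul_le_mul_of_nonneg_right h1 (Real.rpow_nonneg hb.le (-(r / 2)))
    linarith

theorem ofReal_sub_ne_zero {z : ℂ} (hz : z.im ≠ 0) (μ : ℝ) : (μ : ℂ) - z ≠ 0 := by
  intro h
  apply hz
  have := congrArg Complex.im h
  simpa using this

theorem abs_sub_re_le_norm (μ : ℝ) (z : ℂ) : |μ - z.re| ≤ ‖(μ : ℂ) - z‖ := by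
  simpa using Complex.abs_re_le_norm ((μ : ℂ) - z)

theorem abs_im_le_norm_ofReal_sub (μ : ℝ) (z : ℂ) : |z.im| ≤ ‖(μ : ℂ) - z‖ := by
  simpa using Complex.abs_im_le_norm ((μ : ℂ) - z)

/-- The points `μ - z` stay in the lower half-plane, so the principal logarithm is a primitive along
the whole path. -/
theorem integral_inv_ofReal_sub {z : ℂ} (hz : 0 < z.im) :
    ∫ μ in Ioo (-1 : ℝ) 1, ((μ : ℂ) - z)⁻¹ = Complex.log (1 - z) - Complex.log (-1 - z) := by
  rw [← integral_Ioc_eq_integral_Ioo, ← intervalIntegral.integral_of_le (by norm_num)]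
  have h0 := ofReal_sub_ne_zero hz.ne'
  rw [intervalIntegral.integral_eq_sub_of_hasDerivAt (f := fun μ : ℝ => Complex.log ((μ : ℂ) - z))]
  · simp
  · intro x _
    have hd : HasDerivAt (fun w : ℂ => Complex.log (w - z)) (((x : ℂ) - z)⁻¹) (x : ℂ) := by
      have : ((x : ℂ) - z) ∈ Complex.slitPlane := Or.inr (by simpa using hz.ne')
      simpa [one_div] using ((hasDerivAt_id (x : ℂ)).sub_const z).clog this
    exact hd.comp_ofReal
  · refine ContinuousOn.intervalIntegrable (ContinuousOn.inv₀ (by fun_prop) fun x _ => h0 x)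

theorem norm_log_sub_log_le {s : Set ℂ} (hs : Convex ℝ s) (hslit : s ⊆ Complex.slitPlane)
    (hn : ∀ w ∈ s, 1 / 2 ≤ |w.re|) {x y : ℂ} (hx : x ∈ s) (hy : y ∈ s) :
    ‖Complex.log y - Complex.log x‖ ≤ 2 * ‖y - x‖ := by
  refine hs.norm_image_sub_le_of_norm_hasDerivWithin_le
    (fun w hw => (Complex.hasDerivAt_log (hslit hw)).hasDerivWithinAt) (fun w hw => ?_) hx hy
  have : 1 / 2 ≤ ‖w‖ := (hn w hw).trans (Complex.abs_re_le_norm w)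
  rw [norm_inv]
  exact inv_le_of_inv_le₀ (by norm_num) (by linarith)

/-- The Cauchy integral of a constant depends on `z` only through logarithms at the end points `±1`,
which stay at distance at least `1 / 2`. On the left one the argument lies in the lower half-plane,
a convex region avoiding the branch cut. -/
theorem norm_integral_inv_sub_integral_inv_le {z w : ℂ} (hz : 0 < z.im) (hw : 0 < w.im)
    (hz' : |z.re| ≤ 1 / 2) (hw' : |w.re| ≤ 1 / 2) :
    ‖(∫ μ in Ioo (-1 : ℝ) 1, ((μ : ℂ) - z)⁻¹) - ∫ μ in Ioo (-1 : ℝ) 1, ((μ : ℂ) - w)⁻¹‖ ≤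
      4 * ‖z - w‖ := by
  rw [integral_inv_ofReal_sub hz, integral_inv_ofReal_sub hw]
  obtain ⟨hz1, hz2⟩ := abs_le.1 hz'
  obtain ⟨hw1, hw2⟩ := abs_le.1 hw'
  have h1 : ‖Complex.log (1 - z) - Complex.log (1 - w)‖ ≤ 2 * ‖(1 - z) - (1 - w)‖ := by
    refine norm_log_sub_log_le (s := {x : ℂ | 1 / 2 ≤ x.re}) (convex_halfSpace_re_ge _) ?_ ?_ ?_ ?_
    · intro x hx; exact Or.inl (lt_of_lt_of_le (by norm_num) hx)
    · intro x hx; exact le_trans hx (le_abs_self _)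
    · simp only [mem_ofPred_eq, Complex.sub_re, Complex.one_re]; linarith
    · simp only [mem_ofPred_eq, Complex.sub_re, Complex.one_re]; linarith
  have h2 : ‖Complex.log (-1 - z) - Complex.log (-1 - w)‖ ≤ 2 * ‖(-1 - z) - (-1 - w)‖ := by
    refine norm_log_sub_log_le (s := {x : ℂ | x.re ≤ -(1 / 2)} ∩ {x : ℂ | x.im < 0})
      ((convex_halfSpace_re_le _).inter (convex_halfSpace_im_lt _)) ?_ ?_ ?_ ?_
    · intro x hx; exact Or.inr hx.2.ne
    · intro x hx
      have : x.re ≤ -(1 / 2) := hx.1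
      exact le_trans (by linarith) (neg_le_abs _)
    · refine ⟨?_, ?_⟩ <;>
        simp only [mem_ofPred_eq, Complex.sub_re, Complex.sub_im, Complex.neg_re, Complex.neg_im, Complex.one_re, Complex.one_im] <;>
        linarith
    · refine ⟨?_, ?_⟩ <;>
        simp only [mem_ofPred_eq, Complex.sub_re, Complex.sub_im, Complex.neg_re, Complex.neg_im, Complex.one_re, Complex.one_im] <;>
        linarith
  rw [sub_sub_sub_cancel_left, norm_sub_rev] at h1 h2
  calc _ = ‖(Complex.log (1 - z) - Complex.log (1 - w)) -
        (Complex.log (-1 - z) - Complex.log (-1 - w))‖ := by congr 1; ring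
    _ ≤ _ := norm_sub_le _ _
    _ ≤ _ := by rw [norm_sub_rev (Complex.log (1 - z)), norm_sub_rev (Complex.log (-1 - z))]; linarith [norm_sub_rev z w]

namespace LocalBound

variable {v : ℝ → ℂ} {t d r A : ℝ}

theorem nonneg (h : LocalBound v t d r A) : 0 ≤ A :=
  (norm_nonneg _).trans (h.bound t ⟨by linarith [h.d_pos], by linarith [h.d_pos]⟩)

/-- The integrand of the Cauchy integral is integrable for `z` off the line near `t`. -/
theorem integrable_div (h : LocalBound v 0 1 r A) {z : ℂ} (hz : z.im ≠ 0) (hz' : |z.re| ≤ 1 / 2) :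
    Integrable (fun μ : ℝ => v μ / ((μ : ℂ) - z)) := by
  have hm : AEStronglyMeasurable (fun μ : ℝ => v μ / ((μ : ℂ) - z)) :=
    h.aesm.mul ((by fun_prop : Measurable fun μ : ℝ => ((μ : ℂ) - z)⁻¹).aestronglyMeasurable)
  have hi := h.integrable
  have hb := h.bound
  simp only [zero_sub, zero_add, Complex.ofReal_zero, sub_zero] at hi hb
  rw [← integrableOn_univ, ← union_compl_self (Ioo (-1 : ℝ) 1)]
  refine IntegrableOn.union ?_ ?_
  · refine Measure.integrableOn_of_bounded (M := A / |z.im|) (by simp) hm ?_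
    filter_upwards [ae_restrict_mem measurableSet_Ioo] with μ hμ
    rw [norm_div]
    exact div_le_div₀ h.nonneg (hb μ hμ) (abs_pos.2 hz) (abs_im_le_norm_ofReal_sub μ z)
  · refine Integrable.mono' (hi.norm.const_mul 2) hm.restrict ?_
    filter_upwards [ae_restrict_mem measurableSet_Ioo.compl] with μ hμ
    have hμ1 : 1 ≤ |μ| := by
      by_contra! hlt
      exact hμ (abs_lt.1 hlt)
    have h1 : |μ| / 2 ≤ ‖(μ : ℂ) - z‖ := by
      have := abs_sub_re_le_norm μ z
      have := abs_sub_abs_le_abs_sub μ z.re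
      linarith
    rw [norm_div, norm_div, Complex.norm_real, Real.norm_eq_abs]
    calc ‖v μ‖ / ‖(μ : ℂ) - z‖ ≤ ‖v μ‖ / (|μ| / 2) :=
          div_le_div_of_nonneg_left (norm_nonneg _) (by linarith) h1
      _ = 2 * (‖v μ‖ / |μ|) := by field_simp

/-- Comparing all points of a box of size `η` over the origin with the single point `η i` gives at
once existence of the limit, its size and its Hölder continuity. Subtracting `v (Re z)` uses the
Hölder condition at the nearest real point, so the bound does not degenerate as `z` approaches the
line. -/
theorem exists_norm_lineCauchy_sub_le (hr : 0 < r) (hr1 : r ≤ 1) : ∃ C : ℝ, 0 ≤ C ∧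
    ∀ (v : ℝ → ℂ) (A : ℝ), LocalBound v 0 1 r A →
      ‖lineCauchy v (Complex.I / 2)‖ ≤ C * A ∧
      ∀ (η : ℝ) (z : ℂ), η ≤ 1 / 2 → |z.re| ≤ η → 0 < z.im → z.im ≤ η →
        ‖lineCauchy v z - lineCauchy v (η * Complex.I)‖ ≤ C * A * η ^ (r / 2) := by
  set J : ℝ := ∫ x in Ioo (-2 : ℝ) 2, |x| ^ (r / 2 - 1) with hJ
  have hJ0 : 0 ≤ J := setIntegral_nonneg measurableSet_Ioo fun x _ => by positivity
  -- The near part contributes `4 J`, the constant part `8` and the far part `4`.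
  refine ⟨12 + 4 * J, by positivity, fun v A h => ?_⟩
  have hA := h.nonneg
  have hi := h.integrable
  have hb := h.bound
  have hh := h.holder
  have hfar := h.far
  simp only [zero_sub, zero_add, Complex.ofReal_zero, sub_zero, div_one] at hi hb hh hfar
  have hfarabs : ∀ μ ∈ (Ioo (-1 : ℝ) 1)ᶜ, 1 ≤ |μ| := fun μ hμ => by
    by_contra! hlt
    exact hμ (abs_lt.1 hlt)
  constructor
  · have hw : (Complex.I / 2).im ≠ 0 := by norm_num
    have hint := h.integrable_div (z := Complex.I / 2) hw (by norm_num)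
    rw [lineCauchy, ← integral_add_compl (measurableSet_Ioo (a := (-1 : ℝ)) (b := 1)) hint]
    have h1 : ‖∫ μ in Ioo (-1 : ℝ) 1, v μ / ((μ : ℂ) - Complex.I / 2)‖ ≤ 2 * A * 2 := by
      have := norm_setIntegral_le_of_norm_le_const (μ := volume) (s := Ioo (-1 : ℝ) 1)
        (f := fun μ : ℝ => v μ / ((μ : ℂ) - Complex.I / 2)) (C := 2 * A) (by simp) (fun μ hμ => by
          rw [norm_div, div_le_iff₀ (norm_pos_iff.2 (ofReal_sub_ne_zero hw μ))]
          have h2 := abs_im_le_norm_ofReal_sub μ (Complex.I / 2)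
          norm_num at h2
          have h3 := hb μ hμ
          nlinarith)
      refine this.trans_eq ?_
      rw [Measure.real, Real.volume_Ioo, ENNReal.toReal_ofReal] <;> norm_num
    have h2 : ‖∫ μ in (Ioo (-1 : ℝ) 1)ᶜ, v μ / ((μ : ℂ) - Complex.I / 2)‖ ≤ A := by
      refine (norm_integral_le_of_norm_le hi.norm ?_).trans hfar
      filter_upwards [ae_restrict_mem measurableSet_Ioo.compl] with μ hμ
      rw [norm_div, norm_div, Complex.norm_real, Real.norm_eq_abs]
      have := abs_sub_re_le_norm μ (Complex.I / 2)
      norm_num at this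
      exact div_le_div_of_nonneg_left (norm_nonneg _) (by linarith [hfarabs μ hμ]) this
    have := norm_add_le_of_le h1 h2
    nlinarith
  · intro η z hη hzre hzim hzim'
    have hη0 : 0 < η := hzim.trans_le hzim'
    set w : ℂ := η * Complex.I with hw
    have hwim : w.im = η := by simp [hw]
    have hwre : w.re = 0 := by simp [hw]
    -- Half of the Hölder exponent is spent on the decay `η ^ q`; the other half keeps the kernel
    -- integrable.
    set q : ℝ := r / 2 with hq
    have hq0 : 0 < q := by positivity
    have hzw : ‖z - w‖ ≤ 2 * η := by
      refine (Complex.norm_le_abs_re_add_abs_im _).trans ?_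
      rw [Complex.sub_re, Complex.sub_im, hwim, hwre, sub_zero]
      have : |z.im - η| ≤ η := abs_le.2 ⟨by linarith, by linarith⟩
      linarith
    have hiz := h.integrable_div (z := z) hzim.ne' (hzre.trans hη)
    have hiw := h.integrable_div (z := w) (by rw [hwim]; exact hη0.ne') (by rw [hwre]; norm_num)
    have hz0 := ofReal_sub_ne_zero hzim.ne'
    have hw0 := ofReal_sub_ne_zero (z := w) (by rw [hwim]; exact hη0.ne')
    set k : ℝ → ℂ := fun μ => ((μ : ℂ) - z)⁻¹ - ((μ : ℂ) - w)⁻¹ with hk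
    have hkc : Continuous k :=
      ((by fun_prop : Continuous fun μ : ℝ => (μ : ℂ) - z).inv₀ hz0).sub
        ((by fun_prop : Continuous fun μ : ℝ => (μ : ℂ) - w).inv₀ hw0)
    have hknorm : ∀ μ : ℝ, ‖k μ‖ ≤ 2 * η / (‖(μ : ℂ) - z‖ * ‖(μ : ℂ) - w‖) := by
      intro μ
      have : k μ = (z - w) / (((μ : ℂ) - z) * ((μ : ℂ) - w)) := by
        rw [hk]
        have := hz0 μ
        have := hw0 μ
        field_simp
        ring
      rw [this, norm_div, norm_mul]
      exact div_le_div_of_nonneg_right hzw (by positivity)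
    have hvk : Integrable (fun μ : ℝ => v μ * k μ) := by
      refine (hiz.sub hiw).congr (Eventually.of_forall fun μ => ?_)
      simp only [hk, Pi.sub_apply, div_eq_mul_inv, mul_sub]
    have hsub : lineCauchy v z - lineCauchy v w = ∫ μ : ℝ, v μ * k μ := by
      rw [lineCauchy, lineCauchy, ← integral_sub hiz hiw]
      simp only [hk, div_eq_mul_inv, mul_sub]
    have hx : z.re ∈ Ioo (-1 : ℝ) 1 := by
      obtain ⟨h1, h2⟩ := abs_le.1 hzre
      constructor <;> linarith
    have hki : IntegrableOn k (Ioo (-1 : ℝ) 1) :=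
      (hkc.integrableOn_Icc).mono_set Ioo_subset_Icc_self
    have hη1 : η ≤ η ^ q := by
      conv_lhs => rw [← Real.rpow_one η]
      exact Real.rpow_le_rpow_of_exponent_ge hη0 (by linarith) (by rw [hq]; linarith)
    -- the far part
    have hpart1 : ‖∫ μ in (Ioo (-1 : ℝ) 1)ᶜ, v μ * k μ‖ ≤ 4 * η * A := by
      have : ‖∫ μ in (Ioo (-1 : ℝ) 1)ᶜ, v μ * k μ‖ ≤
          ∫ μ in (Ioo (-1 : ℝ) 1)ᶜ, 4 * η * ‖v μ / (μ : ℂ)‖ := by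
        refine norm_integral_le_of_norm_le (hi.norm.const_mul _) ?_
        filter_upwards [ae_restrict_mem measurableSet_Ioo.compl] with μ hμ
        have hμ1 := hfarabs μ hμ
        have h1 : |μ| / 2 ≤ ‖(μ : ℂ) - z‖ := by
          have := abs_sub_re_le_norm μ z
          have := abs_sub_abs_le_abs_sub μ z.re
          linarith
        have h2 : 1 ≤ ‖(μ : ℂ) - w‖ := by
          have := abs_sub_re_le_norm μ w
          rw [hwre, sub_zero] at this
          linarith
        have h3 : ‖k μ‖ ≤ 2 * η / (|μ| / 2 * 1) := (hknorm μ).trans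
          (div_le_div_of_nonneg_left (by positivity) (by positivity)
            (mul_le_mul h1 h2 zero_le_one (norm_nonneg _)))
        rw [norm_mul, norm_div, Complex.norm_real, Real.norm_eq_abs]
        calc ‖v μ‖ * ‖k μ‖ ≤ ‖v μ‖ * (2 * η / (|μ| / 2 * 1)) :=
              mul_le_mul_of_nonneg_left h3 (norm_nonneg _)
          _ = 4 * η * (‖v μ‖ / |μ|) := by field_simp; ring
      refine this.trans ?_
      rw [integral_const_mul]
      exact mul_le_mul_of_nonneg_left hfar (by positivity)
    -- the near part with the value at `Re z` subtracted
    have hpart2 : ‖∫ μ in Ioo (-1 : ℝ) 1, (v μ - v z.re) * k μ‖ ≤ 2 * A * η ^ q * (2 * J) := by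
      have hI1 : IntegrableOn (fun μ : ℝ => |μ - z.re| ^ (q - 1)) (Ioo (z.re - 2) (z.re + 2)) :=
        integrableOn_ball_abs_sub_rpow (by linarith) _ _
      have hI2 : IntegrableOn (fun μ : ℝ => |μ| ^ (q - 1)) (Ioo (-2) 2) := by
        have := integrableOn_ball_abs_sub_rpow (p := q - 1) (by linarith) 0 2
        simpa using this
      have hs1 : Ioo (-1 : ℝ) 1 ⊆ Ioo (z.re - 2) (z.re + 2) := fun x hx' =>
        ⟨by linarith [hx'.1, hx.2], by linarith [hx'.2, hx.1]⟩
      have hs2 : Ioo (-1 : ℝ) 1 ⊆ Ioo (-2) 2 := fun x hx' =>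
        ⟨by linarith [hx'.1], by linarith [hx'.2]⟩
      have hJ1 : ∫ μ in Ioo (-1 : ℝ) 1, |μ - z.re| ^ (q - 1) ≤ J := by
        calc _ ≤ ∫ μ in Ioo (z.re - 2) (z.re + 2), |μ - z.re| ^ (q - 1) :=
              setIntegral_mono_set hI1 (Eventually.of_forall fun x => by positivity)
                hs1.eventuallyLE
          _ = J := by
            rw [hJ, ← integral_indicator measurableSet_Ioo, ← integral_indicator measurableSet_Ioo,
              ← integral_sub_right_eq_self
                ((Ioo (-2 : ℝ) 2).indicator fun x : ℝ => |x| ^ (q - 1)) z.re]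
            refine integral_congr_ae (Eventually.of_forall fun x => ?_)
            by_cases hx : x ∈ Ioo (z.re - 2) (z.re + 2)
            · have hx' : x - z.re ∈ Ioo (-2 : ℝ) 2 := ⟨by linarith [hx.1], by linarith [hx.2]⟩
              simp only [indicator_of_mem hx, indicator_of_mem hx']
            · have hx' : x - z.re ∉ Ioo (-2 : ℝ) 2 :=
                fun h => hx ⟨by linarith [h.1], by linarith [h.2]⟩
              simp only [indicator_of_notMem hx, indicator_of_notMem hx']
      have hJ2 : ∫ μ in Ioo (-1 : ℝ) 1, |μ| ^ (q - 1) ≤ J :=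
        setIntegral_mono_set hI2 (Eventually.of_forall fun x => by positivity) hs2.eventuallyLE
      have hne : ∀ᵐ μ : ℝ, μ ≠ 0 := by simp [ae_iff, measure_singleton]
      have hle : ‖∫ μ in Ioo (-1 : ℝ) 1, (v μ - v z.re) * k μ‖ ≤
          ∫ μ in Ioo (-1 : ℝ) 1, 2 * A * η ^ q * (|μ - z.re| ^ (q - 1) + |μ| ^ (q - 1)) := by
        refine norm_integral_le_of_norm_le
          (((hI1.mono_set hs1).add (hI2.mono_set hs2)).const_mul _) ?_
        filter_upwards [ae_restrict_mem measurableSet_Ioo, ae_restrict_of_ae hne] with μ hμ hμ0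
        rw [norm_mul]
        rcases eq_or_ne μ z.re with rfl | hne
        · rw [sub_self, norm_zero, zero_mul]; positivity
        have ha : 0 < |μ - z.re| := abs_pos.2 (sub_ne_zero.2 hne)
        have hb' : 0 < |μ| := abs_pos.2 hμ0
        have h1 : |μ - z.re| ≤ ‖(μ : ℂ) - z‖ := abs_sub_re_le_norm μ z
        have h2 : |μ| ≤ ‖(μ : ℂ) - w‖ := by simpa [hwre] using abs_sub_re_le_norm μ w
        have h3 : η ≤ ‖(μ : ℂ) - w‖ := by
          have := abs_im_le_norm_ofReal_sub μ w
          rwa [hwim, abs_of_pos hη0] at this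
        -- The distance to `w = η i` is at least `η` and at least `|μ|`; interpolation between the
        -- two leaves a gain of `η ^ q` against a mild singularity at zero.
        have h4 : η ^ (1 - q) * |μ| ^ q ≤ ‖(μ : ℂ) - w‖ := by
          have hp : 0 < ‖(μ : ℂ) - w‖ := norm_pos_iff.2 (hw0 μ)
          calc η ^ (1 - q) * |μ| ^ q ≤ ‖(μ : ℂ) - w‖ ^ (1 - q) * ‖(μ : ℂ) - w‖ ^ q :=
                mul_le_mul (Real.rpow_le_rpow hη0.le h3 (by rw [hq]; linarith))
                  (Real.rpow_le_rpow hb'.le h2 hq0.le) (by positivity) (by positivity)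
            _ = ‖(μ : ℂ) - w‖ := by rw [← Real.rpow_add hp]; simp
        have h5 : ‖k μ‖ ≤ 2 * η / (|μ - z.re| * (η ^ (1 - q) * |μ| ^ q)) := (hknorm μ).trans
          (div_le_div_of_nonneg_left (by positivity) (by positivity)
            (mul_le_mul h1 h4 (by positivity) (norm_nonneg _)))
        calc ‖v μ - v z.re‖ * ‖k μ‖
            ≤ (A * |μ - z.re| ^ r) * (2 * η / (|μ - z.re| * (η ^ (1 - q) * |μ| ^ q))) :=
              mul_le_mul (hh μ hμ _ hx) h5 (norm_nonneg _) (by positivity)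
          _ = 2 * A * η ^ q * (|μ - z.re| ^ (r - 1) * |μ| ^ (-q)) := by
              rw [Real.rpow_sub_one ha.ne', Real.rpow_neg hb'.le, Real.rpow_sub hη0,
                Real.rpow_one]
              have := (Real.rpow_pos_of_pos hη0 q).ne'
              have := (Real.rpow_pos_of_pos hb' q).ne'
              field_simp
          _ ≤ _ := mul_le_mul_of_nonneg_left (rpow_mul_rpow_le_add ha hb' hr hr1) (by positivity)
      refine hle.trans ?_
      rw [integral_const_mul, integral_add (hI1.mono_set hs1) (hI2.mono_set hs2)]
      exact mul_le_mul_of_nonneg_left (by linarith) (by positivity)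
    have hpart3 : ‖∫ μ in Ioo (-1 : ℝ) 1, v z.re * k μ‖ ≤ A * (8 * η) := by
      rw [integral_const_mul, norm_mul]
      refine mul_le_mul (hb _ hx) ?_ (norm_nonneg _) hA
      have hIz : IntegrableOn (fun μ : ℝ => ((μ : ℂ) - z)⁻¹) (Ioo (-1 : ℝ) 1) :=
        (((by fun_prop : Continuous fun μ : ℝ => (μ : ℂ) - z).inv₀ hz0).integrableOn_Icc).mono_set
          Ioo_subset_Icc_self
      have hIw : IntegrableOn (fun μ : ℝ => ((μ : ℂ) - w)⁻¹) (Ioo (-1 : ℝ) 1) :=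
        (((by fun_prop : Continuous fun μ : ℝ => (μ : ℂ) - w).inv₀ hw0).integrableOn_Icc).mono_set
          Ioo_subset_Icc_self
      rw [hk, integral_sub hIz hIw]
      refine (norm_integral_inv_sub_integral_inv_le hzim (by rw [hwim]; exact hη0)
        (hzre.trans hη) (by rw [hwre]; norm_num)).trans ?_
      linarith
    have hnear : ∫ μ in Ioo (-1 : ℝ) 1, v μ * k μ =
        (∫ μ in Ioo (-1 : ℝ) 1, (v μ - v z.re) * k μ) + ∫ μ in Ioo (-1 : ℝ) 1, v z.re * k μ := by
      have i2 : IntegrableOn (fun μ : ℝ => v z.re * k μ) (Ioo (-1 : ℝ) 1) := hki.const_mul _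
      rw [← integral_add (by simpa only [sub_mul] using! hvk.integrableOn.sub i2) i2]
      simp only [sub_mul, sub_add_cancel]
    rw [hsub, ← integral_add_compl measurableSet_Ioo hvk, hnear]
    refine (norm_add_le_of_le (norm_add_le_of_le hpart2 hpart3) hpart1).trans ?_
    have : A * η ≤ A * η ^ q := mul_le_mul_of_nonneg_left hη1 hA
    linear_combination 12 * this

end LocalBound

/-! ### Affine invariance -/

theorem integral_comp_add_mul {E : Type*} [NormedAddCommGroup E] [NormedSpace ℝ E] (g : ℝ → E)
    (t : ℝ) {d : ℝ} (hd : 0 < d) : ∫ s, g (t + d * s) = d⁻¹ • ∫ μ, g μ := by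
  rw [Measure.integral_comp_mul_left (fun x => g (t + x)) d, integral_add_left_eq_self g t,
    abs_of_pos (inv_pos.2 hd)]

theorem integrable_comp_add_mul {E : Type*} [NormedAddCommGroup E] {g : ℝ → E}
    (hg : Integrable g) (t : ℝ) {d : ℝ} (hd : 0 < d) : Integrable (fun s => g (t + d * s)) :=
  (hg.comp_add_left t).comp_mul_left' hd.ne'

theorem lineCauchy_comp_add_mul (v : ℝ → ℂ) (t : ℝ) {d : ℝ} (hd : 0 < d) (w : ℂ) :
    lineCauchy (fun s => v (t + d * s)) w = lineCauchy v (t + d * w) := by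
  have h := integral_comp_add_mul (fun μ : ℝ => v μ / ((μ : ℂ) - (t + d * w))) t hd
  rw [lineCauchy, lineCauchy, ← one_smul ℝ (∫ μ : ℝ, v μ / ((μ : ℂ) - (t + d * w))),
    ← mul_inv_cancel₀ hd.ne', mul_smul, ← h, ← integral_smul]
  refine integral_congr_ae (Eventually.of_forall fun s => ?_)
  have hd' : (d : ℂ) ≠ 0 := by exact_mod_cast hd.ne'
  have e : ((t + d * s : ℝ) : ℂ) - (t + d * w) = d * ((s : ℂ) - w) := by push_cast; ring
  simp only [e, Complex.real_smul]
  rw [div_mul_eq_div_div, div_eq_mul_inv (v (t + d * s)) (d : ℂ), ← mul_div_assoc]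
  congr 1
  field_simp

/-- The Cauchy integral truncated at distance `ε` from the real point `t`. -/
noncomputable def truncatedLineCauchy (v : ℝ → ℂ) (t ε : ℝ) : ℂ :=
  ∫ μ in {μ : ℝ | ε < |μ - t|}, v μ / ((μ : ℂ) - t)

theorem measurableSet_lt_abs_sub (t ε : ℝ) : MeasurableSet {μ : ℝ | ε < |μ - t|} :=
  measurableSet_lt measurable_const (by fun_prop)

theorem truncatedLineCauchy_comp_add_mul (v : ℝ → ℂ) (t : ℝ) {d : ℝ} (hd : 0 < d) (ε : ℝ) :
    truncatedLineCauchy (fun s => v (t + d * s)) 0 ε = truncatedLineCauchy v t (d * ε) := by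
  have h := integral_comp_add_mul
    ({μ : ℝ | d * ε < |μ - t|}.indicator fun μ : ℝ => v μ / ((μ : ℂ) - t)) t hd
  rw [truncatedLineCauchy, truncatedLineCauchy, ← integral_indicator (measurableSet_lt_abs_sub _ _),
    ← integral_indicator (measurableSet_lt_abs_sub _ _),
    ← one_smul ℝ (∫ μ : ℝ, {μ : ℝ | d * ε < |μ - t|}.indicator _ μ),
    ← mul_inv_cancel₀ hd.ne', mul_smul, ← h, ← integral_smul]
  refine integral_congr_ae (Eventually.of_forall fun s => ?_)
  have hd' : (d : ℂ) ≠ 0 := by exact_mod_cast hd.ne'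
  have e : t + d * s ∈ {μ : ℝ | d * ε < |μ - t|} ↔ s ∈ {μ : ℝ | ε < |μ - 0|} := by
    simp only [mem_ofPred_eq, add_sub_cancel_left, sub_zero, abs_mul, abs_of_pos hd]
    exact mul_lt_mul_iff_right₀ hd
  by_cases hs : s ∈ {μ : ℝ | ε < |μ - 0|}
  · simp only [indicator_of_mem hs, indicator_of_mem (e.2 hs), Complex.real_smul]
    push_cast
    rw [add_sub_cancel_left, sub_zero]
    field_simp
  · simp only [indicator_of_notMem hs, indicator_of_notMem (fun h => hs (e.1 h)), smul_zero]

namespace LocalBound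

variable {v : ℝ → ℂ} {t d r A : ℝ}

/-- All the bounds are dimensionless: the Hölder condition involves `|x - y| / d`, and the far
integral uses the scale-invariant kernel. Hence the same `A` works at unit scale. -/
theorem comp_add_mul (h : LocalBound v t d r A) :
    LocalBound (fun s => v (t + d * s)) 0 1 r A := by
  have hd := h.d_pos
  have hd' : (d : ℂ) ≠ 0 := by exact_mod_cast hd.ne'
  have hmem : ∀ s : ℝ, t + d * s ∈ Ioo (t - d) (t + d) ↔ s ∈ Ioo (0 - 1 : ℝ) (0 + 1) := by
    intro s
    simp only [mem_Ioo, zero_sub, zero_add]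
    constructor
    · rintro ⟨h1, h2⟩; constructor <;> nlinarith
    · rintro ⟨h1, h2⟩; constructor <;> nlinarith
  have hind : ∀ s : ℝ, (Ioo (0 - 1 : ℝ) (0 + 1))ᶜ.indicator
      (fun s : ℝ => v (t + d * s) / ((s : ℂ) - (0 : ℝ))) s =
      (d : ℂ) * (Ioo (t - d) (t + d))ᶜ.indicator (fun μ : ℝ => v μ / ((μ : ℂ) - t)) (t + d * s) := by
    intro s
    by_cases hs : s ∈ Ioo (0 - 1 : ℝ) (0 + 1)
    · rw [indicator_of_notMem (notMem_compl_iff.2 hs),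
        indicator_of_notMem (notMem_compl_iff.2 ((hmem s).2 hs)), mul_zero]
    · rw [indicator_of_mem (mem_compl hs), indicator_of_mem (mem_compl (mt (hmem s).1 hs))]
      push_cast
      rw [add_sub_cancel_left, sub_zero]
      field_simp
  have hmeas : MeasurableSet (Ioo (0 - 1 : ℝ) (0 + 1))ᶜ := measurableSet_Ioo.compl
  refine ⟨?_, one_pos, h.r_pos, h.r_le, fun x hx => h.bound _ ((hmem x).2 hx), ?_, ?_, ?_⟩
  · have h1 := h.aesm.comp_quasiMeasurePreserving (quasiMeasurePreserving_add_left volume t)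
    exact h1.comp_quasiMeasurePreserving (Measure.quasiMeasurePreserving_smul volume hd.ne')
  · intro x hx y hy
    have := h.holder _ ((hmem x).2 hx) _ ((hmem y).2 hy)
    rwa [add_sub_add_left_eq_sub, ← mul_sub, abs_mul, abs_of_pos hd, mul_div_cancel_left₀ _ hd.ne',
      ← div_one |x - y|] at this
  · rw [← integrable_indicator_iff hmeas]
    refine ((integrable_comp_add_mul
      ((integrable_indicator_iff measurableSet_Ioo.compl).2 h.integrable) t hd).const_mul
      (d : ℂ)).congr (Eventually.of_forall fun s => ?_)
    exact (hind s).symm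
  · refine le_trans (le_of_eq ?_) h.far
    rw [← integral_indicator hmeas, ← integral_indicator measurableSet_Ioo.compl]
    have h1 := integral_comp_add_mul
      ((Ioo (t - d) (t + d))ᶜ.indicator fun μ : ℝ => ‖v μ / ((μ : ℂ) - t)‖) t hd
    rw [← (eq_inv_smul_iff₀ hd.ne').1 h1, ← integral_smul]
    refine integral_congr_ae (Eventually.of_forall fun s => ?_)
    have := congrArg norm (hind s)
    rw [norm_mul, Complex.norm_real, Real.norm_of_nonneg hd.le] at this
    simpa only [norm_indicator_eq_indicator_norm, smul_eq_mul] using this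

/-! ### The Plemelj formulas and boundary values on both sides -/

/-- Subtract `v 0` on the unit interval. The remainder divided by `μ` is integrable by the Hölder
condition, so its vertical and truncated limits coincide by dominated convergence. The constant part
has principal value zero by oddness but vertical limit `π i v(0)`, the Plemelj term. -/
theorem tendsto_truncatedLineCauchy_of_unit (h : LocalBound v 0 1 r A) {L : ℂ}
    (hL : Tendsto (fun y : ℝ => lineCauchy v (y * Complex.I)) (𝓝[>] 0) (𝓝 L)) :
    Tendsto (fun ε => Real.pi * Complex.I * v 0 + truncatedLineCauchy v 0 ε) (𝓝[>] 0) (𝓝 L) := by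
  have hi := h.integrable
  have hh := h.holder
  simp only [zero_sub, zero_add, Complex.ofReal_zero, sub_zero, div_one] at hi hh
  have hA := h.nonneg
  set I : Set ℝ := Ioo (-1) 1 with hI
  have hIm : MeasurableSet I := measurableSet_Ioo
  set c : ℝ → ℂ := I.indicator fun _ => v 0 with hc
  have hcm : AEStronglyMeasurable c :=
    (measurable_const.indicator hIm).aestronglyMeasurable
  set g : ℝ → ℂ := fun μ => v μ - c μ with hg
  have hgm : AEStronglyMeasurable g := h.aesm.sub hcm
  have hdiv : ∀ z : ℂ, AEStronglyMeasurable fun μ : ℝ => g μ / ((μ : ℂ) - z) := fun z =>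
    hgm.mul ((by fun_prop : Measurable fun μ : ℝ => ((μ : ℂ) - z)⁻¹).aestronglyMeasurable)
  have hg0 : Integrable fun μ : ℝ => g μ / ((μ : ℂ) - (0 : ℂ)) := by
    rw [← integrableOn_univ, ← union_compl_self I]
    refine IntegrableOn.union ?_ ?_
    · have hp : IntegrableOn (fun μ : ℝ => |μ| ^ (r - 1)) I := by
        have := integrableOn_ball_abs_sub_rpow (p := r - 1) (by linarith [h.r_pos]) 0 1
        simpa using this
      refine Integrable.mono' (hp.const_mul A) (hdiv 0).restrict ?_
      have hne : ∀ᵐ μ : ℝ, μ ≠ 0 := by simp [ae_iff, measure_singleton]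
      filter_upwards [ae_restrict_mem hIm, ae_restrict_of_ae hne] with μ hμ hμ0
      have hp : 0 < |μ| := abs_pos.2 hμ0
      have hgμ : g μ = v μ - v 0 := by simp only [hg, hc, indicator_of_mem hμ]
      rw [hgμ, norm_div, sub_zero, Complex.norm_real, Real.norm_eq_abs,
        Real.rpow_sub_one hp.ne', ← mul_div_assoc]
      have := hh μ hμ 0 (by rw [hI]; constructor <;> norm_num)
      rw [sub_zero] at this
      exact div_le_div_of_nonneg_right this hp.le
    · refine hi.congr_fun (fun μ hμ => ?_) hIm.compl
      simp only [hg, hc, indicator_of_notMem hμ, sub_zero]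
  have hle : ∀ (y : ℝ) (μ : ℝ), ‖g μ / ((μ : ℂ) - y * Complex.I)‖ ≤ ‖g μ / ((μ : ℂ) - 0)‖ ∨ μ = 0 := by
    intro y μ
    rcases eq_or_ne μ 0 with h0 | h0
    · exact Or.inr h0
    · left
      rw [norm_div, norm_div, sub_zero, Complex.norm_real, Real.norm_eq_abs]
      refine div_le_div_of_nonneg_left (norm_nonneg _) (abs_pos.2 h0) ?_
      simpa using abs_sub_re_le_norm μ (y * Complex.I)
  have hne : ∀ᵐ μ : ℝ, μ ≠ 0 := by simp [ae_iff, measure_singleton]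
  have t1 : Tendsto (fun y : ℝ => ∫ μ : ℝ, g μ / ((μ : ℂ) - y * Complex.I)) (𝓝[>] 0)
      (𝓝 (∫ μ : ℝ, g μ / ((μ : ℂ) - 0))) := by
    refine tendsto_integral_filter_of_dominated_convergence _
      (Eventually.of_forall fun y => hdiv _) (Eventually.of_forall fun y => ?_) hg0.norm ?_
    · filter_upwards [hne] with μ hμ using (hle y μ).resolve_right hμ
    · filter_upwards [hne] with μ hμ
      have : ContinuousAt (fun y : ℝ => g μ / ((μ : ℂ) - y * Complex.I)) 0 :=
        ContinuousAt.div₀ (by fun_prop) (by fun_prop) (by simpa using hμ)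
      have := this.tendsto
      simp only [Complex.ofReal_zero, zero_mul] at this
      exact this.mono_left nhdsWithin_le_nhds
  have t2 : Tendsto (fun ε : ℝ => ∫ μ : ℝ, {μ : ℝ | ε < |μ - 0|}.indicator
      (fun μ : ℝ => g μ / ((μ : ℂ) - 0)) μ) (𝓝[>] 0) (𝓝 (∫ μ : ℝ, g μ / ((μ : ℂ) - 0))) := by
    refine tendsto_integral_filter_of_dominated_convergence _
      (Eventually.of_forall fun ε => (hdiv _).indicator (measurableSet_lt_abs_sub _ _))
      (Eventually.of_forall fun ε => Eventually.of_forall fun μ =>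
        norm_indicator_le_norm_self _ _) hg0.norm ?_
    filter_upwards [hne] with μ hμ
    refine tendsto_const_nhds.congr' ?_
    have : Iio |μ| ∈ 𝓝[>] (0 : ℝ) := nhdsWithin_le_nhds (Iio_mem_nhds (abs_pos.2 hμ))
    filter_upwards [this] with ε hε
    rw [indicator_of_mem]
    simpa using hε
  -- the constant part of the density
  have hlog : Tendsto (fun y : ℝ => Complex.log (1 - y * Complex.I) -
      Complex.log (-1 - y * Complex.I)) (𝓝[>] 0) (𝓝 (Real.pi * Complex.I)) := by
    have l1 : Tendsto (fun y : ℝ => Complex.log (1 - y * Complex.I)) (𝓝[>] 0) (𝓝 0) := by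
      have : ContinuousAt (fun y : ℝ => Complex.log (1 - y * Complex.I)) 0 :=
        ContinuousAt.clog (by fun_prop) (by simp)
      have := this.tendsto
      simp only [Complex.ofReal_zero, zero_mul, sub_zero, Complex.log_one] at this
      exact this.mono_left nhdsWithin_le_nhds
    have l2 : Tendsto (fun y : ℝ => Complex.log (-1 - y * Complex.I)) (𝓝[>] 0)
        (𝓝 (-(Real.pi * Complex.I))) := by
      have h1 := Complex.tendsto_log_nhdsWithin_im_neg_of_re_neg_of_im_zero (z := -1)
        (by simp) (by simp)
      simp only [norm_neg, norm_one, Real.log_one, Complex.ofReal_zero, zero_sub] at h1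
      refine h1.comp (tendsto_nhdsWithin_iff.2 ⟨?_, ?_⟩)
      · have : ContinuousAt (fun y : ℝ => (-1 : ℂ) - y * Complex.I) 0 := by fun_prop
        have := this.tendsto
        simp only [Complex.ofReal_zero, zero_mul, sub_zero] at this
        exact this.mono_left nhdsWithin_le_nhds
      · filter_upwards [self_mem_nhdsWithin] with y hy
        have hy' : 0 < y := hy
        simpa using hy'
    simpa using l1.sub l2
  -- `e1` and `e2` split the vertical approach and the truncation in the same way, so that the
  -- limits `t1` and `t2` can be compared.
  have e1 : ∀ y : ℝ, 0 < y → lineCauchy v (y * Complex.I) =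
      (∫ μ : ℝ, g μ / ((μ : ℂ) - y * Complex.I)) +
        v 0 * (Complex.log (1 - y * Complex.I) - Complex.log (-1 - y * Complex.I)) := by
    intro y hy
    have him : (0 : ℝ) < (y * Complex.I).im := by simpa using hy
    rw [← integral_inv_ofReal_sub him, ← integral_const_mul, ← integral_indicator hIm]
    have i1 : Integrable fun μ : ℝ => g μ / ((μ : ℂ) - y * Complex.I) := by
      refine hg0.norm.mono' (hdiv _) ?_
      filter_upwards [hne] with μ hμ using (hle y μ).resolve_right hμ
    have i2 : Integrable (I.indicator fun μ : ℝ => v 0 * ((μ : ℂ) - y * Complex.I)⁻¹) := by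
      rw [integrable_indicator_iff hIm]
      exact ((continuous_const.mul ((by fun_prop : Continuous fun μ : ℝ =>
        (μ : ℂ) - y * Complex.I).inv₀
        (ofReal_sub_ne_zero him.ne'))).integrableOn_Icc).mono_set Ioo_subset_Icc_self
    rw [← integral_add i1 i2, lineCauchy]
    refine integral_congr_ae (Eventually.of_forall fun μ => ?_)
    by_cases hμ : μ ∈ I
    · simp only [hg, hc, indicator_of_mem hμ]; ring
    · simp only [hg, hc, indicator_of_notMem hμ]; ring
  have e2 : ∀ ε : ℝ, 0 < ε → truncatedLineCauchy v 0 ε =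
      ∫ μ : ℝ, {μ : ℝ | ε < |μ - 0|}.indicator (fun μ : ℝ => g μ / ((μ : ℂ) - 0)) μ := by
    intro ε hε
    set S : Set ℝ := {μ : ℝ | ε < |μ - 0|} with hS
    have hSm : MeasurableSet S := measurableSet_lt_abs_sub _ _
    have hodd : ∫ μ : ℝ, S.indicator (fun μ : ℝ => c μ / (μ : ℂ)) μ = 0 := by
      have hneg := integral_neg_eq_self (S.indicator (fun μ : ℝ => c μ / (μ : ℂ))) volume
      have : ∀ μ : ℝ, S.indicator (fun μ : ℝ => c μ / (μ : ℂ)) (-μ) =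
          -S.indicator (fun μ : ℝ => c μ / (μ : ℂ)) μ := by
        intro μ
        have h1 : -μ ∈ S ↔ μ ∈ S := by simp [hS]
        have h2 : -μ ∈ I ↔ μ ∈ I := by
          simp only [hI, mem_Ioo]; constructor <;> rintro ⟨a, b⟩ <;> constructor <;> linarith
        have h3 : c (-μ) = c μ := by
          by_cases hμ : μ ∈ I
          · simp only [hc, indicator_of_mem hμ, indicator_of_mem (h2.2 hμ)]
          · simp only [hc, indicator_of_notMem hμ, indicator_of_notMem (fun h => hμ (h2.1 h))]
        by_cases hμ : μ ∈ S
        · rw [indicator_of_mem hμ, indicator_of_mem (h1.2 hμ), h3]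
          push_cast; rw [div_neg]
        · rw [indicator_of_notMem hμ, indicator_of_notMem (fun h => hμ (h1.1 h)), neg_zero]
      simp only [this] at hneg
      rw [integral_neg] at hneg
      have h2 : (2 : ℂ) * ∫ μ : ℝ, S.indicator (fun μ : ℝ => c μ / (μ : ℂ)) μ = 0 := by
        linear_combination -hneg
      simpa using h2
    have i1 : Integrable (S.indicator fun μ : ℝ => g μ / ((μ : ℂ) - 0)) := hg0.indicator hSm
    have i2 : Integrable (S.indicator fun μ : ℝ => c μ / (μ : ℂ)) := by
      have : IntegrableOn (fun _ : ℝ => ‖v 0‖ / ε) I := by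
        simp [hI]
      refine (((integrable_indicator_iff hIm).2 this).mono' ((hcm.mul ((by fun_prop : Measurable
        fun μ : ℝ => ((μ : ℂ))⁻¹).aestronglyMeasurable)).indicator hSm)
        (Eventually.of_forall fun μ => ?_))
      by_cases hμ : μ ∈ I
      · by_cases hμS : μ ∈ S
        · rw [indicator_of_mem hμS, indicator_of_mem hμ, hc, indicator_of_mem hμ, norm_div,
            Complex.norm_real, Real.norm_eq_abs]
          have : ε < |μ| := by simpa [hS] using hμS
          exact div_le_div_of_nonneg_left (norm_nonneg _) hε this.le
        · rw [indicator_of_notMem hμS, indicator_of_mem hμ, norm_zero]; positivity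
      · rw [indicator_of_notMem hμ]
        by_cases hμS : μ ∈ S
        · rw [indicator_of_mem hμS, hc, indicator_of_notMem hμ]; simp
        · rw [indicator_of_notMem hμS]; simp
    have hsum := integral_add i1 i2
    rw [hodd, add_zero] at hsum
    rw [← hsum, truncatedLineCauchy, ← integral_indicator hSm]
    refine integral_congr_ae (Eventually.of_forall fun μ => ?_)
    by_cases hμ : μ ∈ S
    · simp only [indicator_of_mem hμ, hg, Complex.ofReal_zero]; ring
    · simp only [indicator_of_notMem hμ, add_zero]
  have hLeq : L = (∫ μ : ℝ, g μ / ((μ : ℂ) - 0)) + v 0 * (Real.pi * Complex.I) := by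
    refine tendsto_nhds_unique hL ((t1.add (hlog.const_mul (v 0))).congr' ?_)
    filter_upwards [self_mem_nhdsWithin] with y hy using (e1 y hy).symm
  rw [hLeq, add_comm, mul_comm (v 0)]
  refine Tendsto.const_add _ (t2.congr' ?_)
  filter_upwards [self_mem_nhdsWithin] with ε hε using (e2 ε hε).symm

end LocalBound

theorem isUpperValue_comp_add_mul {H : ℂ → ℂ} {t d x : ℝ} (hd : 0 < d) {L : ℂ} :
    IsUpperValue (fun w => H (t + d * w)) x L ↔ IsUpperValue H (t + d * x : ℝ) L := by
  have hd' : (d : ℂ) ≠ 0 := by exact_mod_cast hd.ne'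
  constructor
  · intro h
    have hm : Tendsto (fun z : ℂ => (z - t) / d) (𝓝[{z : ℂ | 0 < z.im}] ((t + d * x : ℝ) : ℂ))
        (𝓝[{z : ℂ | 0 < z.im}] (x : ℂ)) := by
      refine tendsto_nhdsWithin_iff.2 ⟨?_, ?_⟩
      · have : ContinuousAt (fun z : ℂ => (z - t) / d) ((t + d * x : ℝ) : ℂ) := by fun_prop
        have := this.tendsto
        rw [show (((t + d * x : ℝ) : ℂ) - t) / d = x by push_cast; field_simp; ring] at this
        exact this.mono_left nhdsWithin_le_nhds
      · filter_upwards [self_mem_nhdsWithin] with z hz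
        have hz' : 0 < z.im := hz
        simp only [Complex.div_ofReal_im, Complex.sub_im, Complex.ofReal_im, sub_zero]
        positivity
    refine (h.comp hm).congr fun z => ?_
    simp only [Function.comp_apply]
    congr 1
    field_simp
    ring
  · intro h
    have hm : Tendsto (fun w : ℂ => (t : ℂ) + d * w) (𝓝[{z : ℂ | 0 < z.im}] (x : ℂ))
        (𝓝[{z : ℂ | 0 < z.im}] ((t + d * x : ℝ) : ℂ)) := by
      refine tendsto_nhdsWithin_iff.2 ⟨?_, ?_⟩
      · have : ContinuousAt (fun w : ℂ => (t : ℂ) + d * w) (x : ℂ) := by fun_prop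
        have := this.tendsto
        push_cast
        exact this.mono_left nhdsWithin_le_nhds
      · filter_upwards [self_mem_nhdsWithin] with z hz
        have hz' : 0 < z.im := hz
        simp only [Complex.add_im, Complex.ofReal_im, zero_add, Complex.im_ofReal_mul]
        positivity
    exact h.comp hm

theorem lineCauchy_conj (v : ℝ → ℂ) (z : ℂ) :
    lineCauchy (fun μ => (starRingEnd ℂ) (v μ)) ((starRingEnd ℂ) z) =
      (starRingEnd ℂ) (lineCauchy v z) := by
  rw [lineCauchy, lineCauchy, ← integral_conj]
  simp

theorem truncatedLineCauchy_conj (v : ℝ → ℂ) (t ε : ℝ) :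
    truncatedLineCauchy (fun μ => (starRingEnd ℂ) (v μ)) t ε =
      (starRingEnd ℂ) (truncatedLineCauchy v t ε) := by
  rw [truncatedLineCauchy, truncatedLineCauchy, ← integral_conj]
  simp

/-- Conjugation of density and variable exchanges the half-planes, so estimates on the upper side
suffice. -/
theorem isUpperValue_lineCauchy_conj_iff {v : ℝ → ℂ} {t : ℝ} {L : ℂ} :
    IsUpperValue (lineCauchy fun μ => (starRingEnd ℂ) (v μ)) t ((starRingEnd ℂ) L) ↔
      IsLowerValue (lineCauchy v) t L := by
  have hconj : Tendsto (starRingEnd ℂ) (𝓝[{z : ℂ | z.im < 0}] (t : ℂ))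
      (𝓝[{z : ℂ | 0 < z.im}] (t : ℂ)) := by
    refine tendsto_nhdsWithin_iff.2 ⟨?_, ?_⟩
    · have := (Complex.continuous_conj.tendsto (t : ℂ))
      rw [Complex.conj_ofReal] at this
      exact this.mono_left nhdsWithin_le_nhds
    · filter_upwards [self_mem_nhdsWithin] with z hz
      have hz' : z.im < 0 := hz
      simpa using hz'
  have hconj' : Tendsto (starRingEnd ℂ) (𝓝[{z : ℂ | 0 < z.im}] (t : ℂ))
      (𝓝[{z : ℂ | z.im < 0}] (t : ℂ)) := by
    refine tendsto_nhdsWithin_iff.2 ⟨?_, ?_⟩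
    · have := (Complex.continuous_conj.tendsto (t : ℂ))
      rw [Complex.conj_ofReal] at this
      exact this.mono_left nhdsWithin_le_nhds
    · filter_upwards [self_mem_nhdsWithin] with z hz
      have hz' : 0 < z.im := hz
      simpa using hz'
  constructor
  · intro h
    have := (Complex.continuous_conj.tendsto _).comp (h.comp hconj)
    rw [Complex.conj_conj] at this
    refine this.congr fun z => ?_
    simp only [Function.comp_apply, lineCauchy_conj, Complex.conj_conj]
  · intro h
    have := (Complex.continuous_conj.tendsto _).comp (h.comp hconj')
    refine this.congr fun z => ?_
    simp only [Function.comp_apply]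
    rw [← lineCauchy_conj, Complex.conj_conj]

theorem IsUpperValue.norm_sub_le_of_box {H : ℂ → ℂ} {x η b : ℝ} {L w : ℂ}
    (hL : IsUpperValue H x L) (hx : |x| < η)
    (h : ∀ z : ℂ, |z.re| ≤ η → 0 < z.im → z.im ≤ η → ‖H z - w‖ ≤ b) : ‖L - w‖ ≤ b := by
  have ht : Tendsto (fun z => ‖H z - w‖) (𝓝[{z : ℂ | 0 < z.im}] (x : ℂ)) (𝓝 ‖L - w‖) :=
    (Tendsto.sub_const hL w).norm
  refine le_of_tendsto ht ?_
  have h1 : {z : ℂ | |z.re| < η} ∈ 𝓝 (x : ℂ) :=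
    (isOpen_lt (by fun_prop) continuous_const).mem_nhds (by simpa using hx)
  have h2 : {z : ℂ | z.im < η} ∈ 𝓝 (x : ℂ) :=
    (isOpen_lt Complex.continuous_im continuous_const).mem_nhds
      (by simpa using (abs_nonneg x).trans_lt hx)
  filter_upwards [self_mem_nhdsWithin, nhdsWithin_le_nhds h1, nhdsWithin_le_nhds h2] with z a b c
  exact h z (le_of_lt b) a (le_of_lt c)

namespace LocalBound

variable {v : ℝ → ℂ} {t d r A : ℝ}

theorem conj (h : LocalBound v t d r A) : LocalBound (fun μ => (starRingEnd ℂ) (v μ)) t d r A := by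
  have e : ∀ μ : ℝ, (starRingEnd ℂ) (v μ) / ((μ : ℂ) - t) =
      (starRingEnd ℂ) (v μ / ((μ : ℂ) - t)) := fun μ => by simp
  refine ⟨Complex.continuous_conj.comp_aestronglyMeasurable h.aesm, h.d_pos, h.r_pos, h.r_le,
    fun x hx => by simpa using h.bound x hx, fun x hx y hy => ?_, ?_, ?_⟩
  · rw [← map_sub, Complex.norm_conj]; exact h.holder x hx y hy
  · simp only [e]
    exact h.integrable.norm.mono'
      (Complex.continuous_conj.comp_aestronglyMeasurable h.integrable.aestronglyMeasurable)
      (Eventually.of_forall fun μ => (Complex.norm_conj _).le)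
  · simpa only [e, Complex.norm_conj] using h.far

/-- The box estimate is a Cauchy criterion at the origin, and it survives passage to any upper value
over the same box. Two boundary values at distance `|x|` are compared through the common point `2
|x| i`. -/
theorem exists_unit_upper (hr : 0 < r) (hr1 : r ≤ 1) : ∃ C : ℝ, 0 ≤ C ∧
    ∀ (v : ℝ → ℂ) (A : ℝ), LocalBound v 0 1 r A →
      (∀ z : ℂ, |z.re| ≤ 1 / 2 → 0 < z.im → z.im ≤ 1 / 2 → ‖lineCauchy v z‖ ≤ C * A) ∧
      ∃ L : ℂ, IsUpperValue (lineCauchy v) (0 : ℝ) L ∧ ‖L‖ ≤ C * A ∧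
        (∀ (x : ℝ) (L' : ℂ), |x| ≤ 1 / 4 → IsUpperValue (lineCauchy v) x L' →
          ‖L' - L‖ ≤ C * A * |x| ^ (r / 2)) ∧
        Tendsto (fun ε => Real.pi * Complex.I * v 0 + truncatedLineCauchy v 0 ε) (𝓝[>] 0)
          (𝓝 L) := by
  obtain ⟨C, hC, hmain⟩ := exists_norm_lineCauchy_sub_le hr hr1
  have hq : 0 < r / 2 := by positivity
  refine ⟨4 * C, by positivity, fun v A h => ?_⟩
  obtain ⟨hmid, hbox⟩ := hmain v A h
  have hA := h.nonneg
  have hCA : 0 ≤ C * A := mul_nonneg hC hA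
  have hbound : ∀ z : ℂ, |z.re| ≤ 1 / 2 → 0 < z.im → z.im ≤ 1 / 2 →
      ‖lineCauchy v z‖ ≤ 2 * (C * A) := by
    intro z h1 h2 h3
    have h4 := hbox (1 / 2) z le_rfl h1 h2 h3
    have h5 : (((1 / 2 : ℝ) : ℂ) * Complex.I) = Complex.I / 2 := by push_cast; ring
    rw [h5] at h4
    have h6 : (1 / 2 : ℝ) ^ (r / 2) ≤ 1 := Real.rpow_le_one (by norm_num) (by norm_num) hq.le
    have h7 := norm_le_norm_sub_add (lineCauchy v z) (lineCauchy v (Complex.I / 2))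
    have h8 : C * A * (1 / 2 : ℝ) ^ (r / 2) ≤ C * A := mul_le_of_le_one_right hCA h6
    linarith
  have hlim : ∃ L : ℂ, IsUpperValue (lineCauchy v) (0 : ℝ) L := by
    refine cauchy_map_iff_exists_tendsto.1 (Metric.cauchy_iff.2 ⟨inferInstance, fun ε hε => ?_⟩)
    have ht : Tendsto (fun η : ℝ => 2 * (C * A * η ^ (r / 2))) (𝓝[>] 0) (𝓝 0) := by
      have h1 : ContinuousAt (fun η : ℝ => 2 * (C * A * η ^ (r / 2))) 0 := by
        have := Real.continuousAt_rpow_const 0 (r / 2) (Or.inr hq.le)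
        fun_prop
      have := h1.tendsto
      rw [Real.zero_rpow hq.ne', mul_zero, mul_zero] at this
      exact this.mono_left nhdsWithin_le_nhds
    obtain ⟨η, hη1, hη2, hη3⟩ := ((ht.eventually (gt_mem_nhds hε)).and
      (Filter.Eventually.and (nhdsWithin_le_nhds (Iic_mem_nhds (show (0 : ℝ) < 1 / 2 by norm_num)))
        self_mem_nhdsWithin)).exists
    have hη0 : 0 < η := hη3
    refine ⟨lineCauchy v '' {z : ℂ | |z.re| < η ∧ 0 < z.im ∧ z.im < η}, ?_, ?_⟩
    · refine image_mem_map ?_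
      have h1 : {z : ℂ | |z.re| < η} ∈ 𝓝 ((0 : ℝ) : ℂ) :=
        (isOpen_lt (by fun_prop) continuous_const).mem_nhds (by simpa using hη0)
      have h2 : {z : ℂ | z.im < η} ∈ 𝓝 ((0 : ℝ) : ℂ) :=
        (isOpen_lt Complex.continuous_im continuous_const).mem_nhds (by simpa using hη0)
      filter_upwards [self_mem_nhdsWithin, nhdsWithin_le_nhds h1, nhdsWithin_le_nhds h2]
        with z a b c using ⟨b, a, c⟩
    · rintro _ ⟨x, ⟨hx1, hx2, hx3⟩, rfl⟩ _ ⟨y, ⟨hy1, hy2, hy3⟩, rfl⟩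
      have h1 := hbox η x hη2 hx1.le hx2 hx3.le
      have h2 := hbox η y hη2 hy1.le hy2 hy3.le
      have h3 := dist_triangle_right (lineCauchy v x) (lineCauchy v y)
        (lineCauchy v (η * Complex.I))
      rw [dist_eq_norm (lineCauchy v x) (lineCauchy v (η * Complex.I)),
        dist_eq_norm (lineCauchy v y) (lineCauchy v (η * Complex.I))] at h3
      linarith
  obtain ⟨L, hL⟩ := hlim
  refine ⟨fun z h1 h2 h3 => (hbound z h1 h2 h3).trans (by linarith), L, hL, ?_, ?_, ?_⟩
  · have := hL.norm_sub_le_of_box (w := 0) (b := 2 * (C * A)) (η := 1 / 2) (by norm_num)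
      (fun z h1 h2 h3 => by simpa using hbound z h1 h2 h3)
    rw [sub_zero] at this
    linarith
  · intro x L' hx hL'
    rcases eq_or_ne x 0 with rfl | hx0
    · rw [hL'.unique hL, sub_self, norm_zero]; positivity
    have hxp : 0 < |x| := abs_pos.2 hx0
    -- The box of size `2 |x|` has `x` strictly inside its base, and `|x| ≤ 1 / 4` keeps its size at
    -- most `1 / 2`.
    have h1 := hL'.norm_sub_le_of_box (η := 2 * |x|) (by linarith)
      (fun z h1 h2 h3 => hbox (2 * |x|) z (by linarith) h1 h2 h3)
    have h2 := hL.norm_sub_le_of_box (η := 2 * |x|) (by simpa using hxp)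
      (fun z h1 h2 h3 => hbox (2 * |x|) z (by linarith) h1 h2 h3)
    have h3 : (2 * |x|) ^ (r / 2) ≤ 2 * |x| ^ (r / 2) := by
      rw [Real.mul_rpow (by norm_num) hxp.le]
      refine mul_le_mul_of_nonneg_right ?_ (by positivity)
      calc (2 : ℝ) ^ (r / 2) ≤ 2 ^ (1 : ℝ) :=
            Real.rpow_le_rpow_of_exponent_le (by norm_num) (by linarith)
        _ = 2 := Real.rpow_one 2
    have h4 := norm_sub_le_norm_sub_add_norm_sub L' (lineCauchy v ((2 * |x| : ℝ) * Complex.I)) L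
    rw [norm_sub_rev (lineCauchy v _) L] at h4
    have h5 : C * A * (2 * |x|) ^ (r / 2) ≤ C * A * (2 * |x| ^ (r / 2)) :=
      mul_le_mul_of_nonneg_left h3 hCA
    linarith
  · refine h.tendsto_truncatedLineCauchy_of_unit ?_
    refine hL.comp (tendsto_nhdsWithin_iff.2 ⟨?_, ?_⟩)
    · have : ContinuousAt (fun y : ℝ => (y : ℂ) * Complex.I) 0 := by fun_prop
      have := this.tendsto
      rw [Complex.ofReal_zero, zero_mul] at this
      rw [Complex.ofReal_zero]
      exact this.mono_left nhdsWithin_le_nhds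
    · filter_upwards [self_mem_nhdsWithin] with y hy
      have hy' : 0 < y := hy
      simpa using hy'

/-- Size, boundary values and the Plemelj formula for the Cauchy integral on the upper side. -/
theorem exists_upper (hr : 0 < r) (hr1 : r ≤ 1) : ∃ C : ℝ, 0 ≤ C ∧
    ∀ (v : ℝ → ℂ) (t d A : ℝ), LocalBound v t d r A →
      (∀ z : ℂ, |z.re - t| ≤ d / 2 → 0 < z.im → z.im ≤ d / 2 → ‖lineCauchy v z‖ ≤ C * A) ∧
      ∃ L : ℂ, IsUpperValue (lineCauchy v) t L ∧ ‖L‖ ≤ C * A ∧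
        (∀ (x : ℝ) (L' : ℂ), |x - t| ≤ d / 4 → IsUpperValue (lineCauchy v) x L' →
          ‖L' - L‖ ≤ C * A * (|x - t| / d) ^ (r / 2)) ∧
        Tendsto (fun ε => Real.pi * Complex.I * v t + truncatedLineCauchy v t ε) (𝓝[>] 0)
          (𝓝 L) := by
  obtain ⟨C, hC, hmain⟩ := exists_unit_upper hr hr1
  refine ⟨C, hC, fun v t d A h => ?_⟩
  have hd := h.d_pos
  have hd' : (d : ℂ) ≠ 0 := by exact_mod_cast hd.ne'
  have hv : lineCauchy (fun s => v (t + d * s)) = fun w : ℂ => lineCauchy v (t + d * w) :=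
    funext fun w => lineCauchy_comp_add_mul v t hd w
  obtain ⟨hb, L, hL, hLb, hLx, hLt⟩ := hmain _ A h.comp_add_mul
  rw [hv] at hL hLx
  refine ⟨fun z h1 h2 h3 => ?_, L, ?_, hLb, fun x L' hx hL' => ?_, ?_⟩
  · have e : z = t + d * ((z - t) / d) := by field_simp; ring
    have := hb ((z - t) / d) (by
        rw [Complex.div_ofReal_re, Complex.sub_re, Complex.ofReal_re, abs_div, abs_of_pos hd,
          div_le_iff₀ hd]; linarith) (by
        rw [Complex.div_ofReal_im, Complex.sub_im, Complex.ofReal_im, sub_zero]; positivity) (by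
        rw [Complex.div_ofReal_im, Complex.sub_im, Complex.ofReal_im, sub_zero, div_le_iff₀ hd]
        linarith)
    rwa [lineCauchy_comp_add_mul v t hd, ← e] at this
  · have := (isUpperValue_comp_add_mul hd).1 hL
    rwa [mul_zero, add_zero] at this
  · have e : |(x - t) / d| = |x - t| / d := by rw [abs_div, abs_of_pos hd]
    have := hLx ((x - t) / d) L' (by rw [e, div_le_iff₀ hd]; linarith)
      ((isUpperValue_comp_add_mul hd).2 (by
        rwa [show t + d * ((x - t) / d) = x by field_simp; ring]))
    rwa [e] at this
  · simp only [mul_zero, add_zero, truncatedLineCauchy_comp_add_mul v t hd] at hLt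
    have hm : Tendsto (fun ε : ℝ => ε / d) (𝓝[>] 0) (𝓝[>] 0) := by
      refine tendsto_nhdsWithin_iff.2 ⟨?_, ?_⟩
      · have : ContinuousAt (fun ε : ℝ => ε / d) 0 := by fun_prop
        have := this.tendsto
        rw [zero_div] at this
        exact this.mono_left nhdsWithin_le_nhds
      · filter_upwards [self_mem_nhdsWithin] with ε hε
        exact div_pos hε hd
    refine (hLt.comp hm).congr fun ε => ?_
    simp only [Function.comp_apply]
    rw [mul_div_cancel₀ _ hd.ne']

/-- Size, boundary values and the Plemelj formula for the Cauchy integral on the lower side. -/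
theorem exists_lower (hr : 0 < r) (hr1 : r ≤ 1) : ∃ C : ℝ, 0 ≤ C ∧
    ∀ (v : ℝ → ℂ) (t d A : ℝ), LocalBound v t d r A →
      (∀ z : ℂ, |z.re - t| ≤ d / 2 → z.im < 0 → -z.im ≤ d / 2 → ‖lineCauchy v z‖ ≤ C * A) ∧
      ∃ L : ℂ, IsLowerValue (lineCauchy v) t L ∧ ‖L‖ ≤ C * A ∧
        (∀ (x : ℝ) (L' : ℂ), |x - t| ≤ d / 4 → IsLowerValue (lineCauchy v) x L' →
          ‖L' - L‖ ≤ C * A * (|x - t| / d) ^ (r / 2)) ∧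
        Tendsto (fun ε => -(Real.pi * Complex.I * v t) + truncatedLineCauchy v t ε) (𝓝[>] 0)
          (𝓝 L) := by
  obtain ⟨C, hC, hmain⟩ := exists_upper hr hr1
  refine ⟨C, hC, fun v t d A h => ?_⟩
  obtain ⟨hb, L, hL, hLb, hLx, hLt⟩ := hmain _ t d A h.conj
  refine ⟨fun z h1 h2 h3 => ?_, (starRingEnd ℂ) L, ?_, by rwa [Complex.norm_conj],
    fun x L' hx hL' => ?_, ?_⟩
  · have := hb ((starRingEnd ℂ) z) (by simpa using h1) (by simpa using h2) (by simpa using h3)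
    rwa [lineCauchy_conj, Complex.norm_conj] at this
  · rw [← isUpperValue_lineCauchy_conj_iff, Complex.conj_conj]
    exact hL
  · have := hLx x _ hx (isUpperValue_lineCauchy_conj_iff.2 hL')
    rwa [← Complex.norm_conj, map_sub, Complex.conj_conj] at this
  · refine ((Complex.continuous_conj.tendsto _).comp hLt).congr fun ε => ?_
    simp only [Function.comp_apply, truncatedLineCauchy_conj, map_add, map_mul, Complex.conj_conj,
      Complex.conj_ofReal, Complex.conj_I]
    ring

end LocalBound

/-! ### The nodal class in scaled form -/

namespace IsNodalHolder

variable {N : Finset ℝ} {f g : ℝ → ℂ} {κ : ℝ}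

theorem scaled_right (hf : IsNodalHolder N f) (hκ : 1 ≤ κ) {c : ℝ} (hc : c = 0 ∨ c ∈ N) :
    ∃ α < (1 : ℝ), ∃ δ > 0, ScaledHolderOn κ (fun s => f (c + s)) (-α) (Ioo 0 δ) := by
  obtain ⟨α, hα, δ, hδ, hH⟩ := hf.right_of_node c hc
  refine ⟨α, hα, δ, hδ, ScaledHolderOn.of_isHolderOn hκ hδ ?_⟩
  obtain ⟨C, r, hC, hr, -, h⟩ := hH.exists_le (Metric.isBounded_Ioo _ _)
  refine isHolderOn_of_le hC hr fun x hx y hy hxy => ?_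
  have := h (c + y) ⟨by linarith [hy.1], by linarith [hy.2]⟩ (c + x)
    ⟨by linarith [hx.1], by linarith [hx.2]⟩
  simpa only [add_sub_cancel_left, add_sub_add_left_eq_sub, abs_of_pos hx.1, abs_of_pos hy.1,
    abs_of_nonneg (sub_nonneg.2 hxy)] using this

theorem scaled_left (hf : IsNodalHolder N f) (hκ : 1 ≤ κ) {c : ℝ} (hc : c ∈ N) :
    ∃ α < (1 : ℝ), ∃ δ > 0, ScaledHolderOn κ (fun s => f (c - s)) (-α) (Ioo 0 δ) := by
  obtain ⟨α, hα, δ, hδ, hH⟩ := hf.left_of_node c hc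
  refine ⟨α, hα, δ, hδ, ScaledHolderOn.of_isHolderOn hκ hδ ?_⟩
  obtain ⟨C, r, hC, hr, -, h⟩ := hH.exists_le (Metric.isBounded_Ioo _ _)
  refine isHolderOn_of_le hC hr fun x hx y hy hxy => ?_
  have := h (c - y) ⟨by linarith [hy.2], by linarith [hy.1]⟩ (c - x)
    ⟨by linarith [hx.2], by linarith [hx.1]⟩
  rw [show c - y - c = -y by ring, show c - x - c = -x by ring, abs_neg, abs_neg,
    show c - y - (c - x) = -(y - x) by ring, abs_neg] at this
  simpa only [abs_of_pos hx.1, abs_of_pos hy.1, abs_of_nonneg (sub_nonneg.2 hxy)] using this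

theorem scaled_infty (hf : IsNodalHolder N f) (hκ : 1 ≤ κ) :
    ∃ β > (0 : ℝ), ∃ R > 0, ScaledHolderOn κ f (-β) (Ioi R) := by
  obtain ⟨β, hβ, δ, hδ, hH⟩ := hf.at_infinity
  have h1 := (ScaledHolderOn.of_isHolderOn hκ hδ hH).inv hκ fun s hs => hs.1
  refine ⟨β, hβ, 1 / δ, by positivity, ?_⟩
  rw [neg_neg] at h1
  refine (h1.mono fun t ht => ?_).congr fun t _ => by simp
  have ht' : 1 / δ < t := ht
  have ht0 : 0 < t := (by positivity : 0 < 1 / δ).trans ht'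
  exact ⟨by positivity, (one_div_lt hδ ht0).1 ht'⟩

/-- The scaled description suffices for membership in the class because a node exponent may move
from `α` to `(α + 1) / 2`, still below one, and the decay exponent from `β` to `β / 2`, still
positive. -/
theorem of_scaled (hκ : 1 < κ) (hκ2 : κ ≤ 2)
    (hloc : ∀ a b : ℝ, (∀ t ∈ Icc a b, 0 < t ∧ t ∉ N) → IsHolderOn f (Icc a b))
    (hright : ∀ c : ℝ, (c = 0 ∨ c ∈ N) → ∃ α < (1 : ℝ), ∃ δ > 0,
      ScaledHolderOn κ (fun s => f (c + s)) (-α) (Ioo 0 δ))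
    (hleft : ∀ c ∈ N, ∃ α < (1 : ℝ), ∃ δ > 0,
      ScaledHolderOn κ (fun s => f (c - s)) (-α) (Ioo 0 δ))
    (hinf : ∃ β > (0 : ℝ), ∃ R > 0, ScaledHolderOn κ f (-β) (Ioi R)) : IsNodalHolder N f := by
  refine ⟨hloc, fun c hc => ?_, fun c hc => ?_, ?_⟩
  · obtain ⟨α, hα, δ, hδ, h⟩ := hright c hc
    refine ⟨(α + 1) / 2, by linarith, δ, hδ, ?_⟩
    obtain ⟨C, r, hC, hr, -, h⟩ := (h.isHolderOn hκ hκ2 hδ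
      (show α < (α + 1) / 2 by linarith)).exists_le (Metric.isBounded_Ioo _ _)
    refine isHolderOn_of_le hC hr fun x hx y hy hxy => ?_
    have := h (y - c) ⟨by linarith [hy.1], by linarith [hy.2]⟩ (x - c)
      ⟨by linarith [hx.1], by linarith [hx.2]⟩
    simpa only [add_sub_cancel, sub_sub_sub_cancel_right, abs_of_pos (sub_pos.2 hx.1),
      abs_of_pos (sub_pos.2 hy.1), abs_of_nonneg (sub_nonneg.2 hxy)] using this
  · obtain ⟨α, hα, δ, hδ, h⟩ := hleft c hc
    refine ⟨(α + 1) / 2, by linarith, δ, hδ, ?_⟩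
    obtain ⟨C, r, hC, hr, -, h⟩ := (h.isHolderOn hκ hκ2 hδ
      (show α < (α + 1) / 2 by linarith)).exists_le (Metric.isBounded_Ioo _ _)
    refine isHolderOn_of_le hC hr fun x hx y hy hxy => ?_
    have := h (c - y) ⟨by linarith [hy.2], by linarith [hy.1]⟩ (c - x)
      ⟨by linarith [hx.2], by linarith [hx.1]⟩
    rw [show c - y - (c - x) = -(y - x) by ring, abs_neg, abs_of_nonneg (sub_nonneg.2 hxy)] at this
    simpa only [sub_sub_cancel, abs_sub_comm x c, abs_sub_comm y c, abs_of_pos (sub_pos.2 hx.2),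
      abs_of_pos (sub_pos.2 hy.2)] using this
  · obtain ⟨β, hβ, R, hR, h⟩ := hinf
    refine ⟨β / 2, by linarith, 1 / R, by positivity, ?_⟩
    have h1 := h.inv hκ.le fun s hs => hR.trans hs
    rw [← neg_neg (- -β), neg_neg (-β)] at h1
    refine ScaledHolderOn.isHolderOn hκ hκ2 (by positivity) (show -β < -(β / 2) by linarith)
      (h1.mono fun s hs => ?_)
    exact (lt_one_div hs.1 hR).1 hs.2

/-- This puts half the jump of a sectionally analytic function into the class of admissible
densities. Different exponents are merged into the worse one, after restricting to distances below
one at a node and above one at infinity. -/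
theorem half_sub (hf : IsNodalHolder N f) (hg : IsNodalHolder N g) :
    IsNodalHolder N fun t => (f t - g t) / 2 := by
  have comb : ∀ {F G : ℝ → ℂ} {p : ℝ} {S : Set ℝ}, (∀ s ∈ S, 0 < s) → ScaledHolderOn 2 F p S →
      ScaledHolderOn 2 G p S → ScaledHolderOn 2 (fun t => (F t - G t) / 2) p S := by
    intro F G p S hS hF hG
    refine ((hF.const_mul (1 / 2)).add (hG.const_mul (-(1 / 2))) one_le_two hS).congr
      fun s _ => ?_
    ring
  have node : ∀ {F G : ℝ → ℂ}, (∃ α < (1 : ℝ), ∃ δ > 0, ScaledHolderOn 2 F (-α) (Ioo 0 δ)) →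
      (∃ α < (1 : ℝ), ∃ δ > 0, ScaledHolderOn 2 G (-α) (Ioo 0 δ)) →
      ∃ α < (1 : ℝ), ∃ δ > 0, ScaledHolderOn 2 (fun t => (F t - G t) / 2) (-α) (Ioo 0 δ) := by
    rintro F G ⟨α, hα, δ, hδ, hF⟩ ⟨α', hα', δ', hδ', hG⟩
    have hpos : ∀ s ∈ Ioo (0 : ℝ) (min (min δ δ') 1), 0 < s := fun s hs => hs.1
    refine ⟨max α α', max_lt hα hα', min (min δ δ') 1, by positivity, comb hpos ?_ ?_⟩
    · refine (hF.mono (Ioo_subset_Ioo_right ((min_le_left _ _).trans (min_le_left _ _)))).of_rpow_le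
        hpos fun s hs => ?_
      exact Real.rpow_le_rpow_of_exponent_ge hs.1 (hs.2.le.trans (min_le_right _ _))
        (neg_le_neg (le_max_left _ _))
    · refine (hG.mono (Ioo_subset_Ioo_right ((min_le_left _ _).trans (min_le_right _ _)))).of_rpow_le
        hpos fun s hs => ?_
      exact Real.rpow_le_rpow_of_exponent_ge hs.1 (hs.2.le.trans (min_le_right _ _))
        (neg_le_neg (le_max_right _ _))
  refine of_scaled one_lt_two le_rfl (fun a b hab => ?_)
    (fun c hc => node (hf.scaled_right one_le_two hc) (hg.scaled_right one_le_two hc))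
    (fun c hc => node (hf.scaled_left one_le_two hc) (hg.scaled_left one_le_two hc)) ?_
  · obtain ⟨C, r, hC, hr, hr1, h⟩ := (hf.locally_holder a b hab).exists_le (Metric.isBounded_Icc _ _)
    obtain ⟨C', r', hC', hr', hr1', h'⟩ :=
      (hg.locally_holder a b hab).exists_le (Metric.isBounded_Icc _ _)
    have hpow : ∀ ρ, 0 < ρ → ρ ≤ 1 → min r r' ≤ ρ → ∀ x ∈ Icc a b, ∀ y ∈ Icc a b, x ≤ y →
        (y - x) ^ ρ ≤ (1 + (b - a)) * (y - x) ^ (min r r') := by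
      intro ρ hρ hρ1 hle x hx y hy hxy
      have h0 : 0 ≤ y - x := by linarith
      have hm : 0 < min r r' := lt_min hr hr'
      have e : (y - x) ^ ρ = (y - x) ^ (ρ - min r r') * (y - x) ^ (min r r') := by
        rw [← Real.rpow_add_of_nonneg h0 (by linarith) hm.le]; congr 1; ring
      rw [e]
      refine mul_le_mul_of_nonneg_right ?_ (by positivity)
      calc (y - x) ^ (ρ - min r r') ≤ (1 + (b - a)) ^ (ρ - min r r') :=
            Real.rpow_le_rpow h0 (by linarith [hx.1, hy.2]) (by linarith)
        _ ≤ (1 + (b - a)) ^ (1 : ℝ) :=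
            Real.rpow_le_rpow_of_exponent_le (by linarith [hx.1, hx.2]) (by linarith)
        _ = _ := Real.rpow_one _
    rcases lt_or_ge b a with hba | hba
    · rw [Icc_eq_empty hba.not_ge]; exact ⟨1, 1, one_pos, holderOnWith_empty _ _ _⟩
    refine isHolderOn_of_le (C := (C + C') * (1 + (b - a))) (r := min r r')
      (mul_nonneg (by positivity) (by linarith)) (lt_min hr hr') fun x hx y hy hxy => ?_
    have h1 := h y hy x hx
    have h1' := h' y hy x hx
    rw [abs_of_nonneg (by linarith)] at h1 h1'
    have e : (f y - g y) / 2 - (f x - g x) / 2 = ((f y - f x) - (g y - g x)) / 2 := by ring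
    have h2 := mul_le_mul_of_nonneg_left (hpow r hr hr1 (min_le_left _ _) x hx y hy hxy) hC
    have h2' := mul_le_mul_of_nonneg_left (hpow r' hr' hr1' (min_le_right _ _) x hx y hy hxy) hC'
    have h3 := norm_sub_le (f y - f x) (g y - g x)
    rw [e, norm_div, Complex.norm_ofNat]
    have h4 := norm_nonneg (f y - f x - (g y - g x))
    linarith
  · obtain ⟨β, hβ, R, hR, hF⟩ := hf.scaled_infty one_le_two
    obtain ⟨β', hβ', R', hR', hG⟩ := hg.scaled_infty one_le_two
    have hpos : ∀ s ∈ Ioi (max (max R R') 1), 0 < s := fun s hs =>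
      lt_of_lt_of_le (by positivity) (le_of_lt (mem_Ioi.1 hs))
    have hone : ∀ s ∈ Ioi (max (max R R') 1), 1 ≤ s := fun s hs =>
      (le_max_right _ _).trans (le_of_lt (mem_Ioi.1 hs))
    refine ⟨min β β', lt_min hβ hβ', max (max R R') 1, by positivity, comb hpos ?_ ?_⟩
    · refine (hF.mono (Ioi_subset_Ioi ((le_max_left _ _).trans (le_max_left _ _)))).of_rpow_le
        hpos fun s hs => ?_
      exact Real.rpow_le_rpow_of_exponent_le (hone s hs) (neg_le_neg (min_le_left _ _))
    · refine (hG.mono (Ioi_subset_Ioi ((le_max_right _ _).trans (le_max_left _ _)))).of_rpow_le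
        hpos fun s hs => ?_
      exact Real.rpow_le_rpow_of_exponent_le (hone s hs) (neg_le_neg (min_le_right _ _))

end IsNodalHolder

/-! ### Extension by zero, integrability and weights dominating the kernel -/

theorem integrable_of_local_rpow_bounds {f : ℝ → ℂ} (hm : AEStronglyMeasurable f)
    (hloc : ∀ x : ℝ, ∃ γ < (1 : ℝ), ∃ C : ℝ, ∃ ρ > 0, ∀ y, y ≠ x → |y - x| < ρ →
      ‖f y‖ ≤ C * |y - x| ^ (-γ))
    (hinf : ∃ β > (1 : ℝ), ∃ C R : ℝ, ∀ y, R < |y| → ‖f y‖ ≤ C * (1 + |y|) ^ (-β)) :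
    Integrable f := by
  have hli : LocallyIntegrable f volume := by
    intro x
    obtain ⟨γ, hγ, C, ρ, hρ, h⟩ := hloc x
    refine ⟨Ioo (x - ρ) (x + ρ), Ioo_mem_nhds (by linarith) (by linarith), ?_⟩
    refine ((integrableOn_ball_abs_sub_rpow (p := -γ) (by linarith) x ρ).const_mul C).mono'
      hm.restrict ?_
    have hne : ∀ᵐ μ : ℝ, μ ≠ x := by simp [ae_iff, measure_singleton]
    filter_upwards [ae_restrict_mem measurableSet_Ioo, ae_restrict_of_ae hne] with y hy hyx
    exact h y hyx (abs_lt.2 ⟨by linarith [hy.1], by linarith [hy.2]⟩)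
  obtain ⟨β, hβ, C, R, h⟩ := hinf
  have hint : Integrable (fun y : ℝ => (1 + ‖y‖) ^ (-β)) :=
    integrable_one_add_norm (by simpa using hβ)
  refine hli.integrable_of_isBigO_cocompact (IsBigO.of_bound C ?_) (hint.integrableAtFilter _)
  have : ∀ᶠ y : ℝ in cocompact ℝ, R < ‖y‖ := (tendsto_norm_cocompact_atTop (E := ℝ)).eventually_gt_atTop R
  filter_upwards [this] with y hy
  rw [Real.norm_of_nonneg (by positivity)]
  exact h y hy

/-- Splitting `a⁻¹ = a ^ (-α) a ^ (α - 1)` and bounding the factors by different quantities extracts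
the expected order `s ^ (-α)` and leaves a weight that does not depend on `s`. -/
theorem inv_le_mul_rpow {a s b K α : ℝ} (ha : 0 < a) (hs : 0 < s) (hb : 0 < b) (hK : 0 < K)
    (hα : 0 < α) (hα1 : α < 1) (h1 : s ≤ K * a) (h2 : b ≤ K * a) :
    a⁻¹ ≤ K * s ^ (-α) * b ^ (α - 1) := by
  have e : (K * a)⁻¹ = (K * a) ^ (-α) * (K * a) ^ (α - 1) := by
    rw [← Real.rpow_add (by positivity), ← Real.rpow_neg_one]; congr 1; ring
  have h3 : (K * a) ^ (-α) ≤ s ^ (-α) := Real.rpow_le_rpow_of_nonpos hs h1 (by linarith)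
  have h4 : (K * a) ^ (α - 1) ≤ b ^ (α - 1) := Real.rpow_le_rpow_of_nonpos hb h2 (by linarith)
  have h5 : (K * a)⁻¹ ≤ s ^ (-α) * b ^ (α - 1) := by
    rw [e]; exact mul_le_mul h3 h4 (by positivity) (by positivity)
  calc a⁻¹ = K * (K * a)⁻¹ := by field_simp
    _ ≤ K * (s ^ (-α) * b ^ (α - 1)) := mul_le_mul_of_nonneg_left h5 hK.le
    _ = _ := by ring

/-- The density on the positive semi-axis extended by zero to the line. -/
noncomputable def zeroExtend (v : ℝ → ℂ) : ℝ → ℂ := (Ioi (0 : ℝ)).indicator v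

theorem zeroExtend_of_pos {v : ℝ → ℂ} {t : ℝ} (ht : 0 < t) : zeroExtend v t = v t :=
  indicator_of_mem (s := Ioi (0 : ℝ)) ht v

theorem zeroExtend_of_nonpos {v : ℝ → ℂ} {t : ℝ} (ht : t ≤ 0) : zeroExtend v t = 0 :=
  indicator_of_notMem (s := Ioi (0 : ℝ)) (not_lt.2 ht) v

theorem isOpen_pos_notMem (N : Finset ℝ) : IsOpen {t : ℝ | 0 < t ∧ t ∉ N} :=
  (isOpen_lt continuous_const continuous_id).inter N.finite_toSet.isClosed.isOpen_compl

theorem exists_thickening_pos_notMem {N : Finset ℝ} {a b : ℝ}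
    (h : ∀ t ∈ Icc a b, 0 < t ∧ t ∉ N) :
    ∃ η > 0, ∀ t₀ ∈ Icc a b, ∀ t, |t - t₀| ≤ η → 0 < t ∧ t ∉ N := by
  obtain ⟨η, hη, hsub⟩ := (isCompact_Icc (a := a) (b := b)).exists_cthickening_subset_open
    (isOpen_pos_notMem N) h
  exact ⟨η, hη, fun t₀ ht₀ t ht => hsub (Metric.mem_cthickening_of_dist_le t t₀ η _ ht₀ ht)⟩

theorem ScaledHolderOn.zero (κ p : ℝ) {S : Set ℝ} : ScaledHolderOn κ (fun _ => 0) p S :=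
  ⟨0, 1, le_rfl, one_pos, le_rfl, fun s _ => by simp, fun s _ s' _ _ _ => by simp⟩

namespace IsNodalHolder

variable {N : Finset ℝ} {v : ℝ → ℂ}

theorem continuousAt (hv : IsNodalHolder N v) {t : ℝ} (ht : 0 < t) (htN : t ∉ N) :
    ContinuousAt v t := by
  obtain ⟨η, hη, h⟩ := exists_thickening_pos_notMem (N := N) (a := t) (b := t) (by
    intro s hs; rw [Icc_self] at hs; rw [mem_singleton_iff.1 hs]; exact ⟨ht, htN⟩)
  obtain ⟨C, r, hr, hH⟩ := hv.locally_holder (t - η) (t + η) fun s hs =>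
    h t (by simp) s (abs_le.2 ⟨by linarith [hs.1], by linarith [hs.2]⟩)
  exact (hH.continuousOn hr).continuousAt (Icc_mem_nhds (by linarith) (by linarith))

theorem aestronglyMeasurable_zeroExtend (hv : IsNodalHolder N v) :
    AEStronglyMeasurable (zeroExtend v) := by
  have hU := (isOpen_pos_notMem N).measurableSet
  have h1 : ContinuousOn v {t : ℝ | 0 < t ∧ t ∉ N} := fun t ht =>
    (hv.continuousAt ht.1 ht.2).continuousWithinAt
  have h2 : AEStronglyMeasurable ({t : ℝ | 0 < t ∧ t ∉ N}.indicator v) :=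
    (aestronglyMeasurable_indicator_iff hU).2 (h1.aestronglyMeasurable hU)
  refine h2.congr ?_
  have hN0 : ∀ᵐ t : ℝ, t ∉ (N : Set ℝ) := by
    rw [ae_iff]; simpa using N.finite_toSet.measure_zero volume
  filter_upwards [hN0] with t ht
  by_cases h0 : 0 < t
  · rw [zeroExtend_of_pos h0, indicator_of_mem]
    exact ⟨h0, ht⟩
  · rw [zeroExtend_of_nonpos (not_lt.1 h0), indicator_of_notMem]
    exact fun h => h0 h.1

/-- The zero extension makes the origin two-sided, and raising the order to at least `1 / 2` gives a
common positive exponent. The ratio `3` is that of the end points of `(s / 2, 3 s / 2)`, the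
neighbourhood used at distance `s`. -/
theorem exists_node_scaled (hv : IsNodalHolder N v) (hN : ∀ c ∈ N, 0 < c) {c : ℝ}
    (hc : c = 0 ∨ c ∈ N) : ∃ α, 0 < α ∧ α < 1 ∧ ∃ δ, 0 < δ ∧ δ ≤ 1 ∧
      ScaledHolderOn 3 (fun s => zeroExtend v (c + s)) (-α) (Ioo 0 δ) ∧
      ScaledHolderOn 3 (fun s => zeroExtend v (c - s)) (-α) (Ioo 0 δ) := by
  have hc0 : 0 ≤ c := hc.elim (fun h => h.ge) fun h => (hN c h).le
  have hleft : ∃ α < (1 : ℝ), ∃ δ > 0,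
      ScaledHolderOn 3 (fun s => zeroExtend v (c - s)) (-α) (Ioo 0 δ) := by
    rcases hc with rfl | hc
    · refine ⟨0, one_pos, 1, one_pos, (ScaledHolderOn.zero 3 _).congr fun s hs => ?_⟩
      exact (zeroExtend_of_nonpos (by linarith [hs.1])).symm
    · obtain ⟨α, hα, δ, hδ, h⟩ := hv.scaled_left (κ := 3) (by norm_num) hc
      refine ⟨α, hα, min δ c, lt_min hδ (hN c hc),
        (h.mono (Ioo_subset_Ioo_right (min_le_left _ _))).congr fun s hs => ?_⟩
      exact (zeroExtend_of_pos (by linarith [hs.2, min_le_right δ c])).symm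
  obtain ⟨α, hα, δ, hδ, h⟩ := hv.scaled_right (κ := 3) (by norm_num) hc
  obtain ⟨α', hα', δ', hδ', h'⟩ := hleft
  have hpos : ∀ s ∈ Ioo (0 : ℝ) (min (min δ δ') 1), 0 < s := fun s hs => hs.1
  refine ⟨max (max α α') (1 / 2), by positivity, max_lt (max_lt hα hα') (by norm_num),
    min (min δ δ') 1, by positivity, min_le_right _ _, ?_, ?_⟩
  · have h2 := (h.mono (Ioo_subset_Ioo_right ((min_le_left (min δ δ') 1).trans
      (min_le_left _ _)))).of_rpow_le (q := -max (max α α') (1 / 2)) hpos fun s hs =>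
        Real.rpow_le_rpow_of_exponent_ge hs.1 (hs.2.le.trans (min_le_right _ _))
          (neg_le_neg ((le_max_left _ _).trans (le_max_left _ _)))
    refine h2.congr fun s hs => ?_
    exact (zeroExtend_of_pos (by linarith [hs.1])).symm
  · exact (h'.mono (Ioo_subset_Ioo_right ((min_le_left (min δ δ') 1).trans
      (min_le_right _ _)))).of_rpow_le hpos fun s hs =>
        Real.rpow_le_rpow_of_exponent_ge hs.1 (hs.2.le.trans (min_le_right _ _))
          (neg_le_neg ((le_max_right _ _).trans (le_max_left _ _)))

theorem exists_infty_scaled (hv : IsNodalHolder N v) : ∃ β, 0 < β ∧ β < 1 ∧ ∃ R, 1 ≤ R ∧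
      ScaledHolderOn 3 (zeroExtend v) (-β) (Ioi R) := by
  obtain ⟨β, hβ, R, hR, h⟩ := hv.scaled_infty (κ := 3) (by norm_num)
  have hone : ∀ s ∈ Ioi (max R 1), 1 ≤ s := fun s hs =>
    (le_max_right _ _).trans (le_of_lt (mem_Ioi.1 hs))
  refine ⟨min β (1 / 2), by positivity, (min_le_right _ _).trans_lt (by norm_num), max R 1,
    le_max_right _ _, ?_⟩
  refine ((h.mono (Ioi_subset_Ioi (le_max_left _ _))).of_rpow_le (q := -min β (1 / 2))
    (fun s hs => by linarith [hone s hs]) fun s hs =>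
      Real.rpow_le_rpow_of_exponent_le (hone s hs) (neg_le_neg (min_le_left _ _))).congr
    fun s hs => (zeroExtend_of_pos (by linarith [hone s hs])).symm

theorem exists_local_bound (hv : IsNodalHolder N v) (hN : ∀ c ∈ N, 0 < c) (x : ℝ) :
    ∃ γ < (1 : ℝ), ∃ C : ℝ, ∃ ρ > 0, ∀ y, y ≠ x → |y - x| < ρ →
      ‖zeroExtend v y‖ ≤ C * |y - x| ^ (-γ) := by
  by_cases hx : x = 0 ∨ x ∈ N
  · obtain ⟨α, hα, hα1, δ, hδ, hδ1, ⟨C, r, hC, -, -, h, -⟩, ⟨C', r', hC', -, -, h', -⟩⟩ :=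
      hv.exists_node_scaled hN hx
    refine ⟨α, hα1, C + C', δ, hδ, fun y hy hyx => ?_⟩
    have hp : 0 ≤ |y - x| ^ (-α) := by positivity
    rcases lt_or_gt_of_ne hy with hlt | hlt
    · have e : |y - x| = x - y := by rw [abs_sub_comm, abs_of_pos (by linarith)]
      have := h' (x - y) ⟨by linarith, by linarith⟩
      simp only [sub_sub_cancel] at this
      rw [e] at hp ⊢
      nlinarith
    · have e : |y - x| = y - x := abs_of_pos (by linarith)
      have := h (y - x) ⟨by linarith, by linarith⟩
      simp only [add_sub_cancel] at this
      rw [e] at hp ⊢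
      nlinarith
  · push Not at hx
    have hbd : ∃ C : ℝ, ∀ᶠ y in 𝓝 x, ‖zeroExtend v y‖ ≤ C := by
      rcases lt_or_gt_of_ne hx.1 with hlt | hlt
      · refine ⟨0, ?_⟩
        filter_upwards [Iio_mem_nhds hlt] with y hy
        rw [zeroExtend_of_nonpos (le_of_lt hy), norm_zero]
      · have hc := (hv.continuousAt hlt hx.2).norm
        refine ⟨‖v x‖ + 1, ?_⟩
        filter_upwards [hc.eventually (gt_mem_nhds (lt_add_one _)), Ioi_mem_nhds hlt] with y hy hy0
        rw [zeroExtend_of_pos hy0]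
        exact le_of_lt hy
    obtain ⟨C, hC⟩ := hbd
    obtain ⟨ρ, hρ, h⟩ := Metric.eventually_nhds_iff.1 hC
    refine ⟨0, one_pos, C, ρ, hρ, fun y _ hy => ?_⟩
    rw [neg_zero, Real.rpow_zero, mul_one]
    exact h hy

end IsNodalHolder

theorem exists_norm_zeroExtend_le {v : ℝ → ℂ} {β R : ℝ} (hβ : 0 < β) (hR : 1 ≤ R)
    (h : ScaledHolderOn 3 (zeroExtend v) (-β) (Ioi R)) :
    ∃ C : ℝ, 0 ≤ C ∧ ∀ y, R < |y| → ‖zeroExtend v y‖ ≤ C * (1 + |y|) ^ (-β) := by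
  obtain ⟨C, r, hC, -, -, h, -⟩ := h
  refine ⟨C * 2 ^ β, by positivity, fun y hy => ?_⟩
  rcases lt_or_ge 0 y with h0 | h0
  · rw [abs_of_pos h0] at hy ⊢
    refine (h y hy).trans ?_
    have h1 : y ^ (-β) ≤ ((1 + y) / 2) ^ (-β) :=
      Real.rpow_le_rpow_of_nonpos (by positivity) (by linarith) (by linarith)
    have h2 : ((1 + y) / 2) ^ (-β) = 2 ^ β * (1 + y) ^ (-β) := by
      rw [Real.div_rpow (by positivity) (by norm_num), Real.rpow_neg (by norm_num : (0 : ℝ) ≤ 2),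
        div_inv_eq_mul, mul_comm]
    rw [h2] at h1
    calc C * y ^ (-β) ≤ C * (2 ^ β * (1 + y) ^ (-β)) := mul_le_mul_of_nonneg_left h1 hC
      _ = _ := by ring
  · rw [zeroExtend_of_nonpos h0, norm_zero]; positivity

/-- Estimates of a density near an end point `c` (or near infinity, then `c = 0`): scaled Hölder
estimates on both sides of order `-α`, and integrability against a weight `w` that dominates the
Cauchy kernel. -/
structure EndData (v : ℝ → ℂ) (c α : ℝ) (w : ℝ → ℝ) (S S' : Set ℝ) : Prop where
  pos : ∀ s ∈ S, 0 < s
  subset : S' ⊆ S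
  scale : ∀ s ∈ S', ∀ σ ∈ Ioo (s / 2) (3 * s / 2), σ ∈ S
  α_pos : 0 < α
  α_lt : α < 1
  aesm : AEStronglyMeasurable v
  right : ScaledHolderOn 3 (fun s => v (c + s)) (-α) S
  left : ScaledHolderOn 3 (fun s => v (c - s)) (-α) S
  w_nonneg : ∀ μ, 0 ≤ w μ
  integrable : Integrable fun μ => ‖v μ‖ * w μ
  kernel : ∀ s ∈ S, ∀ K : ℝ, 1 ≤ K → ∀ᵐ μ : ℝ, ∀ a : ℝ, 0 < a → s ≤ K * a → |μ - c| ≤ K * a →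
    a⁻¹ ≤ 2 * K * s ^ (-α) * w μ

namespace IsNodalHolder

variable {N : Finset ℝ} {v : ℝ → ℂ}

theorem exists_endData_node (hv : IsNodalHolder N v) (hN : ∀ c ∈ N, 0 < c) {c : ℝ}
    (hc : c = 0 ∨ c ∈ N) : ∃ α δ : ℝ, 0 < δ ∧ ∃ w : ℝ → ℝ,
      EndData (zeroExtend v) c α w (Ioo 0 δ) (Ioo 0 (δ / 2)) := by
  obtain ⟨α₀, hα₀, hα₀1, δ, hδ, hδ1, hr, hl⟩ := hv.exists_node_scaled hN hc
  obtain ⟨β, hβ, hβ1, R, hR, hinf⟩ := hv.exists_infty_scaled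
  obtain ⟨C', hC', hbinf⟩ := exists_norm_zeroExtend_le hβ hR hinf
  -- With `α > α₀` the product `|μ - c| ^ (-α₀) |μ - c| ^ (α - 1)` is integrable at `c`, while `α <
  -- 1` keeps the order admissible.
  set α : ℝ := (α₀ + 1) / 2 with hα
  have hpow : ∀ s ∈ Ioo (0 : ℝ) δ, s ^ (-α₀) ≤ s ^ (-α) := fun s hs =>
    Real.rpow_le_rpow_of_exponent_ge hs.1 (hs.2.le.trans hδ1) (by linarith)
  have hm := hv.aestronglyMeasurable_zeroExtend
  -- The power is the useful bound near `c`; the reciprocal supplies the decay needed at infinity.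
  -- Both dominate the kernel, because `s ^ (-α) ≥ 1` for small `s`.
  set w : ℝ → ℝ := fun μ => min (|μ - c| ^ (α - 1)) (|μ - c|⁻¹) with hw
  have hw0 : ∀ μ, 0 ≤ w μ := fun μ => le_min (by positivity) (by positivity)
  have hwm : Measurable w := by
    refine Measurable.min (Measurable.pow_const (by fun_prop) _) ?_
    exact Measurable.inv (by fun_prop)
  refine ⟨α, δ, hδ, w, fun s hs => hs.1, Ioo_subset_Ioo_right (by linarith), ?_, by linarith,
    by linarith, hm, hr.of_rpow_le (fun s hs => hs.1) hpow,
    hl.of_rpow_le (fun s hs => hs.1) hpow, hw0, ?_, ?_⟩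
  · rintro s ⟨h1, h2⟩ σ ⟨h3, h4⟩
    exact ⟨by linarith, by linarith⟩
  · have key : Integrable fun μ => zeroExtend v μ * (w μ : ℂ) := by
      have hnorm : ∀ y, ‖zeroExtend v y * (w y : ℂ)‖ = ‖zeroExtend v y‖ * w y := fun y => by
        rw [norm_mul, Complex.norm_real, Real.norm_of_nonneg (hw0 y)]
      refine integrable_of_local_rpow_bounds
        (hm.mul (Complex.measurable_ofReal.comp hwm).aestronglyMeasurable) (fun x => ?_) ?_
      · by_cases hxc : x = c
        · subst hxc
          obtain ⟨C, r, hC, -, -, h, -⟩ := hr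
          obtain ⟨C', r', hC', -, -, h', -⟩ := hl
          refine ⟨α₀ + (1 - α), by linarith, C + C', δ, hδ, fun y hy hyx => ?_⟩
          rw [hnorm]
          have hp : 0 < |y - x| := abs_pos.2 (sub_ne_zero.2 hy)
          have hv1 : ‖zeroExtend v y‖ ≤ (C + C') * |y - x| ^ (-α₀) := by
            have hp' : 0 ≤ |y - x| ^ (-α₀) := by positivity
            rcases lt_or_gt_of_ne hy with hlt | hlt
            · have e : |y - x| = x - y := by rw [abs_sub_comm, abs_of_pos (by linarith)]
              have := h' (x - y) ⟨by linarith, by linarith⟩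
              simp only [sub_sub_cancel] at this
              rw [e] at hp' ⊢
              nlinarith
            · have e : |y - x| = y - x := abs_of_pos (by linarith)
              have := h (y - x) ⟨by linarith, by linarith⟩
              simp only [add_sub_cancel] at this
              rw [e] at hp' ⊢
              nlinarith
          calc ‖zeroExtend v y‖ * w y ≤ (C + C') * |y - x| ^ (-α₀) * |y - x| ^ (α - 1) :=
                mul_le_mul hv1 (min_le_left _ _) (hw0 y) (by positivity)
            _ = (C + C') * (|y - x| ^ (-α₀) * |y - x| ^ (α - 1)) := by ring
            _ = _ := by rw [← Real.rpow_add hp]; congr 2; ring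
        · obtain ⟨γ, hγ, C, ρ, hρ, h⟩ := hv.exists_local_bound hN x
          have hd : 0 < |x - c| := abs_pos.2 (sub_ne_zero.2 hxc)
          refine ⟨γ, hγ, C * (|x - c| / 2)⁻¹, min ρ (|x - c| / 2), by positivity, fun y hy hyx => ?_⟩
          rw [hnorm]
          have h1 := h y hy (hyx.trans_le (min_le_left _ _))
          have h2 : w y ≤ (|x - c| / 2)⁻¹ := by
            refine (min_le_right _ _).trans (inv_anti₀ (by positivity) ?_)
            have h3 := hyx.trans_le (min_le_right _ _)
            have h4 := abs_sub_le x y c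
            rw [abs_sub_comm x y] at h4
            linarith
          calc ‖zeroExtend v y‖ * w y ≤ C * |y - x| ^ (-γ) * (|x - c| / 2)⁻¹ :=
                mul_le_mul h1 h2 (hw0 y) ((norm_nonneg _).trans h1)
            _ = _ := by ring
      · refine ⟨1 + β, by linarith, C' * 4, max R (2 * |c| + 1), fun y hy => ?_⟩
        rw [hnorm]
        have h1 := hbinf y ((le_max_left _ _).trans_lt hy)
        have h2 : 2 * |c| + 1 < |y| := (le_max_right _ _).trans_lt hy
        have h3 : (1 + |y|) / 4 ≤ |y - c| := by
          have := abs_sub_abs_le_abs_sub y c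
          linarith [abs_nonneg c]
        have h4 : w y ≤ 4 * (1 + |y|)⁻¹ := by
          refine (min_le_right _ _).trans ((inv_anti₀ (by positivity) h3).trans_eq ?_)
          rw [inv_div, div_eq_mul_inv]
        have hp : 0 < 1 + |y| := by positivity
        calc ‖zeroExtend v y‖ * w y ≤ C' * (1 + |y|) ^ (-β) * (4 * (1 + |y|)⁻¹) :=
              mul_le_mul h1 h4 (hw0 y) (by positivity)
          _ = C' * 4 * ((1 + |y|) ^ (-β) * (1 + |y|)⁻¹) := by ring
          _ = _ := by
            rw [← Real.rpow_neg_one (1 + |y|), ← Real.rpow_add hp]; congr 2; ring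
    refine key.norm.congr (Eventually.of_forall fun y => ?_)
    simp only [norm_mul, Complex.norm_real, Real.norm_of_nonneg (hw0 y)]
  · intro s hs K hK
    have hne : ∀ᵐ μ : ℝ, μ ≠ c := by simp [ae_iff, measure_singleton]
    filter_upwards [hne] with μ hμ a ha h1 h2
    have hb : 0 < |μ - c| := abs_pos.2 (sub_ne_zero.2 hμ)
    have hK0 : 0 < K := by linarith
    have hs1 : 1 ≤ s ^ (-α) :=
      Real.one_le_rpow_of_pos_of_le_one_of_nonpos hs.1 (hs.2.le.trans hδ1) (by linarith)
    have k1 := inv_le_mul_rpow ha hs.1 hb hK0 (α := α) (by linarith) (by linarith) h1 h2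
    have k2 : a⁻¹ ≤ K * s ^ (-α) * |μ - c|⁻¹ := by
      have : a⁻¹ ≤ K * |μ - c|⁻¹ := by
        rw [← div_eq_mul_inv, le_div_iff₀ hb, inv_mul_le_iff₀ ha]; linarith
      refine this.trans (mul_le_mul_of_nonneg_right ?_ (by positivity))
      exact le_mul_of_one_le_right hK0.le hs1
    have k3 : a⁻¹ ≤ K * s ^ (-α) * w μ := by
      rw [hw, mul_min_of_nonneg _ _ (by positivity)]
      exact le_min k1 k2
    have : 0 ≤ K * s ^ (-α) * w μ := mul_nonneg (by positivity) (hw0 μ)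
    linarith

theorem exists_endData_infty (hv : IsNodalHolder N v) (hN : ∀ c ∈ N, 0 < c) :
    ∃ α R : ℝ, 1 ≤ R ∧
      EndData (zeroExtend v) 0 α (fun μ => (1 + |μ|) ^ (α - 1)) (Ioi R) (Ioi (2 * R)) := by
  obtain ⟨β, hβ, hβ1, R, hR, hinf⟩ := hv.exists_infty_scaled
  obtain ⟨C', hC', hbinf⟩ := exists_norm_zeroExtend_le hβ hR hinf
  -- Half of the decay is kept as the order at infinity; the other half makes `(1 + |μ|) ^ (-β + α -
  -- 1)` integrable.
  set α : ℝ := β / 2 with hα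
  have hm := hv.aestronglyMeasurable_zeroExtend
  have hpos : ∀ s ∈ Ioi R, 0 < s := fun s hs => by linarith [mem_Ioi.1 hs]
  have hw0 : ∀ μ : ℝ, 0 ≤ (1 + |μ|) ^ (α - 1) := fun μ => by positivity
  refine ⟨α, R, hR, hpos, Ioi_subset_Ioi (by linarith), ?_, by linarith, by linarith, hm,
    ?_, ?_, hw0, ?_, ?_⟩
  · rintro s hs σ ⟨h3, h4⟩
    have hs' : 2 * R < s := hs
    exact mem_Ioi.2 (by linarith)
  · simp only [zero_add]
    exact hinf.of_rpow_le hpos fun s hs =>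
      Real.rpow_le_rpow_of_exponent_le (by linarith [mem_Ioi.1 hs]) (by linarith)
  · refine (ScaledHolderOn.zero 3 _).congr fun s hs => ?_
    exact (zeroExtend_of_nonpos (by linarith [hpos s hs])).symm
  · have key : Integrable fun μ => zeroExtend v μ * (((1 + |μ|) ^ (α - 1) : ℝ) : ℂ) := by
      have hnorm : ∀ y, ‖zeroExtend v y * (((1 + |y|) ^ (α - 1) : ℝ) : ℂ)‖ =
          ‖zeroExtend v y‖ * (1 + |y|) ^ (α - 1) := fun y => by
        rw [norm_mul, Complex.norm_real, Real.norm_of_nonneg (hw0 y)]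
      have hwm : Measurable fun μ : ℝ => (1 + |μ|) ^ (α - 1) :=
        Measurable.pow_const (by fun_prop) _
      refine integrable_of_local_rpow_bounds
        (hm.mul (Complex.measurable_ofReal.comp hwm).aestronglyMeasurable) (fun x => ?_) ?_
      · obtain ⟨γ, hγ, C, ρ, hρ, h⟩ := hv.exists_local_bound hN x
        refine ⟨γ, hγ, C, ρ, hρ, fun y hy hyx => ?_⟩
        rw [hnorm]
        refine le_trans ?_ (h y hy hyx)
        refine mul_le_of_le_one_right (norm_nonneg _) ?_
        exact Real.rpow_le_one_of_one_le_of_nonpos (by linarith [abs_nonneg y]) (by linarith)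
      · refine ⟨1 + (β - α), by linarith, C', R, fun y hy => ?_⟩
        rw [hnorm]
        have hp : 0 < 1 + |y| := by positivity
        calc ‖zeroExtend v y‖ * (1 + |y|) ^ (α - 1)
            ≤ C' * (1 + |y|) ^ (-β) * (1 + |y|) ^ (α - 1) :=
              mul_le_mul_of_nonneg_right (hbinf y hy) (hw0 y)
          _ = C' * ((1 + |y|) ^ (-β) * (1 + |y|) ^ (α - 1)) := by ring
          _ = _ := by rw [← Real.rpow_add hp]; congr 2; ring
    refine key.norm.congr (Eventually.of_forall fun y => ?_)
    simp only [norm_mul, Complex.norm_real, Real.norm_of_nonneg (hw0 y)]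
  · intro s hs K hK
    refine Eventually.of_forall fun μ a ha h1 h2 => ?_
    rw [sub_zero] at h2
    have hs' : R < s := hs
    -- Since `1 ≤ R < s ≤ K a`, one has `1 + |μ| ≤ 2 K a`; this is the source of the factor `2 K` in
    -- `EndData.kernel`.
    exact inv_le_mul_rpow ha (hpos s hs) (by positivity) (by linarith) (by linarith)
      (by linarith) (by nlinarith) (by linarith)

end IsNodalHolder

theorem half_rpow_neg_le {s α : ℝ} (hs : 0 < s) (hα1 : α ≤ 1) :
    (s / 2) ^ (-α) ≤ 2 * s ^ (-α) := by
  rw [Real.div_rpow hs.le (by norm_num), Real.rpow_neg (by norm_num : (0 : ℝ) ≤ 2), div_inv_eq_mul,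
    mul_comm]
  refine mul_le_mul_of_nonneg_right ?_ (by positivity)
  calc (2 : ℝ) ^ α ≤ 2 ^ (1 : ℝ) := Real.rpow_le_rpow_of_exponent_le (by norm_num) hα1
    _ = 2 := Real.rpow_one 2

theorem integrableOn_div_of_kernel_le {v : ℝ → ℂ} {w : ℝ → ℝ} (hm : AEStronglyMeasurable v)
    (hi : Integrable fun μ => ‖v μ‖ * w μ) {z : ℂ} {E : Set ℝ} (hE : MeasurableSet E) {M : ℝ}
    (hM : ∀ᵐ μ : ℝ, μ ∈ E → v μ ≠ 0 → ‖(μ : ℂ) - z‖⁻¹ ≤ M * w μ) :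
    IntegrableOn (fun μ : ℝ => v μ / ((μ : ℂ) - z)) E ∧
      ∫ μ in E, ‖v μ / ((μ : ℂ) - z)‖ ≤ M * ∫ μ in E, ‖v μ‖ * w μ := by
  have hdiv : AEStronglyMeasurable fun μ : ℝ => v μ / ((μ : ℂ) - z) :=
    hm.mul ((by fun_prop : Measurable fun μ : ℝ => ((μ : ℂ) - z)⁻¹).aestronglyMeasurable)
  have hle : ∀ᵐ μ ∂(volume.restrict E), ‖v μ / ((μ : ℂ) - z)‖ ≤ M * (‖v μ‖ * w μ) := by
    filter_upwards [ae_restrict_mem hE, ae_restrict_of_ae hM] with μ hμ h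
    by_cases h0 : v μ = 0
    · simp [h0]
    · rw [norm_div, div_eq_mul_inv]
      have := mul_le_mul_of_nonneg_left (h hμ h0) (norm_nonneg (v μ))
      linarith
  have hint : IntegrableOn (fun μ : ℝ => v μ / ((μ : ℂ) - z)) E :=
    (hi.integrableOn.const_mul M).mono' hdiv.restrict hle
  refine ⟨hint, ?_⟩
  rw [← integral_const_mul]
  exact integral_mono_ae hint.norm (hi.integrableOn.const_mul M) hle

/-! ### Behaviour of the Cauchy integral near a node and at infinity -/

/-- One-sided boundary values of the Cauchy integral of `v`, given by the relation `B`: they exist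
and are controlled by the local bounds of `v`. -/
def BoundaryControl (v : ℝ → ℂ) (B : ℝ → ℂ → Prop) : Prop :=
  (∀ t a b, B t a → B t b → a = b) ∧
  ∀ r : ℝ, 0 < r → r ≤ 1 → ∃ C : ℝ, 0 ≤ C ∧ ∀ t d A : ℝ, LocalBound v t d r A →
    ∃ L, B t L ∧ ‖L‖ ≤ C * A ∧ ∀ x L', |x - t| ≤ d / 4 → B x L' →
      ‖L' - L‖ ≤ C * A * (|x - t| / d) ^ (r / 2)

theorem boundaryControl_upper (v : ℝ → ℂ) : BoundaryControl v (IsUpperValue (lineCauchy v)) := by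
  refine ⟨fun t a b => IsUpperValue.unique, fun r hr hr1 => ?_⟩
  obtain ⟨C, hC, h⟩ := LocalBound.exists_upper hr hr1
  refine ⟨C, hC, fun t d A hA => ?_⟩
  obtain ⟨-, L, h1, h2, h3, -⟩ := h v t d A hA
  exact ⟨L, h1, h2, h3⟩

theorem boundaryControl_lower (v : ℝ → ℂ) : BoundaryControl v (IsLowerValue (lineCauchy v)) := by
  refine ⟨fun t a b => IsLowerValue.unique, fun r hr hr1 => ?_⟩
  obtain ⟨C, hC, h⟩ := LocalBound.exists_lower hr hr1
  refine ⟨C, hC, fun t d A hA => ?_⟩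
  obtain ⟨-, L, h1, h2, h3, -⟩ := h v t d A hA
  exact ⟨L, h1, h2, h3⟩

namespace EndData

variable {v : ℝ → ℂ} {c α : ℝ} {w : ℝ → ℝ} {S S' : Set ℝ}

/-- An interval of radius `s / 2` at distance `s` from the node does not reach it, and there all
powers of the distance are comparable with powers of `s`. The rest of the density is absorbed by the
weight, so every bound has the same order `s ^ (-α)`. -/
theorem exists_localBound (h : EndData v c α w S S') {ε : ℝ} (hε : ε = 1 ∨ ε = -1) :
    ∃ r C : ℝ, 0 < r ∧ r ≤ 1 ∧ 0 ≤ C ∧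
      ∀ s ∈ S', LocalBound v (c + ε * s) (s / 2) r (C * s ^ (-α)) := by
  have hF : ScaledHolderOn 3 (fun s => v (c + ε * s)) (-α) S := by
    rcases hε with rfl | rfl
    · simpa using h.right
    · simpa [← sub_eq_add_neg] using h.left
  have hεε : ε * ε = 1 := by rcases hε with rfl | rfl <;> norm_num
  have hεa : |ε| = 1 := by rcases hε with rfl | rfl <;> norm_num
  obtain ⟨C, r, hC, hr, hr1, h1, h2⟩ := hF
  simp only at h1 h2
  set W : ℝ := ∫ μ, ‖v μ‖ * w μ with hW
  have hnn : ∀ μ, 0 ≤ ‖v μ‖ * w μ := fun μ => mul_nonneg (norm_nonneg _) (h.w_nonneg μ)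
  have hW0 : 0 ≤ W := integral_nonneg hnn
  refine ⟨r, 2 * C + 6 * W, hr, hr1, by positivity, fun s hs => ?_⟩
  have hs0 := h.pos s (h.subset hs)
  have hp : 0 ≤ s ^ (-α) := by positivity
  have hmem : ∀ x ∈ Ioo (c + ε * s - s / 2) (c + ε * s + s / 2),
      ε * (x - c) ∈ Ioo (s / 2) (3 * s / 2) ∧ c + ε * (ε * (x - c)) = x := by
    rintro x ⟨hx1, hx2⟩
    refine ⟨?_, by rw [← mul_assoc, hεε]; ring⟩
    rcases hε with rfl | rfl
    · constructor <;> linarith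
    · constructor <;> linarith
  have hσ : ∀ σ ∈ Ioo (s / 2) (3 * s / 2), σ ^ (-α) ≤ 2 * s ^ (-α) := fun σ hσ =>
    (Real.rpow_le_rpow_of_nonpos (by positivity) hσ.1.le (by linarith [h.α_pos])).trans
      (half_rpow_neg_le hs0 h.α_lt.le)
  have hker := integrableOn_div_of_kernel_le h.aesm h.integrable (z := ((c + ε * s : ℝ) : ℂ))
    (E := (Ioo (c + ε * s - s / 2) (c + ε * s + s / 2))ᶜ) measurableSet_Ioo.compl
    -- Outside the interval `a = |μ - (c + ε s)| ≥ s / 2`, hence `s ≤ 3 a` and `|μ - c| ≤ a + s ≤ 3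
    -- a`.
    (M := 2 * 3 * s ^ (-α)) (by
      filter_upwards [h.kernel s (h.subset hs) 3 (by norm_num)] with μ hμ hμE _
      rw [← Complex.ofReal_sub, Complex.norm_real, Real.norm_eq_abs]
      have ha : s / 2 ≤ |μ - (c + ε * s)| := by
        by_contra! hlt
        obtain ⟨h3, h4⟩ := abs_lt.1 hlt
        exact hμE ⟨by linarith, by linarith⟩
      refine hμ _ (by linarith) (by linarith) ?_
      have h3 := abs_sub_le μ (c + ε * s) c
      rw [add_sub_cancel_left, abs_mul, hεa, one_mul, abs_of_pos hs0] at h3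
      linarith)
  refine ⟨h.aesm, by positivity, hr, hr1, fun x hx => ?_, fun x hx y hy => ?_, hker.1, ?_⟩
  · obtain ⟨hx1, hx2⟩ := hmem x hx
    have h3 := h1 _ (h.scale s hs _ hx1)
    rw [hx2] at h3
    have h4 := mul_le_mul_of_nonneg_left (hσ _ hx1) hC
    have h5 : 0 ≤ W * s ^ (-α) := by positivity
    linarith
  · have main : ∀ x ∈ Ioo (c + ε * s - s / 2) (c + ε * s + s / 2),
        ∀ y ∈ Ioo (c + ε * s - s / 2) (c + ε * s + s / 2), ε * (y - c) ≤ ε * (x - c) →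
        ‖v x - v y‖ ≤ (2 * C + 6 * W) * s ^ (-α) * (|x - y| / (s / 2)) ^ r := by
      intro x hx y hy hyx
      obtain ⟨hx1, hx2⟩ := hmem x hx
      obtain ⟨hy1, hy2⟩ := hmem y hy
      have h3 := h2 _ (h.scale s hs _ hy1) _ (h.scale s hs _ hx1) hyx
        (by linarith [hx1.2, hy1.1])
      rw [hx2, hy2] at h3
      have hy0 : 0 < ε * (y - c) := by linarith [hy1.1]
      refine h3.trans ?_
      have e : ε * (x - c) / (ε * (y - c)) - 1 = |x - y| / (ε * (y - c)) := by
        have : |x - y| = ε * (x - c) - ε * (y - c) := by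
          rw [← abs_of_nonneg (sub_nonneg.2 hyx), ← mul_sub, abs_mul, hεa, one_mul,
            sub_sub_sub_cancel_right]
        rw [div_sub_one hy0.ne', this]
      rw [e]
      have h4 : (|x - y| / (ε * (y - c))) ^ r ≤ (|x - y| / (s / 2)) ^ r :=
        Real.rpow_le_rpow (by positivity)
          (div_le_div_of_nonneg_left (abs_nonneg _) (by positivity) hy1.1.le) hr.le
      refine mul_le_mul ?_ h4 (by positivity) (by positivity)
      have h5 := mul_le_mul_of_nonneg_left (hσ _ hy1) hC
      have h6 : 0 ≤ W * s ^ (-α) := by positivity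
      linarith
    rcases le_total (ε * (y - c)) (ε * (x - c)) with hle | hle
    · exact main x hx y hy hle
    · rw [norm_sub_rev, abs_sub_comm]; exact main y hy x hx hle
  · refine hker.2.trans ?_
    have h3 : ∫ μ in (Ioo (c + ε * s - s / 2) (c + ε * s + s / 2))ᶜ, ‖v μ‖ * w μ ≤ W :=
      setIntegral_le_integral h.integrable (Eventually.of_forall hnn)
    have h4 := mul_le_mul_of_nonneg_left h3 (by positivity : 0 ≤ 2 * 3 * s ^ (-α))
    have h5 : 0 ≤ C * s ^ (-α) := by positivity
    linarith

/-- Local control at scale `d = s / 2` covers displacements up to `d / 4 = s / 8`, hence the ratio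
`9 / 8`. The order `-α` is inherited from the local bounds. -/
theorem scaledHolderOn_boundary (h : EndData v c α w S S') {B : ℝ → ℂ → Prop}
    (hB : BoundaryControl v B) {ε : ℝ} (hε : ε = 1 ∨ ε = -1) {g : ℝ → ℂ}
    (hg : ∀ s ∈ S', B (c + ε * s) (g (c + ε * s))) :
    ScaledHolderOn (9 / 8) (fun s => g (c + ε * s)) (-α) S' := by
  obtain ⟨r, C, hr, hr1, hC, hL⟩ := h.exists_localBound hε
  obtain ⟨huniq, hB⟩ := hB
  obtain ⟨C', hC', hB⟩ := hB r hr hr1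
  have hεa : |ε| = 1 := by rcases hε with rfl | rfl <;> norm_num
  refine ⟨2 * (C' * C), r / 2, by positivity, by positivity, by linarith, fun s hs => ?_,
    fun s hs s' hs' h1 h2 => ?_⟩
  · obtain ⟨L, hL1, hL2, -⟩ := hB _ _ _ (hL s hs)
    beta_reduce
    rw [huniq _ _ _ (hg s hs) hL1]
    have : 0 ≤ C' * C * s ^ (-α) := by have := h.pos s (h.subset hs); positivity
    linarith
  · obtain ⟨L, hL1, -, hL3⟩ := hB _ _ _ (hL s hs)
    have hs0 := h.pos s (h.subset hs)
    have e : |c + ε * s' - (c + ε * s)| = s' - s := by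
      rw [add_sub_add_left_eq_sub, ← mul_sub, abs_mul, hεa, one_mul, abs_of_nonneg (by linarith)]
    have h3 := hL3 (c + ε * s') _ (by rw [e]; linarith) (hg s' hs')
    rw [e] at h3
    beta_reduce
    rw [huniq _ _ _ (hg s hs) hL1]
    refine h3.trans ?_
    have hu : 0 ≤ s' / s - 1 := by have := (one_le_div hs0).2 h1; linarith
    have e2 : (s' - s) / (s / 2) = 2 * (s' / s - 1) := by field_simp
    have h4 : (2 : ℝ) ^ (r / 2) ≤ 2 := by
      calc (2 : ℝ) ^ (r / 2) ≤ 2 ^ (1 : ℝ) :=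
            Real.rpow_le_rpow_of_exponent_le (by norm_num) (by linarith)
        _ = 2 := Real.rpow_one 2
    rw [e2, Real.mul_rpow (by norm_num) hu]
    have h5 : 0 ≤ C' * C * s ^ (-α) * (s' / s - 1) ^ (r / 2) := by positivity
    calc C' * (C * s ^ (-α)) * (2 ^ (r / 2) * (s' / s - 1) ^ (r / 2))
        = 2 ^ (r / 2) * (C' * C * s ^ (-α) * (s' / s - 1) ^ (r / 2)) := by ring
      _ ≤ 2 * (C' * C * s ^ (-α) * (s' / s - 1) ^ (r / 2)) := mul_le_mul_of_nonneg_right h4 h5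
      _ = _ := by ring

/-- In the sector close to the real line the kernel may be nearly singular, so the uniform box bound
over `Re z` is used at scale half the distance to `c`. -/
theorem exists_norm_lineCauchy_le_of_near (h : EndData v c α w S S') :
    ∃ C : ℝ, 0 ≤ C ∧ ∀ z : ℂ, z.im ≠ 0 → |z.im| ≤ |z.re - c| / 4 → |z.re - c| ∈ S' →
      ‖lineCauchy v z‖ ≤ C * ‖z - c‖ ^ (-α) := by
  have side : ∀ ε : ℝ, ε = 1 ∨ ε = -1 → ∃ C : ℝ, 0 ≤ C ∧ ∀ z : ℂ, z.im ≠ 0 →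
      |z.im| ≤ |z.re - c| / 4 → |z.re - c| ∈ S' → z.re - c = ε * |z.re - c| →
      ‖lineCauchy v z‖ ≤ C * ‖z - c‖ ^ (-α) := by
    intro ε hε
    obtain ⟨r, C, hr, hr1, hC, hL⟩ := h.exists_localBound hε
    obtain ⟨C₁, hC₁, hup⟩ := LocalBound.exists_upper hr hr1
    obtain ⟨C₂, hC₂, hlo⟩ := LocalBound.exists_lower hr hr1
    refine ⟨2 * ((C₁ + C₂) * C), by positivity, fun z hz hz1 hz2 hz3 => ?_⟩
    have hs0 := h.pos _ (h.subset hz2)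
    have e : c + ε * |z.re - c| = z.re := by rw [← hz3]; ring
    have hLB := hL _ hz2
    rw [e] at hLB
    have hn : ‖z - c‖ ≤ 2 * |z.re - c| := by
      have := Complex.norm_le_abs_re_add_abs_im (z - c)
      simp only [Complex.sub_re, Complex.sub_im, Complex.ofReal_re, Complex.ofReal_im, sub_zero] at this
      linarith
    have hn0 : 0 < ‖z - c‖ := by
      have := Complex.abs_re_le_norm (z - c)
      simp only [Complex.sub_re, Complex.ofReal_re] at this
      linarith
    have hp : |z.re - c| ^ (-α) ≤ 2 * ‖z - c‖ ^ (-α) :=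
      (Real.rpow_le_rpow_of_nonpos (by positivity) (by linarith : ‖z - c‖ / 2 ≤ |z.re - c|)
        (by linarith [h.α_pos])).trans (half_rpow_neg_le hn0 h.α_lt.le)
    have key : ‖lineCauchy v z‖ ≤ (C₁ + C₂) * (C * |z.re - c| ^ (-α)) := by
      have hpos : 0 ≤ C * |z.re - c| ^ (-α) := by positivity
      rcases lt_or_gt_of_ne hz with him | him
      · rw [abs_of_neg him] at hz1
        have := (hlo v _ _ _ hLB).1 z (by rw [sub_self, abs_zero]; positivity) him (by linarith)
        nlinarith
      · rw [abs_of_pos him] at hz1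
        have := (hup v _ _ _ hLB).1 z (by rw [sub_self, abs_zero]; positivity) him (by linarith)
        nlinarith
    calc ‖lineCauchy v z‖ ≤ (C₁ + C₂) * C * |z.re - c| ^ (-α) := by linarith
      _ ≤ (C₁ + C₂) * C * (2 * ‖z - c‖ ^ (-α)) := mul_le_mul_of_nonneg_left hp (by positivity)
      _ = _ := by ring
  obtain ⟨C₁, hC₁, h1⟩ := side 1 (Or.inl rfl)
  obtain ⟨C₂, hC₂, h2⟩ := side (-1) (Or.inr rfl)
  refine ⟨C₁ + C₂, by positivity, fun z hz hz1 hz2 => ?_⟩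
  have hp : 0 ≤ ‖z - c‖ ^ (-α) := by positivity
  rcases le_total 0 (z.re - c) with h0 | h0
  · have := h1 z hz hz1 hz2 (by rw [abs_of_nonneg h0, one_mul])
    nlinarith
  · have := h2 z hz hz1 hz2 (by rw [abs_of_nonpos h0]; ring)
    nlinarith

/-- When `z` is no closer to the support of `v` than a fixed fraction of its distance to `c`, no
cancellation is needed: absolute values and the weight suffice. -/
theorem norm_lineCauchy_le_of_kernel (h : EndData v c α w S S') {K : ℝ} (hK : 1 ≤ K) {z : ℂ}
    (hz : ‖z - c‖ ∈ S)
    (hk : ∀ μ : ℝ, v μ ≠ 0 → ‖z - c‖ ≤ K * ‖(μ : ℂ) - z‖ ∧ |μ - c| ≤ K * ‖(μ : ℂ) - z‖) :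
    ‖lineCauchy v z‖ ≤ 2 * K * (∫ μ, ‖v μ‖ * w μ) * ‖z - c‖ ^ (-α) := by
  have hs0 := h.pos _ hz
  have hker := integrableOn_div_of_kernel_le h.aesm h.integrable (z := z) (E := univ)
    MeasurableSet.univ (M := 2 * K * ‖z - c‖ ^ (-α)) (by
      filter_upwards [h.kernel _ hz K hK] with μ hμ _ hv
      obtain ⟨h1, h2⟩ := hk μ hv
      refine hμ _ ?_ h1 h2
      by_contra! hle
      nlinarith)
  have h1 := hker.2
  rw [setIntegral_univ, setIntegral_univ] at h1
  refine (norm_integral_le_integral_norm _).trans (h1.trans_eq (by ring))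

theorem exists_norm_lineCauchy_le (h : EndData v c α w S S') (hc : 0 ≤ c)
    (hv : ∀ μ ≤ 0, v μ = 0) : ∃ C : ℝ, 0 ≤ C ∧ ∀ z ∈ cutPlane, ‖z - c‖ ∈ S →
      (|z.im| ≤ |z.re - c| / 4 → |z.re - c| ∈ S') → (z.im = 0 → c = 0) →
      ‖lineCauchy v z‖ ≤ C * ‖z - c‖ ^ (-α) := by
  obtain ⟨C, hC, hnear⟩ := h.exists_norm_lineCauchy_le_of_near
  set W : ℝ := ∫ μ, ‖v μ‖ * w μ with hW
  have hW0 : 0 ≤ W := integral_nonneg fun μ => mul_nonneg (norm_nonneg _) (h.w_nonneg μ)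
  refine ⟨C + 2 * 6 * W, by positivity, fun z hz hzS hzS' hz0 => ?_⟩
  have hp : 0 ≤ ‖z - c‖ ^ (-α) := by positivity
  have hCp := mul_nonneg hC hp
  have hWp := mul_nonneg hW0 hp
  by_cases him : z.im = 0
  · have hc0 := hz0 him
    subst hc0
    have hre : z.re < 0 := by
      by_contra! hge
      exact hz ⟨hge, him⟩
    have := h.norm_lineCauchy_le_of_kernel (K := 6) (by norm_num) hzS (fun μ hμ => by
      have hμ0 : 0 < μ := by
        by_contra! hle
        exact hμ (hv μ hle)
      have h1 := abs_sub_re_le_norm μ z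
      rw [abs_of_pos (by linarith)] at h1
      have h2 := Complex.norm_le_abs_re_add_abs_im z
      rw [him, abs_zero, add_zero, abs_of_neg hre] at h2
      rw [Complex.ofReal_zero, sub_zero, sub_zero, abs_of_pos hμ0]
      constructor <;> linarith)
    linarith
  · by_cases hcase : |z.im| ≤ |z.re - c| / 4
    · have := hnear z him hcase (hzS' hcase)
      linarith
    · push Not at hcase
      -- Here `‖z - c‖ ≤ 5 |Im z| ≤ 5 ‖μ - z‖`, and then `|μ - c| ≤ 6 ‖μ - z‖`.
      have := h.norm_lineCauchy_le_of_kernel (K := 6) (by norm_num) hzS (fun μ _ => by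
        have h1 := abs_im_le_norm_ofReal_sub μ z
        have h2 := Complex.norm_le_abs_re_add_abs_im (z - c)
        simp only [Complex.sub_re, Complex.sub_im, Complex.ofReal_re, Complex.ofReal_im,
          sub_zero] at h2
        have h3 := norm_sub_le_norm_sub_add_norm_sub (μ : ℂ) z c
        rw [← Complex.ofReal_sub, Complex.norm_real, Real.norm_eq_abs] at h3
        have h4 := norm_nonneg ((μ : ℂ) - z)
        constructor <;> linarith)
      linarith

end EndData

theorem EndData.mono {v : ℝ → ℂ} {c α : ℝ} {w : ℝ → ℝ} {S S' T : Set ℝ}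
    (h : EndData v c α w S S') (hT : T ⊆ S') : EndData v c α w S T :=
  { h with
    subset := hT.trans h.subset
    scale := fun s hs => h.scale s (hT hs) }

/-! ### Analyticity off the cut and regularity of the boundary values -/

theorem inv_norm_sub_le {α a : ℝ} {μ : ℝ} {z : ℂ} (hα : 0 < α) (hα1 : α < 1) (ha : 0 < a)
    (h : a ≤ ‖(μ : ℂ) - z‖) : ‖(μ : ℂ) - z‖⁻¹ ≤ ((1 + ‖z‖) / a + 1) * (1 + |μ|) ^ (α - 1) := by
  have hz := norm_nonneg z
  have h1 : 1 + ‖z‖ ≤ (1 + ‖z‖) / a * ‖(μ : ℂ) - z‖ := by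
    have := mul_le_mul_of_nonneg_left h (by positivity : 0 ≤ (1 + ‖z‖) / a)
    rwa [div_mul_cancel₀ _ ha.ne'] at this
  have h2 : |μ| ≤ ‖(μ : ℂ) - z‖ + ‖z‖ := by
    rw [← Real.norm_eq_abs, ← Complex.norm_real]
    simpa using norm_add_le ((μ : ℂ) - z) z
  have := inv_le_mul_rpow (a := ‖(μ : ℂ) - z‖) (s := 1) (b := 1 + |μ|) (K := (1 + ‖z‖) / a + 1)
    (by linarith) one_pos (by positivity) (by positivity) hα hα1 (by linarith) (by linarith)
  rwa [Real.one_rpow, mul_one] at this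

theorem exists_ball_dist_le {z : ℂ} (hz : z ∈ cutPlane) :
    ∃ ρ > 0, ∀ x ∈ Metric.ball z ρ, ∀ μ : ℝ, 0 < μ → ρ ≤ ‖(μ : ℂ) - x‖ := by
  obtain ⟨ρ, hρ, hsub⟩ := Metric.isOpen_iff.1 isOpen_cutPlane z hz
  refine ⟨ρ / 2, by positivity, fun x hx μ hμ => ?_⟩
  by_contra! hlt
  have h1 : (μ : ℂ) ∈ Metric.ball z ρ := by
    rw [Metric.mem_ball, dist_eq_norm] at hx ⊢
    have := norm_sub_le_norm_sub_add_norm_sub (μ : ℂ) x z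
    linarith
  exact hsub h1 ⟨by simpa using hμ.le, by simp⟩

/-- The support stays at a positive distance from a small ball around `z`. One kernel factor is
dominated by the weight and the second by a constant, so the integral may be differentiated under
the sign. -/
theorem differentiableOn_lineCauchy {v : ℝ → ℂ} {α : ℝ} (hα : 0 < α) (hα1 : α < 1)
    (hm : AEStronglyMeasurable v) (hv : ∀ μ ≤ 0, v μ = 0)
    (hi : Integrable fun μ => ‖v μ‖ * (1 + |μ|) ^ (α - 1)) :
    DifferentiableOn ℂ (lineCauchy v) cutPlane := by
  intro z hz
  obtain ⟨ρ, hρ, hdist⟩ := exists_ball_dist_le hz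
  have hpos : ∀ μ, v μ ≠ 0 → 0 < μ := fun μ h => by
    by_contra! hle
    exact h (hv μ hle)
  have hker : ∀ x ∈ Metric.ball z ρ, ∀ μ, v μ ≠ 0 →
      ‖(μ : ℂ) - x‖⁻¹ ≤ ((1 + ‖x‖) / ρ + 1) * (1 + |μ|) ^ (α - 1) := fun x hx μ hμ =>
    inv_norm_sub_le hα hα1 hρ (hdist x hx μ (hpos μ hμ))
  have hmeas : ∀ x : ℂ, AEStronglyMeasurable fun μ : ℝ => v μ / ((μ : ℂ) - x) := fun x =>
    hm.mul ((by fun_prop : Measurable fun μ : ℝ => ((μ : ℂ) - x)⁻¹).aestronglyMeasurable)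
  have hzb := Metric.mem_ball_self (x := z) hρ
  have hint : Integrable fun μ : ℝ => v μ / ((μ : ℂ) - z) := by
    have := (integrableOn_div_of_kernel_le hm hi (z := z) MeasurableSet.univ
      (Eventually.of_forall fun μ _ h => hker z hzb μ h)).1
    rwa [integrableOn_univ] at this
  have hd := hasDerivAt_integral_of_dominated_loc_of_deriv_le (μ := volume)
    (F := fun (x : ℂ) (μ : ℝ) => v μ / ((μ : ℂ) - x))
    (F' := fun (x : ℂ) (μ : ℝ) => v μ / ((μ : ℂ) - x) ^ 2) (x₀ := z)
    (bound := fun μ => ((1 + (‖z‖ + ρ)) / ρ + 1) * ρ⁻¹ * (‖v μ‖ * (1 + |μ|) ^ (α - 1)))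
    (Metric.ball_mem_nhds z hρ) (Eventually.of_forall hmeas) hint
    (hm.mul ((by fun_prop : Measurable fun μ : ℝ => (((μ : ℂ) - z) ^ 2)⁻¹).aestronglyMeasurable))
    (Eventually.of_forall fun μ x hx => ?_) (hi.const_mul _)
    (Eventually.of_forall fun μ x hx => ?_)
  · exact hd.2.differentiableAt.differentiableWithinAt
  · by_cases h0 : v μ = 0
    · simp [h0]
    · have h1 := hker x hx μ h0
      have h2 := hdist x hx μ (hpos μ h0)
      have h3 : ‖(μ : ℂ) - x‖⁻¹ ≤ ρ⁻¹ := inv_anti₀ hρ h2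
      have h4 : ‖x‖ ≤ ‖z‖ + ρ := by
        rw [Metric.mem_ball, dist_eq_norm] at hx
        have := norm_add_le z (x - z)
        rw [add_sub_cancel] at this
        linarith
      have h5 : ‖(μ : ℂ) - x‖⁻¹ ≤ ((1 + (‖z‖ + ρ)) / ρ + 1) * (1 + |μ|) ^ (α - 1) :=
        h1.trans (by gcongr)
      rw [norm_div, norm_pow, div_eq_mul_inv, ← inv_pow, pow_two]
      calc ‖v μ‖ * (‖(μ : ℂ) - x‖⁻¹ * ‖(μ : ℂ) - x‖⁻¹)
          ≤ ‖v μ‖ * (((1 + (‖z‖ + ρ)) / ρ + 1) * (1 + |μ|) ^ (α - 1) * ρ⁻¹) := by gcongr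
        _ = _ := by ring
  · by_cases h0 : v μ = 0
    · simpa [h0] using hasDerivAt_const x (0 : ℂ)
    · have h2 := hdist x hx μ (hpos μ h0)
      have hne : (μ : ℂ) - x ≠ 0 := norm_pos_iff.1 (hρ.trans_le h2)
      have := (((hasDerivAt_id x).const_sub (μ : ℂ)).inv hne).const_mul (v μ)
      simpa [div_eq_mul_inv] using this

namespace IsNodalHolder

variable {N : Finset ℝ} {v : ℝ → ℂ}

theorem exists_integrable_weight (hv : IsNodalHolder N v) (hN : ∀ c ∈ N, 0 < c) :
    ∃ α : ℝ, 0 < α ∧ α < 1 ∧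
      Integrable fun μ => ‖zeroExtend v μ‖ * (1 + |μ|) ^ (α - 1) := by
  obtain ⟨α, R, -, h⟩ := hv.exists_endData_infty hN
  exact ⟨α, h.α_pos, h.α_lt, h.integrable⟩

theorem integrableOn_zeroExtend_div (hv : IsNodalHolder N v) (hN : ∀ c ∈ N, 0 < c) {z : ℂ}
    {E : Set ℝ} (hE : MeasurableSet E) {a : ℝ} (ha : 0 < a)
    (h : ∀ μ ∈ E, 0 < μ → a ≤ ‖(μ : ℂ) - z‖) :
    IntegrableOn (fun μ : ℝ => zeroExtend v μ / ((μ : ℂ) - z)) E := by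
  obtain ⟨α, hα, hα1, hi⟩ := hv.exists_integrable_weight hN
  refine (integrableOn_div_of_kernel_le hv.aestronglyMeasurable_zeroExtend hi hE
    (Eventually.of_forall fun μ hμ h0 => inv_norm_sub_le hα hα1 ha (h μ hμ ?_))).1
  by_contra! hle
  exact h0 (zeroExtend_of_nonpos hle)

/-- On a compact interval free of nodes, compactness provides one scale and one constant for all its
points. -/
theorem exists_localBound (hv : IsNodalHolder N v) (hN : ∀ c ∈ N, 0 < c) {a b : ℝ}
    (hab : a ≤ b) (h : ∀ t ∈ Icc a b, 0 < t ∧ t ∉ N) : ∃ η r A : ℝ, 0 < η ∧ 0 < r ∧ r ≤ 1 ∧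
      ∀ t ∈ Icc a b, LocalBound (zeroExtend v) t η r A := by
  obtain ⟨η, hη, hthick⟩ := exists_thickening_pos_notMem h
  have hbig : ∀ t ∈ Icc (a - η) (b + η), 0 < t ∧ t ∉ N := by
    rintro t ⟨h1, h2⟩
    rcases le_total t a with h3 | h3
    · exact hthick a ⟨le_rfl, hab⟩ t (abs_le.2 ⟨by linarith, by linarith⟩)
    rcases le_total t b with h4 | h4
    · exact h t ⟨h3, h4⟩
    · exact hthick b ⟨hab, le_rfl⟩ t (abs_le.2 ⟨by linarith, by linarith⟩)
  obtain ⟨C, r, hC, hr, hr1, hH⟩ :=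
    (hv.locally_holder _ _ hbig).exists_le (Metric.isBounded_Icc _ _)
  obtain ⟨α, hα, hα1, hi⟩ := hv.exists_integrable_weight hN
  set W : ℝ := ∫ μ, ‖zeroExtend v μ‖ * (1 + |μ|) ^ (α - 1) with hW
  have hnn : ∀ μ : ℝ, 0 ≤ ‖zeroExtend v μ‖ * (1 + |μ|) ^ (α - 1) := fun μ => by positivity
  have hW0 : 0 ≤ W := integral_nonneg hnn
  set M : ℝ := ‖v a‖ + C * (b - a + η) ^ r with hM
  have hb0 : 0 < b := (h b ⟨hab, le_rfl⟩).1
  have hba : 0 ≤ b - a + η := by linarith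
  have hM0 : 0 ≤ M := by positivity
  have hCη : 0 ≤ C * η ^ r := by positivity
  set K : ℝ := (1 + b) / η + 1 with hK
  have hK0 : 0 ≤ K := by positivity
  have hKW : 0 ≤ K * W := by positivity
  refine ⟨η, r, M + C * η ^ r + K * W, hη, hr, hr1, fun t ht => ?_⟩
  have hsub : ∀ x ∈ Ioo (t - η) (t + η), x ∈ Icc (a - η) (b + η) ∧ zeroExtend v x = v x := by
    rintro x ⟨h1, h2⟩
    have hx : x ∈ Icc (a - η) (b + η) := ⟨by linarith [ht.1], by linarith [ht.2]⟩
    exact ⟨hx, zeroExtend_of_pos (hbig x hx).1⟩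
  have ht0 := (h t ht).1
  have hdist : ∀ μ ∈ (Ioo (t - η) (t + η))ᶜ, η ≤ ‖(μ : ℂ) - (t : ℂ)‖ := fun μ hμ => by
    rw [← Complex.ofReal_sub, Complex.norm_real, Real.norm_eq_abs]
    by_contra! hlt
    obtain ⟨h1, h2⟩ := abs_lt.1 hlt
    exact hμ ⟨by linarith, by linarith⟩
  refine ⟨hv.aestronglyMeasurable_zeroExtend, hη, hr, hr1, fun x hx => ?_, fun x hx y hy => ?_,
    hv.integrableOn_zeroExtend_div hN measurableSet_Ioo.compl hη fun μ hμ _ => hdist μ hμ, ?_⟩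
  · obtain ⟨hx1, hx2⟩ := hsub x hx
    rw [hx2]
    have h1 := hH x hx1 a ⟨by linarith, by linarith⟩
    have h2 : |x - a| ^ r ≤ (b - a + η) ^ r :=
      Real.rpow_le_rpow (abs_nonneg _) (abs_le.2 ⟨by linarith [hx1.1], by linarith [hx1.2]⟩) hr.le
    have h3 := mul_le_mul_of_nonneg_left h2 hC
    have h4 := norm_add_le (v a) (v x - v a)
    rw [add_sub_cancel] at h4
    linarith
  · obtain ⟨hx1, hx2⟩ := hsub x hx
    obtain ⟨hy1, hy2⟩ := hsub y hy
    rw [hx2, hy2]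
    have e : C * |x - y| ^ r = C * η ^ r * (|x - y| / η) ^ r := by
      rw [Real.div_rpow (abs_nonneg _) hη.le]
      have : η ^ r ≠ 0 := by positivity
      field_simp
    refine (hH x hx1 y hy1).trans (e.trans_le ?_)
    exact mul_le_mul_of_nonneg_right (by linarith) (by positivity)
  · have hker := (integrableOn_div_of_kernel_le hv.aestronglyMeasurable_zeroExtend hi
      (z := (t : ℂ)) measurableSet_Ioo.compl (E := (Ioo (t - η) (t + η))ᶜ) (M := K)
      (Eventually.of_forall fun μ hμ _ => by
        refine (inv_norm_sub_le hα hα1 hη (hdist μ hμ)).trans ?_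
        refine mul_le_mul_of_nonneg_right ?_ (by positivity)
        rw [Complex.norm_real, Real.norm_of_nonneg ht0.le, hK]
        have := ht.2
        gcongr)).2
    have h3 : ∫ μ in (Ioo (t - η) (t + η))ᶜ, ‖zeroExtend v μ‖ * (1 + |μ|) ^ (α - 1) ≤ W :=
      setIntegral_le_integral hi (Eventually.of_forall hnn)
    have h4 := mul_le_mul_of_nonneg_left h3 hK0
    linarith

theorem exists_pos_avoiding {c : ℝ} (hc : 0 < c) :
    ∃ δ > 0, ∀ t, t ≠ c → |t - c| < δ → 0 < t ∧ t ∉ N := by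
  have h : {t : ℝ | 0 < t ∧ t ∉ N.erase c} ∈ 𝓝 c :=
    (isOpen_pos_notMem (N.erase c)).mem_nhds ⟨hc, by simp⟩
  obtain ⟨δ, hδ, hsub⟩ := Metric.mem_nhds_iff.1 h
  refine ⟨δ, hδ, fun t htc ht => ?_⟩
  obtain ⟨h1, h2⟩ := hsub (Metric.mem_ball.2 (by rwa [Real.dist_eq]))
  exact ⟨h1, fun h3 => h2 (Finset.mem_erase.2 ⟨htc, h3⟩)⟩

theorem exists_right_avoiding {c : ℝ} (hc : 0 ≤ c) :
    ∃ δ > 0, ∀ s ∈ Ioo 0 δ, 0 < c + s ∧ c + s ∉ N := by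
  have h : ((N.erase c : Finset ℝ) : Set ℝ)ᶜ ∈ 𝓝 c :=
    (N.erase c).finite_toSet.isClosed.isOpen_compl.mem_nhds (by simp)
  obtain ⟨δ, hδ, hsub⟩ := Metric.mem_nhds_iff.1 h
  refine ⟨δ, hδ, fun s hs => ⟨by linarith [hs.1], fun h3 => ?_⟩⟩
  have h4 : c + s ∈ Metric.ball c δ := by
    rw [Metric.mem_ball, Real.dist_eq, add_sub_cancel_left, abs_of_pos hs.1]
    exact hs.2
  exact hsub h4 (Finset.mem_coe.2 (Finset.mem_erase.2 ⟨by linarith [hs.1], h3⟩))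

/-- Boundary values of the Cauchy integral inherit the nodal class: uniform local bounds give the
interior condition, and `EndData` gives the scaled conditions at the nodes and at infinity. The
abstract relation `B` treats both sides of the cut at once. -/
theorem of_boundaryControl (hv : IsNodalHolder N v) (hN : ∀ c ∈ N, 0 < c) {B : ℝ → ℂ → Prop}
    (hB : BoundaryControl (zeroExtend v) B) {g : ℝ → ℂ}
    (hg : ∀ t, 0 < t → t ∉ N → B t (g t)) : IsNodalHolder N g := by
  refine of_scaled (κ := 9 / 8) (by norm_num) (by norm_num) (fun a b h => ?_) (fun c hc => ?_)
    (fun c hc => ?_) ?_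
  · rcases lt_or_ge b a with hab | hab
    · rw [Icc_eq_empty (not_le.2 hab)]
      exact ⟨0, 1, one_pos, by intro x hx; exact hx.elim⟩
    obtain ⟨η, r, A, hη, hr, hr1, hL⟩ := hv.exists_localBound hN hab h
    obtain ⟨huniq, hB⟩ := hB
    obtain ⟨C, hC, hB⟩ := hB r hr hr1
    have hval : ∀ x ∈ Icc a b, ‖g x‖ ≤ C * A ∧ ∀ y ∈ Icc a b, |y - x| ≤ η / 4 →
        ‖g y - g x‖ ≤ C * A * (|y - x| / η) ^ (r / 2) := by
      intro x hx
      obtain ⟨L, hL1, hL2, hL3⟩ := hB x η A (hL x hx)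
      rw [huniq _ _ _ (hg x (h x hx).1 (h x hx).2) hL1]
      exact ⟨hL2, fun y hy hxy => hL3 y _ hxy (hg y (h y hy).1 (h y hy).2)⟩
    have hCA : 0 ≤ C * A := (norm_nonneg _).trans (hval a ⟨le_rfl, hab⟩).1
    -- For `y - x > η / 4` the increment is at most `2 C A`, while `((y - x) / η) ^ (r / 2) ≥ 1 /
    -- 4`; hence the factor `8`.
    refine isHolderOn_of_le (C := 8 * (C * A) * (1 / η) ^ (r / 2)) (r := r / 2) (by positivity)
      (by positivity) fun x hx y hy hxy => ?_
    have hyx : 0 ≤ y - x := by linarith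
    have e : 8 * (C * A) * (1 / η) ^ (r / 2) * (y - x) ^ (r / 2) =
        8 * (C * A) * ((y - x) / η) ^ (r / 2) := by
      rw [mul_assoc, ← Real.mul_rpow (by positivity) hyx, one_div_mul_eq_div]
    rw [e]
    have hp : 0 ≤ C * A * ((y - x) / η) ^ (r / 2) := by positivity
    by_cases hclose : y - x ≤ η / 4
    · have := (hval x hx).2 y hy (by rwa [abs_of_nonneg hyx])
      rw [abs_of_nonneg hyx] at this
      linarith
    · push Not at hclose
      have h1 : (1 / 4 : ℝ) ≤ ((y - x) / η) ^ (r / 2) := by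
        calc (1 / 4 : ℝ) = (1 / 4) ^ (1 : ℝ) := (Real.rpow_one _).symm
          _ ≤ (1 / 4) ^ (r / 2) :=
            Real.rpow_le_rpow_of_exponent_ge (by norm_num) (by norm_num) (by linarith)
          _ ≤ _ := Real.rpow_le_rpow (by norm_num)
            (by rw [le_div_iff₀ hη]; linarith) (by linarith)
      have h2 := mul_le_mul_of_nonneg_left h1 hCA
      have h3 := norm_sub_le (g y) (g x)
      linarith [(hval x hx).1, (hval y hy).1]
  · obtain ⟨α, δ, hδ, w, hE⟩ := hv.exists_endData_node hN hc
    obtain ⟨δ', hδ', hav⟩ := exists_right_avoiding (N := N)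
      (hc.elim (fun h => h.ge) fun h => (hN c h).le)
    refine ⟨α, hE.α_lt, min (δ / 2) δ', by positivity, ?_⟩
    have := (hE.mono (Ioo_subset_Ioo_right (min_le_left (δ / 2) δ'))).scaledHolderOn_boundary hB
      (ε := 1) (Or.inl rfl) (g := g) fun s hs => by
        rw [one_mul]
        obtain ⟨h1, h2⟩ := hav s ⟨hs.1, hs.2.trans_le (min_le_right _ _)⟩
        exact hg _ h1 h2
    simpa only [one_mul] using this
  · obtain ⟨α, δ, hδ, w, hE⟩ := hv.exists_endData_node hN (Or.inr hc)
    obtain ⟨δ', hδ', hav⟩ := exists_pos_avoiding (N := N) (hN c hc)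
    refine ⟨α, hE.α_lt, min (δ / 2) δ', by positivity, ?_⟩
    have := (hE.mono (Ioo_subset_Ioo_right (min_le_left (δ / 2) δ'))).scaledHolderOn_boundary hB
      (ε := -1) (Or.inr rfl) (g := g) fun s hs => by
        obtain ⟨h1, h2⟩ := hav (c + -1 * s) (by linarith [hs.1]) (by
          rw [add_sub_cancel_left, neg_one_mul, abs_neg, abs_of_pos hs.1]
          exact hs.2.trans_le (min_le_right _ _))
        exact hg _ h1 h2
    simpa only [neg_one_mul, ← sub_eq_add_neg] using this
  · obtain ⟨α, R, hR, hE⟩ := hv.exists_endData_infty hN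
    obtain ⟨M, hM0, hM⟩ := exists_forall_lt_of_finset N
    refine ⟨α, hE.α_pos, max (2 * R) M, by positivity, ?_⟩
    have := (hE.mono (Ioi_subset_Ioi (le_max_left (2 * R) M))).scaledHolderOn_boundary hB
      (ε := 1) (Or.inl rfl) (g := g) fun s hs => by
        rw [one_mul, zero_add]
        have h1 : max (2 * R) M < s := hs
        refine hg _ (by linarith [le_max_right (2 * R) M]) fun h2 => ?_
        linarith [le_max_right (2 * R) M, hM s h2]
    simpa only [one_mul, zero_add] using this

theorem isBigO_lineCauchy_node (hv : IsNodalHolder N v) (hN : ∀ c ∈ N, 0 < c) {c : ℝ}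
    (hc : c = 0 ∨ c ∈ N) : ∃ α < (1 : ℝ),
      lineCauchy (zeroExtend v) =O[𝓝[cutPlane] (c : ℂ)] fun z => ‖z - (c : ℂ)‖ ^ (-α) := by
  obtain ⟨α, δ, hδ, w, hE⟩ := hv.exists_endData_node hN hc
  have hc0 : 0 ≤ c := hc.elim (fun h => h.ge) fun h => (hN c h).le
  obtain ⟨C, hC, h⟩ := hE.exists_norm_lineCauchy_le hc0 fun μ hμ => zeroExtend_of_nonpos hμ
  -- For a positive node the ball must not reach the negative axis, so that only the node `0` sees
  -- real points of the cut plane.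
  have hρ : ∃ ρ > 0, ρ ≤ δ / 2 ∧ (c = 0 ∨ ρ ≤ c) := by
    rcases hc0.eq_or_lt with h0 | h0
    · exact ⟨δ / 2, by positivity, le_rfl, Or.inl h0.symm⟩
    · exact ⟨min (δ / 2) c, by positivity, min_le_left _ _, Or.inr (min_le_right _ _)⟩
  obtain ⟨ρ, hρ, hρδ, hρc⟩ := hρ
  refine ⟨α, hE.α_lt, IsBigO.of_bound C ?_⟩
  filter_upwards [self_mem_nhdsWithin, mem_nhdsWithin_of_mem_nhds (Metric.ball_mem_nhds (c : ℂ) hρ)]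
    with z hz hzρ
  rw [Metric.mem_ball, dist_eq_norm] at hzρ
  rw [Real.norm_of_nonneg (by positivity)]
  have hre := Complex.abs_re_le_norm (z - c)
  simp only [Complex.sub_re, Complex.ofReal_re] at hre
  have hzc : z ≠ c := by
    rintro rfl
    exact hz ⟨by simpa using hc0, by simp⟩
  refine h z hz ⟨norm_pos_iff.2 (sub_ne_zero.2 hzc), by linarith⟩ (fun him => ⟨?_, by linarith⟩)
    fun him => ?_
  · refine lt_of_le_of_ne (abs_nonneg _) fun h0 => hzc ?_
    rw [← h0] at him
    apply Complex.ext
    · rw [Complex.ofReal_re]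
      linarith [abs_eq_zero.1 h0.symm]
    · rw [Complex.ofReal_im]
      exact abs_nonpos_iff.1 (by simpa using him)
  · refine hρc.resolve_right fun hle => ?_
    have hneg : z.re < 0 := by
      by_contra! hge
      exact hz ⟨hge, him⟩
    have := neg_abs_le (z.re - c)
    linarith

theorem isBigO_lineCauchy_infty (hv : IsNodalHolder N v) (hN : ∀ c ∈ N, 0 < c) :
    ∃ β > (0 : ℝ), lineCauchy (zeroExtend v) =O[Bornology.cobounded ℂ ⊓ 𝓟 cutPlane]
      fun z => ‖z‖ ^ (-β) := by
  obtain ⟨α, R, hR, hE⟩ := hv.exists_endData_infty hN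
  obtain ⟨C, hC, h⟩ := hE.exists_norm_lineCauchy_le le_rfl fun μ hμ => zeroExtend_of_nonpos hμ
  refine ⟨α, hE.α_pos, IsBigO.of_bound C ?_⟩
  rw [eventually_inf_principal]
  -- In the sector `|Im z| ≤ |Re z| / 4` one has `‖z‖ ≤ 5 |Re z| / 4`, so `‖z‖ > 4 R` forces `|Re z|
  -- > 2 R`.
  filter_upwards [(tendsto_norm_cobounded_atTop (E := ℂ)).eventually_gt_atTop (4 * R)] with z hzR hz
  rw [Real.norm_of_nonneg (by positivity)]
  have := h z hz
  simp only [Complex.ofReal_zero, sub_zero] at this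
  refine this (mem_Ioi.2 (by linarith)) (fun him => mem_Ioi.2 ?_) fun _ => trivial
  linarith [Complex.norm_le_abs_re_add_abs_im z]

end IsNodalHolder

/-! ### Return to the half-axis and solution of the equations -/

theorem IsUpperValue.const_mul {H : ℂ → ℂ} {t : ℝ} {a : ℂ} (h : IsUpperValue H t a) (k : ℂ) :
    IsUpperValue (fun z => k * H z) t (k * a) := Tendsto.const_mul k h

theorem IsLowerValue.const_mul {H : ℂ → ℂ} {t : ℝ} {a : ℂ} (h : IsLowerValue H t a) (k : ℂ) :
    IsLowerValue (fun z => k * H z) t (k * a) := Tendsto.const_mul k h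

theorem IsUpperValue.sub {H G : ℂ → ℂ} {t : ℝ} {a b : ℂ} (h : IsUpperValue H t a)
    (h' : IsUpperValue G t b) : IsUpperValue (fun z => H z - G z) t (a - b) := Tendsto.sub h h'

theorem IsLowerValue.sub {H G : ℂ → ℂ} {t : ℝ} {a b : ℂ} (h : IsLowerValue H t a)
    (h' : IsLowerValue G t b) : IsLowerValue (fun z => H z - G z) t (a - b) := Tendsto.sub h h'

theorem IsUpperValue.congr_cutPlane {H G : ℂ → ℂ} {t : ℝ} {a : ℂ} (h : IsUpperValue H t a)
    (hHG : EqOn H G cutPlane) : IsUpperValue G t a :=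
  Tendsto.congr' (eventually_nhdsWithin_of_forall fun _ hz =>
    hHG (mem_cutPlane_of_im_ne_zero (ne_of_gt hz))) h

theorem IsLowerValue.congr_cutPlane {H G : ℂ → ℂ} {t : ℝ} {a : ℂ} (h : IsLowerValue H t a)
    (hHG : EqOn H G cutPlane) : IsLowerValue G t a :=
  Tendsto.congr' (eventually_nhdsWithin_of_forall fun _ hz =>
    hHG (mem_cutPlane_of_im_ne_zero (ne_of_lt hz))) h

theorem IsHolderOn.const_mul {f : ℝ → ℂ} {s : Set ℝ} (h : IsHolderOn f s) (a : ℂ) :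
    IsHolderOn (fun t => a * f t) s := by
  obtain ⟨C, r, hr, hf⟩ := h
  refine ⟨‖a‖₊ * C, r, hr, fun x hx y hy => ?_⟩
  have e : edist (a * f x) (a * f y) = ‖a‖₊ * edist (f x) (f y) := edist_smul₀ a (f x) (f y)
  rw [e, ENNReal.coe_mul, mul_assoc]
  exact mul_le_mul_right (hf x hx y hy) _

theorem IsNodalHolder.const_mul {N : Finset ℝ} {f : ℝ → ℂ} (h : IsNodalHolder N f) (a : ℂ) :
    IsNodalHolder N fun t => a * f t := by
  obtain ⟨h1, h2, h3, β, hβ, δ, hδ, h4⟩ := h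
  refine ⟨fun x y hxy => (h1 x y hxy).const_mul a, fun c hc => ?_, fun c hc => ?_,
    β, hβ, δ, hδ, ?_⟩
  · obtain ⟨α, hα, δ, hδ, h⟩ := h2 c hc
    exact ⟨α, hα, δ, hδ, by simpa only [mul_left_comm] using h.const_mul a⟩
  · obtain ⟨α, hα, δ, hδ, h⟩ := h3 c hc
    exact ⟨α, hα, δ, hδ, by simpa only [mul_left_comm] using h.const_mul a⟩
  · simpa only [mul_left_comm] using h4.const_mul a

theorem zeroExtend_div (v : ℝ → ℂ) (z : ℂ) :
    (fun μ : ℝ => zeroExtend v μ / ((μ : ℂ) - z)) =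
      (Ioi (0 : ℝ)).indicator fun μ : ℝ => v μ / ((μ : ℂ) - z) := by
  ext μ
  rcases lt_or_ge 0 μ with h | h
  · rw [zeroExtend_of_pos h, indicator_of_mem (mem_Ioi.2 h)]
  · rw [zeroExtend_of_nonpos h, indicator_of_notMem (by simpa using h), zero_div]

theorem cauchyIntegral_eq (v : ℝ → ℂ) : cauchyIntegral v =
    fun z => 1 / ((Real.pi : ℂ) * Complex.I) * lineCauchy (zeroExtend v) z := by
  ext z
  rw [cauchyIntegral, lineCauchy, zeroExtend_div, integral_indicator measurableSet_Ioi]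

theorem truncatedCauchyIntegral_eq (v : ℝ → ℂ) (t ε : ℝ) : truncatedCauchyIntegral v t ε =
    1 / ((Real.pi : ℂ) * Complex.I) * truncatedLineCauchy (zeroExtend v) t ε := by
  rw [truncatedCauchyIntegral, truncatedLineCauchy, zeroExtend_div,
    setIntegral_indicator measurableSet_Ioi]
  congr 3
  ext μ
  exact and_comm

namespace IsNodalHolder

variable {N : Finset ℝ} {v : ℝ → ℂ}

/-- Both one-sided limits contain the same principal value, since the truncated integral has only
one limit; after division by `π i` the Plemelj terms become `± v t`. -/
theorem exists_boundary_values (hv : IsNodalHolder N v) (hN : ∀ c ∈ N, 0 < c) {t : ℝ}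
    (ht : 0 < t) (htN : t ∉ N) : ∃ P : ℂ, IsUpperValue (cauchyIntegral v) t (v t + P) ∧
      IsLowerValue (cauchyIntegral v) t (-v t + P) ∧
      Tendsto (fun ε => truncatedCauchyIntegral v t ε) (𝓝[>] 0) (𝓝 P) := by
  obtain ⟨η, r, A, hη, hr, hr1, hL⟩ := hv.exists_localBound hN (le_refl t) (by
    intro s hs; rw [Icc_self] at hs; rw [mem_singleton_iff.1 hs]; exact ⟨ht, htN⟩)
  have hLB := hL t ⟨le_rfl, le_rfl⟩
  obtain ⟨C, hC, hup⟩ := LocalBound.exists_upper hr hr1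
  obtain ⟨C', hC', hlo⟩ := LocalBound.exists_lower hr hr1
  obtain ⟨-, L, hL1, -, -, hL2⟩ := hup _ _ _ _ hLB
  obtain ⟨-, L', hL1', -, -, hL2'⟩ := hlo _ _ _ _ hLB
  rw [zeroExtend_of_pos ht] at hL2 hL2'
  set k : ℂ := (Real.pi : ℂ) * Complex.I with hk
  have hk0 : k ≠ 0 := by simp [hk, Real.pi_ne_zero]
  have h1 : Tendsto (fun ε => truncatedLineCauchy (zeroExtend v) t ε) (𝓝[>] 0)
      (𝓝 (L - k * v t)) := by
    refine (hL2.sub_const (k * v t)).congr fun ε => ?_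
    ring
  have h2 : Tendsto (fun ε => truncatedLineCauchy (zeroExtend v) t ε) (𝓝[>] 0)
      (𝓝 (L' + k * v t)) := by
    refine (hL2'.add_const (k * v t)).congr fun ε => ?_
    ring
  have hLL := tendsto_nhds_unique h1 h2
  refine ⟨1 / k * (L - k * v t), ?_, ?_, ?_⟩
  · rw [cauchyIntegral_eq]
    have := hL1.const_mul (1 / k)
    convert this using 1
    field_simp
    ring
  · rw [cauchyIntegral_eq]
    have := hL1'.const_mul (1 / k)
    convert this using 1
    rw [hLL]
    field_simp
    ring
  · simp only [truncatedCauchyIntegral_eq]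
    exact h1.const_mul (1 / k)

theorem analyticOnNhd_cauchyIntegral (hv : IsNodalHolder N v) (hN : ∀ c ∈ N, 0 < c) :
    AnalyticOnNhd ℂ (cauchyIntegral v) cutPlane := by
  obtain ⟨α, hα, hα1, hi⟩ := hv.exists_integrable_weight hN
  rw [cauchyIntegral_eq]
  exact ((differentiableOn_lineCauchy hα hα1 hv.aestronglyMeasurable_zeroExtend
    (fun μ hμ => zeroExtend_of_nonpos hμ) hi).const_mul _).analyticOnNhd isOpen_cutPlane

theorem isSectionallyAnalytic_cauchyIntegral (hv : IsNodalHolder N v) (hN : ∀ c ∈ N, 0 < c) :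
    IsSectionallyAnalytic N (cauchyIntegral v) := by
  set k : ℂ := (Real.pi : ℂ) * Complex.I with hk
  have hk0 : k ≠ 0 := by simp [hk, Real.pi_ne_zero]
  have hkk : ∀ a : ℂ, 1 / k * (k * a) = a := fun a => by field_simp
  have hkk' : ∀ a : ℂ, k * (1 / k * a) = a := fun a => by field_simp
  have hlin : lineCauchy (zeroExtend v) = fun z => k * cauchyIntegral v z := by
    ext z; rw [cauchyIntegral_eq, hkk']
  -- The boundary estimates concern the integral without its prefactor, so regularity is obtained
  -- for `k = π i` times the boundary values and divided out afterwards.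
  have hcontrol : ∀ B : (ℂ → ℂ) → ℝ → ℂ → Prop,
      (∀ H t a, B H t a → ∀ c : ℂ, B (fun z => c * H z) t (c * a)) →
      BoundaryControl (zeroExtend v) (B (lineCauchy (zeroExtend v))) →
      ∀ g : ℝ → ℂ, (∀ t, 0 < t → t ∉ N → B (cauchyIntegral v) t (g t)) →
      IsNodalHolder N fun t => k * g t := fun B hmul hB g hg =>
    hv.of_boundaryControl hN hB fun t ht htN => by
      rw [hlin]
      exact hmul _ _ _ (hg t ht htN) k
  have hex := fun t (h : 0 < t ∧ t ∉ N) => hv.exists_boundary_values hN h.1 h.2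
  choose! P hP using hex
  have hUp := hcontrol IsUpperValue (fun H t a h c => h.const_mul c) (boundaryControl_upper _)
    (fun t => v t + P t) fun t ht htN => (hP t ⟨ht, htN⟩).1
  have hLo := hcontrol IsLowerValue (fun H t a h c => h.const_mul c) (boundaryControl_lower _)
    (fun t => -v t + P t) fun t ht htN => (hP t ⟨ht, htN⟩).2.1
  refine ⟨hv.analyticOnNhd_cauchyIntegral hN, ⟨fun t => v t + P t, fun t => -v t + P t, ?_, ?_,
    fun t ht htN => ⟨(hP t ⟨ht, htN⟩).1, (hP t ⟨ht, htN⟩).2.1⟩⟩, fun c hc => ?_, ?_⟩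
  · simpa only [hkk] using hUp.const_mul (1 / k)
  · simpa only [hkk] using hLo.const_mul (1 / k)
  · obtain ⟨α, hα, h⟩ := hv.isBigO_lineCauchy_node hN hc
    exact ⟨α, hα, by rw [cauchyIntegral_eq]; exact h.const_mul_left _⟩
  · obtain ⟨β, hβ, h⟩ := hv.isBigO_lineCauchy_infty hN
    exact ⟨β, hβ, by rw [cauchyIntegral_eq]; exact h.const_mul_left _⟩

theorem isSolutionOffCut (hv : IsNodalHolder N v) (hN : ∀ c ∈ N, 0 < c) {H : ℂ → ℂ}
    (h : EqOn (cauchyIntegral v) H cutPlane) : IsSolutionOffCut N v H := by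
  refine ⟨hv, fun z hz => ⟨?_, h hz⟩⟩
  obtain ⟨ρ, hρ, hdist⟩ := exists_ball_dist_le hz
  refine (hv.integrableOn_zeroExtend_div hN measurableSet_Ioi hρ fun μ _ hμ =>
    hdist z (Metric.mem_ball_self hρ) μ hμ).congr_fun (fun μ hμ => ?_) measurableSet_Ioi
  beta_reduce
  rw [zeroExtend_of_pos hμ]

theorem isSolutionOnAxis (hv : IsNodalHolder N v) (hN : ∀ c ∈ N, 0 < c) {h : ℝ → ℂ}
    (hh : ∀ t, 0 < t → t ∉ N → IsUpperValue (cauchyIntegral v) t (h t)) :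
    IsSolutionOnAxis N v h := by
  refine ⟨hv, fun t ht htN ε hε => ?_, fun t ht htN => ?_⟩
  · have hE : MeasurableSet {μ : ℝ | 0 < μ ∧ ε < |μ - t|} :=
      measurableSet_Ioi.inter (measurableSet_lt_abs_sub t ε)
    refine (hv.integrableOn_zeroExtend_div hN (z := t) hE hε fun μ hμ _ => ?_).congr_fun
      (fun μ hμ => ?_) hE
    · rw [← Complex.ofReal_sub, Complex.norm_real]
      exact hμ.2.le
    · beta_reduce
      rw [zeroExtend_of_pos hμ.1]
  · obtain ⟨P, h1, -, h2⟩ := hv.exists_boundary_values hN ht htN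
    rw [(hh t ht htN).unique h1]
    exact h2.const_add (v t)

end IsNodalHolder

/-- The Plemelj formula turns the singular integral equation into a boundary condition for an
analytic function. -/
theorem IsSolutionOnAxis.isUpperValue {N : Finset ℝ} {v h : ℝ → ℂ} (hN : ∀ c ∈ N, 0 < c)
    (hv : IsSolutionOnAxis N v h) {t : ℝ} (ht : 0 < t) (htN : t ∉ N) :
    IsUpperValue (cauchyIntegral v) t (h t) := by
  obtain ⟨P, h1, -, h2⟩ := hv.density.exists_boundary_values hN ht htN
  rwa [tendsto_nhds_unique (hv.equation t ht htN) (h2.const_add (v t))]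

theorem exists_half_jump {N : Finset ℝ} {v : ℝ → ℂ} {H : ℂ → ℂ} (hN : ∀ c ∈ N, 0 < c)
    (hv : IsNodalHolder N v) (h : EqOn (cauchyIntegral v) H cutPlane) {t : ℝ}
    (ht : 0 < t) (htN : t ∉ N) :
    ∃ a b : ℂ, IsUpperValue H t a ∧ IsLowerValue H t b ∧ v t = (a - b) / 2 := by
  obtain ⟨P, h1, h2, -⟩ := hv.exists_boundary_values hN ht htN
  exact ⟨_, _, h1.congr_cutPlane h, h2.congr_cutPlane h, by ring⟩

theorem eq_of_eqOn_cauchyIntegral {N : Finset ℝ} {v w : ℝ → ℂ} {H : ℂ → ℂ} (hN : ∀ c ∈ N, 0 < c)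
    (hv : IsNodalHolder N v) (hw : IsNodalHolder N w) (h : EqOn (cauchyIntegral v) H cutPlane)
    (h' : EqOn (cauchyIntegral w) H cutPlane) {t : ℝ} (ht : 0 < t) (htN : t ∉ N) : v t = w t := by
  obtain ⟨a, b, ha, hb, e⟩ := exists_half_jump hN hv h ht htN
  obtain ⟨a', b', ha', hb', e'⟩ := exists_half_jump hN hw h' ht htN
  rw [e, e', ha.unique ha', hb.unique hb']

theorem eqOn_of_isUpperValue {N : Finset ℝ} {G H : ℂ → ℂ} (hG : AnalyticOnNhd ℂ G cutPlane)
    (hH : AnalyticOnNhd ℂ H cutPlane) {h : ℝ → ℂ}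
    (hGh : ∀ t, 0 < t → t ∉ N → IsUpperValue G t (h t))
    (hHh : ∀ t, 0 < t → t ∉ N → IsUpperValue H t (h t)) : EqOn G H cutPlane := fun z hz => by
  have := eqOn_zero_of_isUpperValue_zero (N := N) (fun x hx => (hG x hx).fun_sub (hH x hx)) (fun t ht htN => by
    simpa using (hGh t ht htN).sub (hHh t ht htN)) hz
  exact sub_eq_zero.1 this

/-- Subtracting `H` from the Cauchy integral of half its jump cancels the jump. Both functions obey
the bounds at the nodes and at infinity, so after taking the worse exponents the Liouville argument
applies. -/
theorem IsSectionallyAnalytic.eqOn_cauchyIntegral {N : Finset ℝ} {H : ℂ → ℂ}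
    (hN : ∀ c ∈ N, 0 < c) (hH : IsSectionallyAnalytic N H) {Hp Hm : ℝ → ℂ}
    (hpm : ∀ t : ℝ, 0 < t → t ∉ N → IsUpperValue H t (Hp t) ∧ IsLowerValue H t (Hm t))
    (hv : IsNodalHolder N fun t => (Hp t - Hm t) / 2) :
    EqOn (cauchyIntegral fun t => (Hp t - Hm t) / 2) H cutPlane := by
  have hC := hv.isSectionallyAnalytic_cauchyIntegral hN
  have key := eqOn_zero_of_no_jump hN
    (fun x hx => (hC.analytic_off_cut x hx).fun_sub (hH.analytic_off_cut x hx))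
    (fun t ht htN => ?_) (fun c hc => ?_) ?_
  · exact fun z hz => sub_eq_zero.1 (key hz)
  · obtain ⟨P, h1, h2, -⟩ := hv.exists_boundary_values hN ht htN
    obtain ⟨h3, h4⟩ := hpm t ht htN
    refine ⟨_, h1.sub h3, ?_⟩
    convert h2.sub h4 using 1
    ring
  · obtain ⟨α, hα, h1⟩ := hC.at_node c hc
    obtain ⟨α', hα', h2⟩ := hH.at_node c hc
    have hmono : ∀ γ ≤ max α α', (fun z : ℂ => ‖z - (c : ℂ)‖ ^ (-γ)) =O[𝓝[cutPlane] (c : ℂ)]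
        fun z => ‖z - (c : ℂ)‖ ^ (-max α α') := by
      intro γ hγ
      refine IsBigO.of_bound 1 ?_
      have hc0 : 0 ≤ c := hc.elim (fun h => h.ge) fun h => (hN c h).le
      filter_upwards [self_mem_nhdsWithin,
        mem_nhdsWithin_of_mem_nhds (Metric.ball_mem_nhds (c : ℂ) one_pos)] with z hz hz1
      rw [Metric.mem_ball, dist_eq_norm] at hz1
      rw [one_mul, Real.norm_of_nonneg (by positivity), Real.norm_of_nonneg (by positivity)]
      refine Real.rpow_le_rpow_of_exponent_ge (norm_pos_iff.2 (sub_ne_zero.2 ?_)) hz1.le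
        (neg_le_neg hγ)
      rintro rfl
      exact hz ⟨by simpa using hc0, by simp⟩
    exact ⟨max α α', max_lt hα hα', (h1.trans (hmono α (le_max_left _ _))).sub
      (h2.trans (hmono α' (le_max_right _ _)))⟩
  · obtain ⟨β, hβ, h1⟩ := hC.at_infinity
    obtain ⟨β', hβ', h2⟩ := hH.at_infinity
    have hmono : ∀ γ ≥ min β β', (fun z : ℂ => ‖z‖ ^ (-γ))
        =O[Bornology.cobounded ℂ ⊓ 𝓟 cutPlane] fun z => ‖z‖ ^ (-min β β') := by
      intro γ hγ
      refine IsBigO.of_bound 1 ?_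
      rw [eventually_inf_principal]
      filter_upwards [(tendsto_norm_cobounded_atTop (E := ℂ)).eventually_gt_atTop 1] with z hz _
      rw [one_mul, Real.norm_of_nonneg (by positivity), Real.norm_of_nonneg (by positivity)]
      exact Real.rpow_le_rpow_of_exponent_le hz.le (neg_le_neg hγ)
    exact ⟨min β β', lt_min hβ hβ', (h1.trans (hmono β (min_le_left _ _))).sub
      (h2.trans (hmono β' (min_le_right _ _)))⟩

theorem IsSectionallyAnalytic.congr {N : Finset ℝ} {G H : ℂ → ℂ} (hG : IsSectionallyAnalytic N G)
    (h : EqOn G H cutPlane) : IsSectionallyAnalytic N H := by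
  obtain ⟨h1, ⟨Hp, Hm, hp, hm, hb⟩, h3, β, hβ, h4⟩ := hG
  refine ⟨h1.congr isOpen_cutPlane h, ⟨Hp, Hm, hp, hm, fun t ht htN =>
    ⟨(hb t ht htN).1.congr_cutPlane h, (hb t ht htN).2.congr_cutPlane h⟩⟩, fun c hc => ?_,
    β, hβ, h4.congr' ?_ .rfl⟩
  · obtain ⟨α, hα, h5⟩ := h3 c hc
    exact ⟨α, hα, h5.congr' (eventually_nhdsWithin_of_forall h) .rfl⟩
  · exact eventually_inf_principal.2 (Eventually.of_forall h)

theorem IsSectionallyAnalytic.exists_density {N : Finset ℝ} {H : ℂ → ℂ} (hN : ∀ c ∈ N, 0 < c)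
    (hH : IsSectionallyAnalytic N H) :
    ∃ v : ℝ → ℂ, IsNodalHolder N v ∧ EqOn (cauchyIntegral v) H cutPlane := by
  obtain ⟨Hp, Hm, hp, hm, hb⟩ := hH.boundary_values
  exact ⟨_, hp.half_sub hm, hH.eqOn_cauchyIntegral hN hb (hp.half_sub hm)⟩

theorem mainTheorem2 (N : Finset ℝ) (hN : ∀ c ∈ N, 0 < c) :
    (∀ H : ℂ → ℂ,
      ((∃ v : ℝ → ℂ, IsSolutionOffCut N v H) ↔ IsSectionallyAnalytic N H) ∧
      (∀ v w : ℝ → ℂ, IsSolutionOffCut N v H → IsSolutionOffCut N w H →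
        ∀ t : ℝ, 0 < t → t ∉ N → v t = w t) ∧
      (∀ v : ℝ → ℂ, IsSolutionOffCut N v H → ∀ t : ℝ, 0 < t → t ∉ N →
        ∃ a b : ℂ, IsUpperValue H t a ∧ IsLowerValue H t b ∧ v t = (a - b) / 2)) ∧
    (∀ h : ℝ → ℂ,
      ((∃ v : ℝ → ℂ, IsSolutionOnAxis N v h) ↔
        ∃ H : ℂ → ℂ, IsSectionallyAnalytic N H ∧
          ∀ t : ℝ, 0 < t → t ∉ N → IsUpperValue H t (h t)) ∧
      (∀ v w : ℝ → ℂ, IsSolutionOnAxis N v h → IsSolutionOnAxis N w h →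
        ∀ t : ℝ, 0 < t → t ∉ N → v t = w t) ∧
      (∀ (v : ℝ → ℂ) (H : ℂ → ℂ), IsSolutionOnAxis N v h → IsSectionallyAnalytic N H →
        (∀ t : ℝ, 0 < t → t ∉ N → IsUpperValue H t (h t)) →
        (∀ z ∈ cutPlane, cauchyIntegral v z = H z) ∧
        ∀ t : ℝ, 0 < t → t ∉ N →
          ∃ b : ℂ, IsLowerValue H t b ∧ v t = (h t - b) / 2)) := by
  have hoff : ∀ (v : ℝ → ℂ) (H : ℂ → ℂ), IsSolutionOffCut N v H →
      EqOn (cauchyIntegral v) H cutPlane := fun v H hv z hz => (hv.equation z hz).2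
  -- Upper values alone determine the function off the cut. This reduces the equation on the axis to
  -- the one with a complex variable.
  have haxis : ∀ (v h : ℝ → ℂ) (H : ℂ → ℂ), IsSolutionOnAxis N v h →
      AnalyticOnNhd ℂ H cutPlane → (∀ t : ℝ, 0 < t → t ∉ N → IsUpperValue H t (h t)) →
      EqOn (cauchyIntegral v) H cutPlane := fun v h H hv hH hh =>
    eqOn_of_isUpperValue (hv.density.analyticOnNhd_cauchyIntegral hN) hH
      (fun t ht htN => hv.isUpperValue hN ht htN) hh
  refine ⟨fun H => ⟨⟨?_, fun hH => ?_⟩, fun v w hv hw t ht htN => ?_, fun v hv t ht htN => ?_⟩,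
    fun h => ⟨⟨?_, ?_⟩, fun v w hv hw t ht htN => ?_, fun v H hv hH hh => ?_⟩⟩
  · rintro ⟨v, hv⟩
    exact (hv.density.isSectionallyAnalytic_cauchyIntegral hN).congr (hoff v H hv)
  · obtain ⟨v, hv, hvH⟩ := hH.exists_density hN
    exact ⟨v, hv.isSolutionOffCut hN hvH⟩
  · exact eq_of_eqOn_cauchyIntegral hN hv.density hw.density (hoff v H hv) (hoff w H hw) ht htN
  · exact exists_half_jump hN hv.density (hoff v H hv) ht htN
  · rintro ⟨v, hv⟩
    exact ⟨cauchyIntegral v, hv.density.isSectionallyAnalytic_cauchyIntegral hN,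
      fun t ht htN => hv.isUpperValue hN ht htN⟩
  · rintro ⟨H, hH, hh⟩
    obtain ⟨v, hv, hvH⟩ := hH.exists_density hN
    exact ⟨v, hv.isSolutionOnAxis hN fun t ht htN => (hh t ht htN).congr_cutPlane hvH.symm⟩
  · exact eq_of_eqOn_cauchyIntegral hN hv.density hw.density
      -- The second solution supplies the comparison function: both Cauchy integrals have the upper
      -- value `h`, hence they agree and have the same half jump.
      (haxis v h _ hv (hw.density.analyticOnNhd_cauchyIntegral hN)
        fun t ht htN => hw.isUpperValue hN ht htN) (fun _ _ => rfl) ht htN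
  · have heq := haxis v h H hv hH.analytic_off_cut hh
    refine ⟨heq, fun t ht htN => ?_⟩
    obtain ⟨a, b, ha, hb, e⟩ := exists_half_jump hN hv.density heq ht htN
    exact ⟨b, hb, by rw [e, ha.unique (hh t ht htN)]⟩
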